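/- Let $k$ be a field of characteristic zero and let $A$ be a homologically smooth $k$-algebra, i.e. $A$ has a finite resolution by finitely generated projective $A^e=A\otimes_k A^{op}$-modules. Write $\bar A=A/k$ and let $\bar C_\bullet=\bigoplus_n A\otimes\bar A^{\otimes n}$ be the normalized Hochschild chains with Hochschild differential $\mathsf b$ and Connes differential $\mathsf B$; let $\overline{CC}{}^-_\bullet=(\bar C_\bullet[[u]],\mathsf b+u\mathsf B)$ (with $u$ of homological degree $-2$) be the normalized negative cyclic complex, $HC^-_\bullet(A)$ its homology, and $\pi\colon HC^-_n(A)\to HH_n(A)$ the map $\sum_i c_iu^i\mapsto c_0$. Let $\bar{\mathfrak C}^\bullet$ be the normalized Hochschild cochains, where a cochain $x$ with $p+1$ arguments has degree $|x|=p$, with $x\{y\}(a_1,\dots,a_n)=\sum_i(-1)^{|y|i}x(a_1,\dots,a_i,y(a_{i+1},\dots),\dots,a_n)$, Gerstenhaber bracket $[x,y]=x\{y\}-(-1)^{|x||y|}y\{x\}$, differential $dx=[\mu,x]$ for $\mu(a,b)=-ab$, and cup product $(x\cup y)(a_1,\dots)=(-1)^{(|x|+1)(|y|+1)}x(a_1,\dots)\,y(\dots)$.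 For $x\in\bar{\mathfrak C}^p$ put $$i_x(a_0\otimes\dots\otimes a_n)=a_0x(a_1,\dots,a_{p+1})\otimes a_{p+2}\otimes\dots\otimes a_n,$$ $$L_x(a_0\otimes\dots\otimes a_n)=\sum_{i=0}^{n-p-1}(-1)^{pi}a_0\otimes\dots\otimes a_i\otimes x(a_{i+1},\dots,a_{i+p+1})\otimes\dots\otimes a_n+\sum_{i=n-p}^{n}(-1)^{n(i+1)+p}x(a_{i+1},\dots,a_n,a_0,\dots,a_{p-n+i})\otimes\dots\otimes a_i$$ (the last sum being zero for $p>n$), and $$S_x(a_0\otimes\dots\otimes a_n)=\sum_{0\le j,\ j+p+1\le m\le n}(-1)^{p(j+m)+n(m+p+1)}\,1\otimes a_{m+1}\otimes\dots\otimes a_n\otimes a_0\otimes\dots\otimes a_j\otimes x(a_{j+1},\dots,a_{j+p+1})\otimes\dots\otimes a_m ,$$ all extended $u$-linearly to $\overline{CC}{}^-_\bullet$. Let $d\ge 0$ and let $\eta_0\in\overline{CC}{}^-_d$ be a cycle whose image $\pi(\bar\eta_0)\in HH_d(A)$ is nondegenerate, i.e. the morphism $\mathrm{RHom}_{A^e}(A,A^e)\to\Sigma^{-d}A$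 in $D(A^e)$ defined by it (evaluation at $\pi(\eta_0)$) is an isomorphism; so $(A,\bar\eta_0)$ is a $d$-Calabi–Yau algebra. Let $\mathfrak D^\bullet=\mathfrak D^\bullet(A,\eta_0)$ be the DG-Lie algebra $\bar{\mathfrak C}^\bullet\oplus\Sigma^{-d-1}\overline{CC}{}^-_\bullet$ with bracket $[(x,m),(y,m')]=([x,y],L_xm'-(-1)^{|y||m|}L_ym)$ and differential $(x,m)\mapsto(dx,(\mathsf b+u\mathsf B)m-(-1)^{|x|}L_x(s^{-d-1}\eta_0))$, where an operator $\varphi$ acts on shifts by $\varphi(s^rc)=(-1)^{r|\varphi|}s^r\varphi(c)$ ($|\varphi|$ the cohomological degree, so $|i_x|=|x|+1$, $|L_x|=|x|$, $|S_x|=|x|-1$), and let $$\Psi\colon\mathfrak D^\bullet\to\Sigma^{-d+1}\overline{CC}{}^-_\bullet,\qquad (x,s^{-d-1}\eta)\mapsto(-1)^{|x|-1}(i_x+uS_x)(s^{-d+1}\eta_0)+u\,s^{-d+1}\eta .$$ Then the operations $\cup$, $x\mapsto x\cap\pi(\eta_0)=i_x\pi(\eta_0)$, $\pi$, $\mathsf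 B$, the bracket of $\mathfrak D^\bullet$ and $\Psi$ descend to (co)homology; $-\cap\pi(\bar\eta_0)\colon HH^i(A)\to HH_{d-i}(A)$ is an isomorphism for all $i$, with inverse denoted $j$; and $\Psi$ is a quasi-isomorphism, so that $H^p(\mathfrak D^\bullet)\cong HC^-_{d-1-p}(A)$ for all $p$. With $a\cdot b=(j(a)\cup j(b))\cap\pi(\bar\eta_0)$ on $HH_\bullet(A)$ and $\mathsf B\colon HH_q(A)\to HC^-_{q+1}(A)$, $\bar\nu\mapsto\overline{\mathsf B\nu}$, the Lie bracket that $\Psi$ induces on $HC^-_\bullet(A)$ is $$HC^-_n(A)\times HC^-_m(A)\to HC^-_{n+m-d+1}(A),\qquad [\eta_1,\eta_2]=(-1)^{|\eta_1|+d}\,\mathsf B(\pi(\eta_1)\cdot\pi(\eta_2)),$$ where $|\eta_1|=d-1-n$ is the degree of $\eta_1\in HC^-_n(A)$ in $H^\bullet(\Sigma^{-d+1}\overline{CC}{}^-_\bullet)$; that is, the sign is $(-1)^{n+1}$. -/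

import Mathlib

open scoped TensorProduct

namespace NCCalculus

universe u v w

set_option linter.unusedSectionVars false

section Lists

variable (k : Type u) {A : Type v} [Field k] [Ring A] [Algebra k A]

/-- `f (a₁, …, aₙ)` is `k`-linear in every entry of the list, for every length `n`. -/
def SlotLinear {M : Type w} [AddCommGroup M] [Module k M] (f : List A → M) : Prop :=
  ∀ (s t : List A) (c : k) (y z : A),
    f (s ++ (c • y + z) :: t) = c • f (s ++ y :: t) + f (s ++ z :: t)

/-- `(a₀, …, a_{j-1}, x (a_j, …, a_{j+p-1}), a_{j+p}, …)`. -/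
def ins (x : List A → A) (p j : ℕ) (l : List A) : List A :=
  l.take j ++ x ((l.drop j).take p) :: l.drop (j + p)

/-- The multiplication of `A` as a function on lists, supported on lists of length two. -/
def mulList : List A → A
  | [a, b] => a * b
  | _ => 0

variable {k}

theorem SlotLinear.eq_zero {M : Type w} [AddCommGroup M] [Module k M] {f : List A → M}
    (hf : SlotLinear k f) {l : List A} (hl : (0 : A) ∈ l) : f l = 0 := by
  obtain ⟨s, t, rfl⟩ := List.append_of_mem hl
  have h := hf s t (-1 : k) 0 0
  simpa using h

theorem SlotLinear.rotate {M : Type w} [AddCommGroup M] [Module k M] {f : List A → M}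
    (hf : SlotLinear k f) (i : ℕ) : SlotLinear k (fun l => f (l.rotate i)) := by
  induction i generalizing f with
  | zero => simpa using hf
  | succ i ih =>
    have h1 : SlotLinear k (fun l => f (l.rotate 1)) := by
      intro s t c y z
      cases s with
      | nil => simpa using hf t [] c y z
      | cons a s => simpa using hf s (t ++ [a]) c y z
    have := ih h1
    simpa [List.rotate_rotate] using this

theorem SlotLinear.ins {M : Type w} [AddCommGroup M] [Module k M] {f : List A → M}
    (hf : SlotLinear k f) {x : List A → A} (hx : SlotLinear k x) (p j : ℕ) :
    SlotLinear k (fun l => f (ins x p j l)) := by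
  intro s t c y z
  rcases lt_or_ge s.length j with h1 | h1
  · obtain ⟨e, rfl⟩ : ∃ e, j = s.length + (e + 1) := ⟨j - s.length - 1, by omega⟩
    have key : ∀ a : A, NCCalculus.ins x p (s.length + (e + 1)) (s ++ a :: t)
        = s ++ a :: NCCalculus.ins x p e t := by
      intro a
      have : s.length + (e + 1) + p = s.length + ((e + p) + 1) := by omega
      have d1 : ∀ r, List.drop (s.length + r) s = [] := fun r => List.drop_eq_nil_of_le (by omega)
      have t1 : ∀ r, List.take (s.length + r) s = s := fun r => List.take_of_length_le (by omega)
      simp [NCCalculus.ins, List.take_append, List.drop_append, this, d1, t1]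
    simpa [key] using hf s (NCCalculus.ins x p e t) c y z
  · obtain ⟨s1, s2, rfl, rfl⟩ : ∃ s1 s2, s = s1 ++ s2 ∧ s1.length = j :=
      ⟨s.take j, s.drop j, by simp, by simp [h1]⟩
    rcases lt_or_ge s2.length p with h2 | h2
    · obtain ⟨e, rfl⟩ : ∃ e, p = s2.length + (e + 1) := ⟨p - s2.length - 1, by omega⟩
      have key : ∀ a : A, NCCalculus.ins x (s2.length + (e + 1)) s1.length (s1 ++ s2 ++ a :: t)
          = s1 ++ x (s2 ++ a :: t.take e) :: t.drop e := by
        intro a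
        have d1 : ∀ r, List.drop (s1.length + r) s1 = [] :=
          fun r => List.drop_eq_nil_of_le (by omega)
        have d2 : ∀ r, List.drop (s2.length + r) s2 = [] :=
          fun r => List.drop_eq_nil_of_le (by omega)
        have t2 : ∀ r, List.take (s2.length + r) s2 = s2 :=
          fun r => List.take_of_length_le (by omega)
        simp [NCCalculus.ins, List.take_append, List.drop_append, d1, d2, t2]
      simp only [key, hx s2 (t.take e) c y z]
      exact hf _ _ _ _ _
    · obtain ⟨s2, s3, rfl, rfl⟩ : ∃ s2' s3, s2 = s2' ++ s3 ∧ s2'.length = p :=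
        ⟨s2.take p, s2.drop p, by simp, by simp [h2]⟩
      have key : ∀ a : A, NCCalculus.ins x s2.length s1.length (s1 ++ (s2 ++ s3) ++ a :: t)
          = (s1 ++ x s2 :: s3) ++ a :: t := by
        intro a
        simp [NCCalculus.ins, List.drop_append]
      simp only [key]
      exact hf _ _ _ _ _

theorem slotLinear_mulList : SlotLinear k (mulList (A := A)) := by
  intro s t c y z
  rcases s with _ | ⟨a, _ | ⟨b, s⟩⟩ <;> rcases t with _ | ⟨a', _ | ⟨b', t⟩⟩ <;>
    simp [mulList, mul_add, add_mul]

theorem SlotLinear.sum {M : Type w} [AddCommGroup M] [Module k M] {f : List A → ℕ → M}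
    (g : ℕ → ℕ) (hf : ∀ i, SlotLinear k (fun l => f l i)) :
    SlotLinear k (fun l => ∑ i ∈ Finset.range (g l.length), f l i) := by
  intro s t c y z
  simp only [List.length_append, List.length_cons, Finset.smul_sum, ← Finset.sum_add_distrib]
  exact Finset.sum_congr rfl fun i _ => hf i s t c y z

theorem SlotLinear.smul_length {M : Type w} [AddCommGroup M] [Module k M] {f : List A → M}
    (g : ℕ → k) (hf : SlotLinear k f) : SlotLinear k (fun l => g l.length • f l) := by
  intro s t c y z
  simp only [List.length_append, List.length_cons, hf s t c y z, smul_add]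
  rw [smul_comm]

theorem SlotLinear.add {M : Type w} [AddCommGroup M] [Module k M] {f g : List A → M}
    (hf : SlotLinear k f) (hg : SlotLinear k g) : SlotLinear k (fun l => f l + g l) := by
  intro s t c y z
  simp only [hf s t c y z, hg s t c y z, smul_add]
  abel

theorem SlotLinear.sub {M : Type w} [AddCommGroup M] [Module k M] {f g : List A → M}
    (hf : SlotLinear k f) (hg : SlotLinear k g) : SlotLinear k (fun l => f l - g l) := by
  intro s t c y z
  simp only [hf s t c y z, hg s t c y z, smul_sub]
  abel

theorem SlotLinear.ite_length {M : Type w} [AddCommGroup M] [Module k M] {f g : List A → M}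
    (P : ℕ → Prop) [DecidablePred P] (hf : SlotLinear k f) (hg : SlotLinear k g) :
    SlotLinear k (fun l => if P l.length then f l else g l) := by
  intro s t c y z
  simp only [List.length_append, List.length_cons]
  split_ifs
  · exact hf s t c y z
  · exact hg s t c y z

theorem SlotLinear.cons {M : Type w} [AddCommGroup M] [Module k M] {f : List A → M}
    (hf : SlotLinear k f) (a : A) : SlotLinear k (fun l => f (a :: l)) :=
  fun s t c y z => hf (a :: s) t c y z

theorem ins_mul (s t : List A) (a b : A) :
    ins mulList 2 s.length (s ++ a :: b :: t) = s ++ (a * b) :: t := by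
  simp [ins, List.drop_append, mulList]

theorem length_ins (x : List A → A) {p j : ℕ} {l : List A} (h : j + p ≤ l.length) :
    (ins x p j l).length + p = l.length + 1 := by
  simp [ins]; omega

theorem mem_ins {p j : ℕ} {l : List A} {a : A} (h : a ∈ l) :
    a ∈ (l.drop j).take p ∨ a ∈ l.take j ∨ a ∈ l.drop (j + p) := by
  rw [← List.take_append_drop j l, List.mem_append] at h
  rcases h with h | h
  · exact Or.inr (Or.inl h)
  · rw [← List.take_append_drop p (l.drop j), List.mem_append, List.drop_drop] at h
    tauto

end Lists

section Cochains

variable (k : Type u) (A : Type v) [Field k] [Ring A] [Algebra k A]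
variable (M : Type w) [AddCommGroup M] [Module k M]

/-- Normalized `M`-valued cochains with `n` arguments, `Hom_k ((A / k)^{⊗ n}, M)`, as functions
on lists supported on the lists of length `n`. -/
def MCochain (n : ℤ) : Submodule k (List A → M) where
  carrier := {f | SlotLinear k f ∧ (∀ l, (1 : A) ∈ l → f l = 0) ∧
    ∀ l, (l.length : ℤ) ≠ n → f l = 0}
  add_mem' := by
    rintro f g ⟨hf1, hf2, hf3⟩ ⟨hg1, hg2, hg3⟩
    exact ⟨hf1.add hg1, fun l hl => by simp [hf2 l hl, hg2 l hl],
      fun l hl => by simp [hf3 l hl, hg3 l hl]⟩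
  zero_mem' := ⟨fun s t c y z => by simp, fun l _ => rfl, fun l _ => rfl⟩
  smul_mem' := by
    rintro c f ⟨hf1, hf2, hf3⟩
    exact ⟨hf1.smul_length (fun _ => c), fun l hl => by simp [hf2 l hl],
      fun l hl => by simp [hf3 l hl]⟩

variable {k A M}

/-- The Hochschild coboundary
`(a₁, …, aₙ) ↦ a₁ f(a₂, …) + ∑ (-1)ⁱ f(…, aᵢ aᵢ₊₁, …) + (-1)ⁿ f(a₁, …, aₙ₋₁) aₙ`
for the bimodule `M` with left action `lft` and right action `rgt`. -/
def hochFun (lft rgt : A →ₗ[k] M →ₗ[k] M) (f : List A → M) (l : List A) : M :=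
  lft (l.headD 0) (f l.tail)
    + (∑ i ∈ Finset.range (l.length - 1), (-1 : k) ^ (i + 1) • f (ins mulList 2 i l))
    + (-1 : k) ^ l.length • rgt (l.getLastD 0) (f l.dropLast)

theorem slotLinear_hochFun (lft rgt : A →ₗ[k] M →ₗ[k] M) {f : List A → M}
    (hf : SlotLinear k f) : SlotLinear k (hochFun lft rgt f) := by
  have h1 : SlotLinear k (fun l : List A => lft (l.headD 0) (f l.tail)) := by
    intro s t c y z
    cases s with
    | nil => simp
    | cons a s => simp [hf s t c y z]
  have h3 : SlotLinear k (fun l : List A => rgt (l.getLastD 0) (f l.dropLast)) := by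
    intro s t c y z
    rcases List.eq_nil_or_concat t with rfl | ⟨t, a, rfl⟩
    · simp
    · have e : ∀ b : A, s ++ b :: t.concat a = (s ++ b :: t) ++ [a] := by simp
      simp only [e, List.dropLast_concat, List.getLastD_concat, hf s t c y z, map_add, map_smul]
  exact (h1.add (SlotLinear.sum (fun n => n - 1) fun i =>
    (hf.ins slotLinear_mulList 2 i).smul_length (fun _ => (-1 : k) ^ (i + 1)))).add
    (h3.smul_length fun n => (-1 : k) ^ n)

theorem hochFun_one (lft rgt : A →ₗ[k] M →ₗ[k] M) (hl : lft 1 = LinearMap.id)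
    (hr : rgt 1 = LinearMap.id) {f : List A → M}
    (hf1 : ∀ l, (1 : A) ∈ l → f l = 0) {l : List A} (h : (1 : A) ∈ l) :
    hochFun lft rgt f l = 0 := by
  obtain ⟨s, t, rfl⟩ := List.append_of_mem h
  have hterm : ∀ i, i ≠ s.length → i + 1 ≠ s.length → f (ins mulList 2 i (s ++ 1 :: t)) = 0 := by
    intro i h1 h2
    apply hf1
    rcases lt_or_ge i s.length with h3 | h3
    · have : (1 : A) ∈ List.drop (i + 2) (s ++ 1 :: t) := by
        rw [List.drop_append_of_le_length (by omega)]; simp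
      simp only [ins, List.mem_append, List.mem_cons]; tauto
    · obtain ⟨e, rfl⟩ : ∃ e, i = s.length + (e + 1) := ⟨i - s.length - 1, by omega⟩
      simp [ins, List.take_append]
  rcases List.eq_nil_or_concat s with rfl | ⟨s, b, rfl⟩
  · rcases t with _ | ⟨c, t⟩
    · simp [hochFun, hl, hr]
    · have hlast : f ((1 :: c :: t).dropLast) = 0 := hf1 _ (by simp)
      have hs : ∑ i ∈ Finset.range ((1 :: c :: t).length - 1),
          (-1 : k) ^ (i + 1) • f (ins mulList 2 i (1 :: c :: t)) = - f (c :: t) := by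
        rw [Finset.sum_eq_single 0]
        · simp [ins, mulList]
        · intro i _ hi
          have := hterm i (by simpa using hi) (by simp)
          simp only [List.nil_append] at this
          simp [this]
        · simp
      simp only [List.nil_append] at *
      rw [hochFun, hs, hlast]
      simp [hl]
  · simp only [List.concat_eq_append, List.append_assoc, List.cons_append, List.nil_append] at *
    have hhead : f (s ++ b :: 1 :: t).tail = 0 := by
      apply hf1; cases s <;> simp
    have e1 : f (ins mulList 2 s.length (s ++ b :: 1 :: t)) = f (s ++ b :: t) := by
      rw [ins_mul]; simp
    rcases t with _ | ⟨c, t⟩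
    · have hs : ∑ i ∈ Finset.range ((s ++ b :: [1]).length - 1),
          (-1 : k) ^ (i + 1) • f (ins mulList 2 i (s ++ b :: [1]))
            = (-1 : k) ^ (s.length + 1) • f (s ++ [b]) := by
        rw [Finset.sum_eq_single s.length]
        · rw [e1]
        · intro i hi hi'
          simp at hi
          rw [hterm i (by simp; omega) (by simp; omega), smul_zero]
        · simp
      have e3 : s ++ [b, 1] = (s ++ [b]) ++ [1] := by simp
      rw [hochFun, hs, hhead, e3, List.dropLast_concat, List.getLastD_concat, hr]
      simp [pow_succ]
    · have e2 : f (ins mulList 2 (s.length + 1) (s ++ b :: 1 :: c :: t)) = f (s ++ b :: c :: t) := by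
        have := ins_mul (s ++ [b]) t 1 c
        simp only [List.append_assoc, List.cons_append, List.nil_append, List.length_append,
          List.length_cons, List.length_nil, zero_add, one_mul] at this
        rw [this]
      have hs : ∑ i ∈ Finset.range ((s ++ b :: 1 :: c :: t).length - 1),
          (-1 : k) ^ (i + 1) • f (ins mulList 2 i (s ++ b :: 1 :: c :: t)) = 0 := by
        rw [Finset.sum_eq_add s.length (s.length + 1) (by omega)]
        · rw [e1, e2]; simp [pow_succ]
        · intro i hi hi'
          rw [hterm i (by simp; omega) (by simp; omega), smul_zero]
        · intro hh; simp at hh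
        · intro hh; simp at hh
      have hlast : f ((s ++ b :: 1 :: c :: t).dropLast) = 0 := by
        apply hf1
        have : s ++ b :: 1 :: c :: t = (s ++ [b, 1]) ++ (c :: t) := by simp
        rw [this, List.dropLast_append_of_ne_nil (by simp)]
        simp
      rw [hochFun, hs, hhead, hlast]
      simp

/-- The Hochschild differential on normalized `M`-valued cochains, from `n` to `m = n + 1`
arguments. -/
def hochDiff (lft rgt : A →ₗ[k] M →ₗ[k] M) (hl : lft 1 = LinearMap.id)
    (hr : rgt 1 = LinearMap.id) {n m : ℤ} (h : m = n + 1) :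
    MCochain k A M n →ₗ[k] MCochain k A M m where
  toFun f := ⟨hochFun lft rgt f.1, slotLinear_hochFun lft rgt f.2.1,
    fun l h1 => hochFun_one lft rgt hl hr f.2.2.1 h1, by
      intro l hlen
      rcases List.eq_nil_or_concat l with rfl | ⟨t, a, rfl⟩
      · simp [hochFun]
      · simp only [List.concat_eq_append, List.length_append, List.length_cons, List.length_nil,
          zero_add, Nat.cast_add, Nat.cast_one] at hlen
        have h0 : ∀ s : List A, s.length = t.length → f.1 s = 0 :=
          fun s hs => f.2.2.2 s (by omega)
        rw [hochFun, h0 _ (by simp), h0 (List.dropLast _) (by simp), Finset.sum_eq_zero]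
        · simp
        · intro i hi
          simp only [List.concat_eq_append, List.length_append, List.length_cons, List.length_nil,
            zero_add, Nat.add_sub_cancel, Finset.mem_range] at hi
          have := length_ins (mulList (A := A)) (p := 2) (j := i) (l := t.concat a)
            (by simp; omega)
          rw [h0 _ (by rw [List.length_concat] at this; omega), smul_zero]⟩
  map_add' f g := by
    ext l
    simp only [hochFun, Submodule.coe_add, Pi.add_apply, map_add, smul_add,
      Finset.sum_add_distrib]
    abel
  map_smul' c f := by
    ext l
    simp only [hochFun, Submodule.coe_smul, Pi.smul_apply, map_smul, smul_add, Finset.smul_sum,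
      RingHom.id_apply, smul_comm c]

end Cochains

section Homology

variable {k : Type u} [Field k] {X Y Z X' Y' Z' X'' Y'' Z'' : Type*}
  [AddCommGroup X] [Module k X] [AddCommGroup Y] [Module k Y] [AddCommGroup Z] [Module k Z]
  [AddCommGroup X'] [Module k X'] [AddCommGroup Y'] [Module k Y'] [AddCommGroup Z'] [Module k Z']
  [AddCommGroup X''] [Module k X''] [AddCommGroup Y''] [Module k Y'']
  [AddCommGroup Z''] [Module k Z'']

/-- The homology `ker g / im f` of `X → Y → Z`. -/
def Homology (f : X →ₗ[k] Y) (g : Y →ₗ[k] Z) : Type _ :=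
  LinearMap.ker g ⧸ (LinearMap.range f).comap (LinearMap.ker g).subtype

instance (f : X →ₗ[k] Y) (g : Y →ₗ[k] Z) : AddCommGroup (Homology f g) :=
  inferInstanceAs (AddCommGroup
    (LinearMap.ker g ⧸ (LinearMap.range f).comap (LinearMap.ker g).subtype))

instance (f : X →ₗ[k] Y) (g : Y →ₗ[k] Z) : Module k (Homology f g) :=
  inferInstanceAs (Module k
    (LinearMap.ker g ⧸ (LinearMap.range f).comap (LinearMap.ker g).subtype))

/-- The class of a cycle. -/
def cls (f : X →ₗ[k] Y) (g : Y →ₗ[k] Z) (z : Y) (hz : g z = 0) : Homology f g :=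
  Submodule.Quotient.mk (p := (LinearMap.range f).comap (LinearMap.ker g).subtype) ⟨z, hz⟩

/-- `φ` maps cycles to cycles, and the map `Φ` on homology is given on classes by `φ`. -/
def Induces {f : X →ₗ[k] Y} {g : Y →ₗ[k] Z} {f' : X' →ₗ[k] Y'} {g' : Y' →ₗ[k] Z'}
    (φ : Y → Y') (Φ : Homology f g →ₗ[k] Homology f' g') : Prop :=
  ∀ (z : Y) (hz : g z = 0), ∃ hz' : g' (φ z) = 0, Φ (cls f g z hz) = cls f' g' (φ z) hz'

/-- The same for an operation with two arguments. -/
def Induces₂ {f : X →ₗ[k] Y} {g : Y →ₗ[k] Z} {f' : X' →ₗ[k] Y'} {g' : Y' →ₗ[k] Z'}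
    {f'' : X'' →ₗ[k] Y''} {g'' : Y'' →ₗ[k] Z''} (φ : Y → Y' → Y'')
    (Φ : Homology f g →ₗ[k] Homology f' g' →ₗ[k] Homology f'' g'') : Prop :=
  ∀ (z : Y) (hz : g z = 0) (z' : Y') (hz' : g' z' = 0), ∃ hz'' : g'' (φ z z') = 0,
    Φ (cls f g z hz) (cls f' g' z' hz') = cls f'' g'' (φ z z') hz''

end Homology

noncomputable section HochschildCochains

variable (k : Type u) (A : Type v) [Field k] [Ring A] [Algebra k A]

/-- Normalized Hochschild cochains of degree `|x| = p`, i.e. with `p + 1` arguments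
(the shifted complex, on which the Gerstenhaber bracket has degree zero). -/
abbrev Cochain (p : ℤ) : Submodule k (List A → A) := MCochain k A A (p + 1)

variable {k A}

/-- The differential `x ↦ [μ, x]` for `μ(a, b) = -ab`; written out, it is `(-1)^{|x|+1}` times
the usual Hochschild coboundary. -/
def cochainD {p q : ℤ} (h : q = p + 1) : Cochain k A p →ₗ[k] Cochain k A q :=
  (-1 : k) ^ (p + 1) • hochDiff (LinearMap.mul k A) (LinearMap.mul k A).flip
    (by ext; simp) (by ext; simp) (by omega)

/-- `x{y}(a₁, …, aₙ) = ∑ᵢ (-1)^{|y| i} x(a₁, …, aᵢ, y(aᵢ₊₁, …), …, aₙ)` for `y` of degree `q`. -/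
def braceFun (q : ℤ) (x y : List A → A) (l : List A) : A :=
  ∑ i ∈ Finset.range (l.length + 1), (-1 : k) ^ (q * i) • x (ins y (q + 1).toNat i l)

theorem braceFun_mem {p q r : ℤ} (h : p + q = r) (x : Cochain k A p) (y : Cochain k A q) :
    braceFun (k := k) q x.1 y.1 ∈ Cochain k A r := by
  refine ⟨SlotLinear.sum (fun n => n + 1) fun i =>
    (x.2.1.ins y.2.1 _ i).smul_length fun _ => (-1 : k) ^ (q * i), ?_, ?_⟩
  · intro l hl
    refine Finset.sum_eq_zero fun i _ => ?_
    rcases mem_ins (p := (q + 1).toNat) (j := i) hl with h1 | h1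
    · rw [x.2.1.eq_zero (by simp [ins, y.2.2.1 _ h1]), smul_zero]
    · rw [x.2.2.1 _ (by simp only [ins, List.mem_append, List.mem_cons]; tauto), smul_zero]
  · intro l hl
    refine Finset.sum_eq_zero fun i _ => ?_
    by_cases h1 : (((l.drop i).take (q + 1).toNat).length : ℤ) = q + 1
    · rw [x.2.2.2, smul_zero]
      simp only [ins, List.length_append, List.length_cons, List.length_take,
        List.length_drop] at h1 ⊢
      omega
    · rw [x.2.1.eq_zero (by simp [ins, y.2.2.2 _ h1]), smul_zero]

/-- The Gerstenhaber bracket `[x, y] = x{y} - (-1)^{|x||y|} y{x}`. -/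
def gerst {p q r : ℤ} (h : p + q = r) (x : Cochain k A p) (y : Cochain k A q) : Cochain k A r :=
  ⟨braceFun (k := k) q x.1 y.1, braceFun_mem h x y⟩
    - (-1 : k) ^ (p * q) • ⟨braceFun (k := k) p y.1 x.1, braceFun_mem (by omega) y x⟩

/-- The cup product `x ∪ y = (-1)^{|x|} μ{x, y}` for `μ(a, b) = -ab`; written out,
`(x ∪ y)(a₁, …) = (-1)^{(|x|+1)(|y|+1)} x(a₁, …) y(…)`. -/
def cup {p q r : ℤ} (h : p + q + 1 = r) (x : Cochain k A p) (y : Cochain k A q) :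
    Cochain k A r :=
  (-1 : k) ^ ((p + 1) * (q + 1)) •
    ⟨fun l => x.1 (l.take (p + 1).toNat) * y.1 (l.drop (p + 1).toNat), by
      set P := (p + 1).toNat
      refine ⟨?_, ?_, ?_⟩
      · intro s t c a b
        rcases lt_or_ge s.length P with h1 | h1
        · obtain ⟨e, he⟩ : ∃ e, P = s.length + (e + 1) := ⟨P - s.length - 1, by omega⟩
          have d1 : ∀ r, List.drop (s.length + r) s = [] :=
            fun r => List.drop_eq_nil_of_le (by omega)
          have t1 : ∀ r, List.take (s.length + r) s = s :=
            fun r => List.take_of_length_le (by omega)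
          simp [he, List.take_append, List.drop_append, d1, t1, x.2.1 s (t.take e) c a b, add_mul]
        · simp only [List.take_append_of_le_length h1, List.drop_append_of_le_length h1,
            y.2.1 (s.drop P) t c a b, mul_add, mul_smul_comm]
      · intro l hl
        rw [← List.take_append_drop P l, List.mem_append] at hl
        rcases hl with hl | hl
        · simp [x.2.2.1 _ hl]
        · simp [y.2.2.1 _ hl]
      · intro l hl
        by_cases h1 : ((l.take P).length : ℤ) = p + 1
        · simp only [y.2.2.2 (l.drop P) (by simp at h1 ⊢; omega), mul_zero]
        · simp only [x.2.2.2 _ h1, zero_mul]⟩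

variable (k A)

/-- Hochschild cohomology `HH^i(A)`: classes of cocycles with `i` arguments. -/
abbrev HHCoh (i : ℤ) : Type _ :=
  Homology (cochainD (k := k) (A := A) (show i - 1 = (i - 2) + 1 by ring))
    (cochainD (show i = (i - 1) + 1 by ring))

end HochschildCochains

noncomputable section Chains

variable (k : Type u) (A : Type v) [Field k] [Ring A] [Algebra k A]

/-- The relations that present `⨁ₙ A ⊗ (A / k)^{⊗ n}` by the symbols `a₀ ⊗ … ⊗ aₙ`. -/
def chainRel : Submodule k (List A →₀ k) :=
  Submodule.span k
    ({Finsupp.single [] 1}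
      ∪ {r | ∃ (s t : List A) (c : k) (y z : A), r = Finsupp.single (s ++ (c • y + z) :: t) 1
          - (c • Finsupp.single (s ++ y :: t) 1 + Finsupp.single (s ++ z :: t) 1)}
      ∪ {r | ∃ (a : A) (t : List A), (1 : A) ∈ t ∧ r = Finsupp.single (a :: t) 1})

/-- The normalized Hochschild chains `⨁ₙ A ⊗ (A / k)^{⊗ n}` (all degrees together). -/
abbrev Chain : Type (max u v) := (List A →₀ k) ⧸ chainRel k A

variable {A}

/-- The chain `a₀ ⊗ a₁ ⊗ … ⊗ aₙ`. -/
def chain (l : List A) : Chain k A := Submodule.Quotient.mk (Finsupp.single l 1)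

theorem chain_nil : chain k ([] : List A) = 0 :=
  (Submodule.Quotient.mk_eq_zero _).2 (Submodule.subset_span (by simp))

theorem chain_one {a : A} {t : List A} (h : (1 : A) ∈ t) : chain k (a :: t) = 0 :=
  (Submodule.Quotient.mk_eq_zero _).2 (Submodule.subset_span (Or.inr ⟨a, t, h, rfl⟩))

theorem slotLinear_chain : SlotLinear k (chain k (A := A)) := by
  intro s t c y z
  rw [← sub_eq_zero]
  simp only [chain, ← Submodule.Quotient.mk_smul, ← Submodule.Quotient.mk_add,
    ← Submodule.Quotient.mk_sub]
  exact (Submodule.Quotient.mk_eq_zero _).2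
    (Submodule.subset_span (Or.inl (Or.inr ⟨s, t, c, y, z, rfl⟩)))

variable {k}

/-- A function on lists that respects the relations defining `Chain`. -/
structure IsChainFun {M : Type w} [AddCommGroup M] [Module k M] (f : List A → M) : Prop where
  nil : f [] = 0
  slot : SlotLinear k f
  one : ∀ (a : A) (t : List A), (1 : A) ∈ t → f (a :: t) = 0

/-- The linear map with `a₀ ⊗ … ⊗ aₙ ↦ f [a₀, …, aₙ]`. -/
def chainLift {M : Type w} [AddCommGroup M] [Module k M] (f : List A → M)
    (hf : IsChainFun (k := k) f) : Chain k A →ₗ[k] M :=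
  (chainRel k A).liftQ (Finsupp.linearCombination k f) (by
    rw [chainRel, Submodule.span_le]
    rintro r ((rfl | ⟨s, t, c, y, z, rfl⟩) | ⟨a, t, h, rfl⟩)
    · simp [hf.nil]
    · simp [hf.slot s t c y z]
    · simp [hf.one a t h])

@[simp]
theorem chainLift_chain {M : Type w} [AddCommGroup M] [Module k M] (f : List A → M)
    (hf : IsChainFun (k := k) f) (l : List A) : chainLift f hf (chain k l) = f l := by
  simp [chainLift, chain]

theorem chain_induction {P : Chain k A → Prop} (h0 : P 0)
    (hadd : ∀ c c', P c → P c' → P (c + c')) (hs : ∀ (r : k) l, P (r • chain k l)) (c) : P c := by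
  obtain ⟨c, rfl⟩ := Submodule.Quotient.mk_surjective _ c
  induction c using Finsupp.induction_linear with
  | zero => simpa using h0
  | add f g hf hg => simpa using hadd _ _ hf hg
  | single l r =>
    have := hs r l
    rwa [chain, ← Submodule.Quotient.mk_smul, Finsupp.smul_single, smul_eq_mul, mul_one] at this

theorem chain_hom_ext {M : Type w} [AddCommGroup M] [Module k M] {f g : Chain k A →ₗ[k] M}
    (h : ∀ l, f (chain k l) = g (chain k l)) : f = g := by
  refine LinearMap.ext fun c => ?_
  induction c using chain_induction with
  | h0 => simp
  | hadd c c' h1 h2 => simp [h1, h2]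
  | hs r l => simp [h]

variable (k A)

/-- The chains of degree `n`, `A ⊗ (A / k)^{⊗ n}`. -/
def chainDeg (n : ℤ) : Submodule k (Chain k A) :=
  Submodule.span k {c | ∃ l : List A, (l.length : ℤ) = n + 1 ∧ c = chain k l}

variable {k A}

theorem chain_mem {n : ℤ} {l : List A} (h : (l.length : ℤ) = n + 1) : chain k l ∈ chainDeg k A n :=
  Submodule.subset_span ⟨l, h, rfl⟩

theorem chainLift_mem {n m : ℤ} {f : List A → Chain k A} (hf : IsChainFun (k := k) f)
    (h : ∀ l : List A, (l.length : ℤ) = n + 1 → f l ∈ chainDeg k A m) (c : Chain k A)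
    (hc : c ∈ chainDeg k A n) : chainLift f hf c ∈ chainDeg k A m := by
  have : chainDeg k A n ≤ (chainDeg k A m).comap (chainLift f hf) := by
    rw [chainDeg, Submodule.span_le]
    rintro _ ⟨l, hl, rfl⟩
    simpa using h l hl
  exact this hc

/-- The Hochschild differential
`a₀ ⊗ … ⊗ aₙ ↦ ∑_{i<n} (-1)ⁱ a₀ ⊗ … ⊗ aᵢaᵢ₊₁ ⊗ … ⊗ aₙ + (-1)ⁿ aₙa₀ ⊗ a₁ ⊗ … ⊗ aₙ₋₁`
(the Lie derivative along `μ(a, b) = -ab`). -/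
def bFun (l : List A) : Chain k A :=
  (∑ i ∈ Finset.range (l.length - 1), (-1 : k) ^ i • chain k (ins mulList 2 i l))
    + (-1 : k) ^ (l.length - 1) • chain k (ins mulList 2 0 (l.rotate (l.length - 1)))

theorem isChainFun_bFun : IsChainFun (k := k) (bFun (k := k) (A := A)) where
  nil := by
    simp [bFun, ins, mulList, (slotLinear_chain k).eq_zero (l := [(0 : A)]) (by simp)]
  slot := by
    refine (SlotLinear.sum (fun n => n - 1) fun i =>
      ((slotLinear_chain k).ins slotLinear_mulList 2 i).smul_length
        fun _ => (-1 : k) ^ i).add ?_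
    intro s t c y z
    have := (((slotLinear_chain k).ins slotLinear_mulList 2 0).rotate
      ((s ++ y :: t).length - 1)).smul_length (fun n => (-1 : k) ^ (n - 1)) s t c y z
    simpa using this
  one := by
    intro a t0 h
    obtain ⟨s, t, rfl⟩ := List.append_of_mem h
    have hterm : ∀ i, i ≠ s.length → i ≠ s.length + 1 →
        chain k (ins mulList 2 i (a :: (s ++ 1 :: t))) = 0 := by
      intro i h1 h2
      rcases lt_or_ge i s.length with h3 | h3
      · have h4 : (1 : A) ∈ List.drop (i + 1) (s ++ 1 :: t) := by
          rw [List.drop_append_of_le_length (by omega)]; simp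
        rcases i with _ | i
        · exact chain_one k (by simpa using h4)
        · simp only [ins, List.take_succ_cons, List.cons_append]
          apply chain_one
          simp only [List.mem_append, List.mem_cons]
          right; right
          simpa [add_assoc, add_comm, add_left_comm] using h4
      · obtain ⟨e, rfl⟩ : ∃ e, i = (s.length + (e + 1)) + 1 := ⟨i - s.length - 2, by omega⟩
        simp only [ins, List.take_succ_cons, List.cons_append]
        exact chain_one k (by simp [List.take_append])
    have e1 : chain k (ins mulList 2 s.length (a :: (s ++ 1 :: t))) = chain k (a :: (s ++ t)) := by
      rcases List.eq_nil_or_concat s with rfl | ⟨s, b, rfl⟩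
      · simp [ins, mulList]
      · have := ins_mul (a :: s) t b 1
        simp only [List.cons_append, List.length_cons, mul_one] at this
        simp [this]
    rcases t with _ | ⟨c, t⟩
    · have hs : ∑ i ∈ Finset.range ((a :: (s ++ [1])).length - 1),
          (-1 : k) ^ i • chain k (ins mulList 2 i (a :: (s ++ [1])))
            = (-1 : k) ^ s.length • chain k (a :: s) := by
        rw [Finset.sum_eq_single s.length]
        · rw [e1, List.append_nil]
        · intro i hi hi'
          simp at hi
          rw [hterm i hi' (by omega), smul_zero]
        · simp
      have hr : (a :: (s ++ [1])).rotate ((a :: (s ++ [1])).length - 1) = 1 :: a :: s := by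
        simp
      rw [bFun, hs, hr]
      simp [ins, mulList, pow_succ]
    · have e2 : chain k (ins mulList 2 (s.length + 1) (a :: (s ++ 1 :: c :: t)))
          = chain k (a :: (s ++ c :: t)) := by
        have := ins_mul (a :: s) t 1 c
        simp only [List.cons_append, List.length_cons, one_mul] at this
        rw [this]
      have hs : ∑ i ∈ Finset.range ((a :: (s ++ 1 :: c :: t)).length - 1),
          (-1 : k) ^ i • chain k (ins mulList 2 i (a :: (s ++ 1 :: c :: t))) = 0 := by
        rw [Finset.sum_eq_add s.length (s.length + 1) (by omega)]
        · rw [e1, e2]; simp [pow_succ]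
        · intro i hi hi'
          rw [hterm i hi'.1 hi'.2, smul_zero]
        · intro hh; simp at hh
        · intro hh; simp at hh
      obtain ⟨t', z, ht⟩ : ∃ t' z, c :: t = t' ++ [z] :=
        ⟨(c :: t).dropLast, (c :: t).getLast (List.cons_ne_nil _ _),
          (List.dropLast_append_getLast _).symm⟩
      have hr : (a :: (s ++ 1 :: c :: t)).rotate ((a :: (s ++ 1 :: c :: t)).length - 1)
          = z :: a :: (s ++ 1 :: t') := by
        rw [ht]
        have := List.rotate_append_length_eq (a :: (s ++ 1 :: t')) [z]
        have e3 : (a :: (s ++ 1 :: (t' ++ [z]))).length - 1 = (a :: (s ++ 1 :: t')).length := by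
          simp; omega
        have e4 : a :: (s ++ 1 :: (t' ++ [z])) = (a :: (s ++ 1 :: t')) ++ [z] := by simp
        rw [e3, e4, this]; rfl
      rw [bFun, hs, hr]
      simp [ins, mulList, chain_one]

/-- The Hochschild differential on normalized chains. -/
def b : Chain k A →ₗ[k] Chain k A := chainLift bFun isChainFun_bFun

/-- The Connes differential `a₀ ⊗ … ⊗ aₙ ↦ ∑ᵢ (-1)^{n i} 1 ⊗ aᵢ ⊗ … ⊗ aₙ ⊗ a₀ ⊗ … ⊗ aᵢ₋₁`. -/
def connesFun (l : List A) : Chain k A :=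
  ∑ i ∈ Finset.range l.length, (-1 : k) ^ ((l.length - 1) * i) • chain k (1 :: l.rotate i)

theorem isChainFun_connesFun : IsChainFun (k := k) (connesFun (k := k) (A := A)) where
  nil := by simp [connesFun]
  slot := SlotLinear.sum (fun n => n) fun i =>
    (((slotLinear_chain k).cons 1).rotate i).smul_length fun n => (-1 : k) ^ ((n - 1) * i)
  one := by
    intro a t h
    refine Finset.sum_eq_zero fun i _ => ?_
    rw [chain_one k (by simp [h]), smul_zero]

/-- The Connes differential on normalized chains. -/
def connes : Chain k A →ₗ[k] Chain k A := chainLift connesFun isChainFun_connesFun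

/-- The contraction `i_x (a₀ ⊗ … ⊗ aₙ) = a₀ x(a₁, …, a_{p+1}) ⊗ a_{p+2} ⊗ … ⊗ aₙ`, `|x| = p`. -/
def contrFun (p : ℤ) (x : List A → A) : List A → Chain k A
  | [] => 0
  | a :: t => chain k ((a * x (t.take (p + 1).toNat)) :: t.drop (p + 1).toNat)

/-- The Lie derivative `L_x` for `|x| = p`: the sum of
`(-1)^{p i} a₀ ⊗ … ⊗ aᵢ ⊗ x(aᵢ₊₁, …, a_{i+p+1}) ⊗ … ⊗ aₙ` over `0 ≤ i ≤ n - p - 1` and of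
`(-1)^{n(i+1)+p} x(aᵢ₊₁, …, aₙ, a₀, …, a_{p-n+i}) ⊗ … ⊗ aᵢ` over `n - p ≤ i ≤ n`
(terms in which `x` would get too few arguments vanish). -/
def lieFun (p : ℤ) (x : List A → A) (l : List A) : Chain k A :=
  ∑ i ∈ Finset.range l.length,
    if i + (p + 1).toNat < l.length then
      (-1 : k) ^ (p * i) • chain k (ins x (p + 1).toNat (i + 1) l)
    else
      (-1 : k) ^ (((l.length : ℤ) - 1) * (i + 1) + p) •
        chain k (ins x (p + 1).toNat 0 (l.rotate (i + 1)))

/-- The operation `S_x` for `|x| = p`: the sum of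
`± 1 ⊗ a_{m+1} ⊗ … ⊗ aₙ ⊗ a₀ ⊗ … ⊗ a_j ⊗ x(a_{j+1}, …, a_{j+p+1}) ⊗ … ⊗ a_m`
over `0 ≤ j` and `j + p + 1 ≤ m ≤ n`, with the sign `(-1)^{p (j + m) + n (m + p + 1)}`. -/
def sFun (p : ℤ) (x : List A → A) (l : List A) : Chain k A :=
  ∑ j ∈ Finset.range l.length, ∑ m ∈ Finset.range l.length,
    if j + (p + 1).toNat ≤ m then
      (-1 : k) ^ (p * (j + m) + ((l.length : ℤ) - 1) * (m + p + 1)) •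
        chain k (1 :: (ins x (p + 1).toNat (j + 1) l).rotate (m + 2 - (p + 1).toNat))
    else 0

theorem isChainFun_contrFun {p : ℤ} (x : Cochain k A p) :
    IsChainFun (k := k) (contrFun (k := k) p x.1) where
  nil := rfl
  slot := by
    intro s t c y z
    cases s with
    | nil =>
      simpa [contrFun, add_mul] using slotLinear_chain k []
        (t.drop (p + 1).toNat) c (y * x.1 (t.take (p + 1).toNat)) (z * x.1 (t.take (p + 1).toNat))
    | cons a s =>
      have h : SlotLinear k (fun l : List A => chain k
          (ins (fun r => a * x.1 r) (p + 1).toNat 0 l)) := by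
        refine (slotLinear_chain k).ins (x := fun r => a * x.1 r) ?_ _ 0
        intro s t c y z
        simp [x.2.1 s t c y z, mul_add]
      simpa [contrFun, ins] using h s t c y z
  one := by
    intro a t h
    rw [← List.take_append_drop (p + 1).toNat t, List.mem_append] at h
    rcases h with h | h
    · simpa [contrFun, x.2.2.1 _ h] using
        (slotLinear_chain k).eq_zero (l := 0 :: t.drop (p + 1).toNat) (by simp)
    · exact chain_one k h

theorem isChainFun_lieFun {p : ℤ} (x : Cochain k A p) :
    IsChainFun (k := k) (lieFun (k := k) p x.1) where
  nil := by simp [lieFun]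
  slot := SlotLinear.sum (fun n => n) fun i =>
    SlotLinear.ite_length (fun n => i + (p + 1).toNat < n)
      (((slotLinear_chain k).ins x.2.1 _ (i + 1)).smul_length fun _ => (-1 : k) ^ (p * i))
      ((((slotLinear_chain k).ins x.2.1 _ 0).rotate (i + 1)).smul_length
        fun n => (-1 : k) ^ (((n : ℤ) - 1) * (i + 1) + p))
  one := by
    intro a t h
    refine Finset.sum_eq_zero fun i _ => ?_
    split_ifs
    · rw [smul_eq_zero_of_right]
      rcases mem_ins (p := (p + 1).toNat) (j := i) h with h1 | h1
      · exact (slotLinear_chain k).eq_zero (by simp [ins, x.2.2.1 _ h1])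
      · simp only [ins, List.take_succ_cons, List.cons_append, Nat.add_right_comm i 1,
          List.drop_succ_cons]
        exact chain_one k (by simp only [List.mem_append, List.mem_cons]; tauto)
    · rw [smul_eq_zero_of_right]
      have h' : (1 : A) ∈ (a :: t).rotate (i + 1) := by simp [h]
      rcases mem_ins (p := (p + 1).toNat) (j := 0) h' with h1 | h1 | h1
      · exact (slotLinear_chain k).eq_zero (by simp only [ins, x.2.2.1 _ h1]; simp)
      · simp at h1
      · simp only [ins, List.take_zero, List.nil_append]
        exact chain_one k h1

theorem isChainFun_sFun {p : ℤ} (x : Cochain k A p) :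
    IsChainFun (k := k) (sFun (k := k) p x.1) where
  nil := by simp [sFun]
  slot := SlotLinear.sum (fun n => n) fun j => SlotLinear.sum (fun n => n) fun m =>
    SlotLinear.ite_length (fun _ => j + (p + 1).toNat ≤ m)
      (((((slotLinear_chain k).cons 1).rotate (m + 2 - (p + 1).toNat)).ins x.2.1 _
        (j + 1)).smul_length fun n => (-1 : k) ^ (p * (j + m) + ((n : ℤ) - 1) * (m + p + 1)))
      (fun s t c y z => by simp)
  one := by
    intro a t h
    refine Finset.sum_eq_zero fun j _ => Finset.sum_eq_zero fun m _ => ?_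
    split_ifs
    · rw [smul_eq_zero_of_right]
      have h' : (1 : A) ∈ a :: t := by simp [h]
      rcases mem_ins (p := (p + 1).toNat) (j := j + 1) h' with h1 | h1
      · exact (slotLinear_chain k).eq_zero (by
          simp only [List.mem_cons, List.mem_rotate, ins, x.2.2.1 _ h1]; simp)
      · refine chain_one k ?_
        simp only [List.mem_rotate, ins, List.mem_append, List.mem_cons]; tauto
    · rfl

/-- The contraction `i_x` on normalized chains. -/
def contr {p : ℤ} (x : Cochain k A p) : Chain k A →ₗ[k] Chain k A :=
  chainLift (contrFun p x.1) (isChainFun_contrFun x)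

/-- The Lie derivative `L_x` on normalized chains. -/
def lieDer {p : ℤ} (x : Cochain k A p) : Chain k A →ₗ[k] Chain k A :=
  chainLift (lieFun p x.1) (isChainFun_lieFun x)

/-- The operation `S_x` on normalized chains. -/
def sOp {p : ℤ} (x : Cochain k A p) : Chain k A →ₗ[k] Chain k A :=
  chainLift (sFun p x.1) (isChainFun_sFun x)

theorem chain_ins_mem {p n m : ℤ} (h : m = n - p) (x : Cochain k A p) (j : ℕ) {l : List A}
    (hl : (l.length : ℤ) = n + 1) {f : List A → List A}
    (hf0 : ∀ l, (0 : A) ∈ l → (0 : A) ∈ f l) {e : ℤ}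
    (hf : ∀ l, ((f l).length : ℤ) = l.length + e) :
    chain k (f (ins x.1 (p + 1).toNat j l)) ∈ chainDeg k A (m + e) := by
  by_cases h1 : (((l.drop j).take (p + 1).toNat).length : ℤ) = p + 1
  · refine chain_mem ?_
    rw [hf]
    simp only [ins, List.length_append, List.length_cons, List.length_take,
      List.length_drop] at h1 ⊢
    omega
  · rw [(slotLinear_chain k).eq_zero (hf0 _ (by simp [ins, x.2.2.2 _ h1]))]
    exact Submodule.zero_mem _

theorem b_mem {n m : ℤ} (h : n = m + 1) (c : Chain k A) (hc : c ∈ chainDeg k A n) :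
    b c ∈ chainDeg k A m := by
  refine chainLift_mem _ (fun l hl => ?_) c hc
  refine Submodule.add_mem _ (Submodule.sum_mem _ fun i hi => Submodule.smul_mem _ _ ?_)
    (Submodule.smul_mem _ _ ?_)
  · rw [Finset.mem_range] at hi
    have := length_ins (mulList (A := A)) (p := 2) (j := i) (l := l) (by omega)
    exact chain_mem (by omega)
  · by_cases h2 : 2 ≤ l.length
    · have := length_ins (mulList (A := A)) (p := 2) (j := 0) (l := l.rotate (l.length - 1))
        (by simpa using h2)
      rw [List.length_rotate] at this
      exact chain_mem (by omega)
    · rw [(slotLinear_chain k).eq_zero]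
      · exact Submodule.zero_mem _
      · have h3 : (l.rotate (l.length - 1)).length < 2 := by simpa using h2
        generalize l.rotate (l.length - 1) = r at h3
        rcases r with _ | ⟨a, _ | ⟨a', r⟩⟩
        · simp [ins, mulList]
        · simp [ins, mulList]
        · simp at h3

theorem connes_mem {n m : ℤ} (h : m = n + 1) (c : Chain k A) (hc : c ∈ chainDeg k A n) :
    connes c ∈ chainDeg k A m := by
  refine chainLift_mem _ (fun l hl => ?_) c hc
  refine Submodule.sum_mem _ fun i _ => Submodule.smul_mem _ _ (chain_mem ?_)
  simp; omega

theorem contr_mem {p n m : ℤ} (h : m = n - (p + 1)) (x : Cochain k A p) (c : Chain k A)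
    (hc : c ∈ chainDeg k A n) : contr x c ∈ chainDeg k A m := by
  refine chainLift_mem _ (fun l hl => ?_) c hc
  rcases l with _ | ⟨a, t⟩
  · exact Submodule.zero_mem _
  · by_cases h1 : ((t.take (p + 1).toNat).length : ℤ) = p + 1
    · refine chain_mem ?_
      simp only [List.length_cons, List.length_take, List.length_drop] at h1 hl ⊢
      omega
    · rw [contrFun, (slotLinear_chain k).eq_zero (by simp [x.2.2.2 _ h1])]
      exact Submodule.zero_mem _

theorem lieDer_mem {p n m : ℤ} (h : m = n - p) (x : Cochain k A p) (c : Chain k A)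
    (hc : c ∈ chainDeg k A n) : lieDer x c ∈ chainDeg k A m := by
  refine chainLift_mem _ (fun l hl => Submodule.sum_mem _ fun i _ => ?_) c hc
  split_ifs
  · have := chain_ins_mem h x (i + 1) hl (f := id) (e := 0) (by simp) (by simp)
    exact Submodule.smul_mem _ _ (by simpa using this)
  · have := chain_ins_mem h x 0 (l := l.rotate (i + 1)) (by simpa using hl) (f := id) (e := 0)
      (by simp) (by simp)
    exact Submodule.smul_mem _ _ (by simpa using this)

theorem sOp_mem {p n m : ℤ} (h : m = n - p + 1) (x : Cochain k A p) (c : Chain k A)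
    (hc : c ∈ chainDeg k A n) : sOp x c ∈ chainDeg k A m := by
  refine chainLift_mem _ (fun l hl => Submodule.sum_mem _ fun j _ =>
    Submodule.sum_mem _ fun i _ => ?_) c hc
  split_ifs
  · have := chain_ins_mem (m := m - 1) (by omega) x (j + 1) hl
      (f := fun l => 1 :: l.rotate (i + 2 - (p + 1).toNat)) (e := 1)
      (by intro l hl; simp [hl]) (by simp)
    exact Submodule.smul_mem _ _ (by simpa using this)
  · exact Submodule.zero_mem _

theorem lieDer_lin {p : ℤ} (r : k) (x y : Cochain k A p) :
    lieDer (r • x + y) = r • lieDer x + lieDer y := by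
  refine chain_hom_ext fun l => ?_
  have key : ∀ (P j : ℕ) (l : List A), chain k (ins (r • x.1 + y.1) P j l)
      = r • chain k (ins x.1 P j l) + chain k (ins y.1 P j l) :=
    fun P j l => slotLinear_chain k _ _ r _ _
  simp only [lieDer, chainLift_chain, LinearMap.add_apply, LinearMap.smul_apply, lieFun,
    Submodule.coe_add, Submodule.coe_smul, key, Finset.smul_sum, ← Finset.sum_add_distrib]
  refine Finset.sum_congr rfl fun i _ => ?_
  split_ifs <;> rw [smul_add, smul_comm r]

variable (k A)

/-- The Hochschild differential from degree `n` to degree `m = n - 1`. -/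
def bDeg {n m : ℤ} (h : n = m + 1) : chainDeg k A n →ₗ[k] chainDeg k A m := b.restrict (b_mem h)

/-- Hochschild homology `HH_n(A)`. -/
abbrev HH (n : ℤ) : Type _ :=
  Homology (bDeg k A (show n + 1 = n + 1 from rfl)) (bDeg k A (show n = (n - 1) + 1 by ring))

/-- The normalized negative cyclic chains `∑ᵢ cᵢ uⁱ` of homological degree `n`: as `u` has
homological degree `-2`, the coefficient `cᵢ` has degree `n + 2 i`. -/
def CC (n : ℤ) : Submodule k (ℕ → Chain k A) where
  carrier := {c | ∀ i : ℕ, c i ∈ chainDeg k A (n + 2 * i)}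
  add_mem' hc hc' i := Submodule.add_mem _ (hc i) (hc' i)
  zero_mem' _ := Submodule.zero_mem _
  smul_mem' r _ hc i := Submodule.smul_mem _ r (hc i)

variable {k A}

/-- Multiplication by `u`. -/
def uMul (c : ℕ → Chain k A) : ℕ → Chain k A
  | 0 => 0
  | i + 1 => c i

theorem uMul_mem {n m : ℤ} (h : n = m + 2) {c : ℕ → Chain k A} (hc : c ∈ CC k A n) :
    uMul c ∈ CC k A m
  | 0 => Submodule.zero_mem _
  | i + 1 => by
    have h1 := hc i
    have e : n + 2 * (i : ℤ) = m + 2 * ((i + 1 : ℕ) : ℤ) := by push_cast; omega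
    rwa [e] at h1

theorem mapCC_mem {n m : ℤ} {f : Chain k A →ₗ[k] Chain k A} (e : ℤ) (h : m = n + e)
    (hf : ∀ n : ℤ, ∀ c ∈ chainDeg k A n, f c ∈ chainDeg k A (n + e)) {c : ℕ → Chain k A}
    (hc : c ∈ CC k A n) : (fun i => f (c i)) ∈ CC k A m := fun i => by
  have h1 := hf _ _ (hc i)
  have e' : n + 2 * (i : ℤ) + e = m + 2 * (i : ℤ) := by omega
  rwa [e'] at h1

/-- The cyclic differential `b + u B` from degree `n` to degree `m = n - 1`. -/
def ccD {n m : ℤ} (h : n = m + 1) : CC k A n →ₗ[k] CC k A m where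
  toFun c := ⟨(fun i => b (c.1 i)) + uMul (fun i => connes (c.1 i)),
    Submodule.add_mem _
      (mapCC_mem (-1) (by omega) (fun n => b_mem (by omega)) c.2)
      (uMul_mem (n := n + 1) (by omega)
        (mapCC_mem 1 rfl (fun n => connes_mem rfl) c.2))⟩
  map_add' c c' := by
    ext i
    cases i <;> simp [uMul]
    abel
  map_smul' r c := by
    ext i
    cases i <;> simp [uMul]

variable (k A)

/-- Negative cyclic homology `HC⁻_n(A)`. -/
abbrev HC (n : ℤ) : Type _ :=
  Homology (ccD (k := k) (A := A) (show n + 1 = n + 1 from rfl))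
    (ccD (show n = (n - 1) + 1 by ring))

variable {k A}

/-- `π (∑ᵢ cᵢ uⁱ) = c₀`. -/
def piMap (n : ℤ) (c : CC k A n) : chainDeg k A n := ⟨c.1 0, by simpa using c.2 0⟩

/-- `c ↦ B c`, from Hochschild chains to negative cyclic chains constant in `u`. -/
def connesCC {n m : ℤ} (h : m = n + 1) (c : chainDeg k A n) : CC k A m :=
  ⟨Pi.single 0 (connes c.1), fun i => by
    rcases i with _ | i
    · simpa using connes_mem h c.1 c.2
    · simp⟩

/-- The cap product `x ↦ x ∩ c = i_x c` with a chain `c` of degree `d`. -/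
def cap {d : ℤ} (c : chainDeg k A d) {p n : ℤ} (h : n = d - (p + 1)) (x : Cochain k A p) :
    chainDeg k A n :=
  ⟨contr x c.1, contr_mem h x c.1 c.2⟩

/-- `x ↦ L_x c` on negative cyclic chains. -/
def lieCC {p n m : ℤ} (h : m = n - p) (c : CC k A n) : Cochain k A p →ₗ[k] CC k A m where
  toFun x := ⟨fun i => lieDer x (c.1 i),
    mapCC_mem (-p) (by omega) (fun _ => lieDer_mem (by omega) x) c.2⟩
  map_add' x y := by
    have h1 := lieDer_lin 1 x y
    simp only [one_smul] at h1
    ext i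
    simp [h1]
  map_smul' r x := by
    have h0 := lieDer_lin (1 : k) (0 : Cochain k A p) 0
    simp only [one_smul, add_zero, left_eq_add] at h0
    have h1 := lieDer_lin r x 0
    simp only [add_zero, h0] at h1
    ext i
    simp [h1]

/-- `(i_x + u S_x) c` for a negative cyclic chain `c`. -/
def cyclicCap {p n m : ℤ} (h : m = n - (p + 1)) (x : Cochain k A p) (c : CC k A n) : CC k A m :=
  ⟨(fun i => contr x (c.1 i)) + uMul (fun i => sOp x (c.1 i)),
    Submodule.add_mem _
      (mapCC_mem (-(p + 1)) (by omega) (fun _ => contr_mem (by omega) x) c.2)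
      (uMul_mem (n := n - p + 1) (by omega)
        (mapCC_mem (-p + 1) (by omega) (fun _ => sOp_mem (by omega) x) c.2))⟩

end Chains

noncomputable section TwistedSemidirect

variable (k : Type u) (A : Type v) [Field k] [Ring A] [Algebra k A]

/-- The degree `p` part of the semi-direct product of the (shifted) normalized Hochschild cochains
with `Σ^{-d-1} CC⁻`. The pair `(x, η)` stands for `(x, s^{-d-1} η)`; operators `φ` on chains act
on the shifted chains by `φ (s^{-d-1} η) = (-1)^{(d+1)|φ|} s^{-d-1} φ η`. -/
abbrev DD (d : ℕ) (p : ℤ) : Type _ := Cochain k A p × CC k A ((d : ℤ) + 1 - p)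

variable {k A} {d : ℕ}

/-- The bracket `[(x, m), (y, m')] = ([x, y], L_x m' - (-1)^{|y||m|} L_y m)` of the semi-direct
product. -/
def ddBracket {p q r : ℤ} (h : p + q = r) (X : DD k A d p) (Y : DD k A d q) : DD k A d r :=
  (gerst h X.1 Y.1,
    (-1 : k) ^ (((d : ℤ) + 1) * p) • lieCC (by omega) Y.2 X.1
      - (-1 : k) ^ (q * p) • (-1 : k) ^ (((d : ℤ) + 1) * q) • lieCC (by omega) X.2 Y.1)

/-- The differential of the semi-direct product twisted by the Maurer-Cartan element
`(0, s^{-d-1} η₀)`, that is `(x, m) ↦ (d x, (b + u B) m - (-1)^{|x|} L_x s^{-d-1} η₀)`. -/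
def ddDiff (η₀ : CC k A d) {p q : ℤ} (h : q = p + 1) : DD k A d p →ₗ[k] DD k A d q :=
  LinearMap.prod (cochainD h ∘ₗ LinearMap.fst k _ _)
    ((-1 : k) ^ (d + 1) • ccD (by omega) ∘ₗ LinearMap.snd k _ _
      - (-1 : k) ^ p • (-1 : k) ^ (((d : ℤ) + 1) * p) •
        lieCC (by omega) η₀ ∘ₗ LinearMap.fst k _ _)

/-- The cohomology `H^p` of the twisted semi-direct product. -/
abbrev HD (η₀ : CC k A d) (p : ℤ) : Type _ :=
  Homology (ddDiff η₀ (show p = (p - 1) + 1 by ring)) (ddDiff η₀ (show p + 1 = p + 1 from rfl))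

/-- The map
`(x, s^{-d-1} η) ↦ (-1)^{|x|-1} (i_x + u S_x)(s^{-d+1} η₀) + u s^{-d+1} η` to `Σ^{-d+1} CC⁻`,
followed by the identification `s^{d-1}` of the degree `p` part of `Σ^{-d+1} CC⁻` with the chains
of homological degree `n = d - 1 - p`. -/
def psi (η₀ : CC k A d) {p n : ℤ} (h : p + n = d - 1) (X : DD k A d p) : CC k A n :=
  (-1 : k) ^ (p - 1) • (-1 : k) ^ (((d : ℤ) - 1) * (p + 1)) • cyclicCap (by omega) X.1 η₀
    + ⟨uMul X.2.1, uMul_mem (by omega) X.2.2⟩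

end TwistedSemidirect

noncomputable section CalabiYau

variable (k : Type u) (A : Type v) [Field k] [Ring A] [Algebra k A]

/-- `M` has a finite resolution by finitely generated projective `S`-modules. -/
def IsPerfect (S : Type v) [Ring S] (M : Type v) [AddCommGroup M] [Module S M] : Prop :=
  ∃ (P : ℕ → ModuleCat.{v} S) (δ : ∀ i, P (i + 1) →ₗ[S] P i) (ε : P 0 →ₗ[S] M) (N : ℕ),
    (∀ i, Module.Finite S (P i) ∧ Module.Projective S (P i)) ∧
    (∀ i, N < i → Subsingleton (P i)) ∧
    Function.Surjective ε ∧ Function.Exact (δ 0) ε ∧ ∀ i, Function.Exact (δ (i + 1)) (δ i)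

/-- `A` is perfect as a module over `A ⊗ Aᵒᵖ` (over a field, flatness is automatic). -/
def HomologicallySmooth : Prop :=
  letI : Module (A ⊗[k] Aᵐᵒᵖ) A := instModuleTensorProductMop k A
  IsPerfect (A ⊗[k] Aᵐᵒᵖ) A

/-- The normalized Hochschild cochain complex with values in `A ⊗ A` for the outer bimodule
structure `a (x ⊗ y) b = a x ⊗ y b`. It is the complex `Hom_{Aᵉ}(Bar A, Aᵉ)` for the normalized
bar resolution of `A`, hence represents `RHom_{Aᵉ}(A, Aᵉ)`. -/
def envDiff {n m : ℤ} (h : m = n + 1) :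
    MCochain k A (A ⊗[k] A) n →ₗ[k] MCochain k A (A ⊗[k] A) m :=
  hochDiff (LinearMap.rTensorHom A ∘ₗ LinearMap.mul k A)
    (LinearMap.lTensorHom A ∘ₗ (LinearMap.mul k A).flip)
    (by ext; simp) (by ext; simp) h

variable {k A}

/-- The linear map `x ⊗ y ↦ y a x`. -/
def sandwich (a : A) : A ⊗[k] A →ₗ[k] A :=
  TensorProduct.lift (LinearMap.mk₂ k (fun x y => y * a * x)
    (by intros; simp [mul_add]) (by intros; simp) (by intros; simp [add_mul]) (by intros; simp))

theorem sandwich_lin (r : k) (a a' : A) (T : A ⊗[k] A) :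
    sandwich (r • a + a') T = r • sandwich a T + sandwich a' T := by
  induction T using TensorProduct.induction_on with
  | zero => simp
  | tmul x y => simp [sandwich, mul_add, add_mul]
  | add S T hS hT => simp only [map_add, hS, hT, smul_add]; abel

/-- The evaluation of `Φ ∈ Hom_{Aᵉ}(Bar A, Aᵉ)` on chains:
`a₀ ⊗ a₁ ⊗ … ⊗ aₙ ↦ ∑ y a₀ x` if `Φ(a₁, …, aₙ) = ∑ x ⊗ y`. -/
def evalEnv {n : ℤ} (Φ : MCochain k A (A ⊗[k] A) n) : Chain k A →ₗ[k] A :=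
  chainLift (fun l => match l with
    | [] => 0
    | a :: t => sandwich a (Φ.1 t))
    { nil := rfl
      slot := by
        intro s t c y z
        cases s with
        | nil => exact sandwich_lin c y z _
        | cons a s => simp [Φ.2.1 s t c y z]
      one := by
        intro a t h
        simp [Φ.2.2.1 t h] }

/-- A Hochschild cycle `c` of degree `d` defines, by evaluation, a chain map from
`RHom_{Aᵉ}(A, Aᵉ) = Hom_{Aᵉ}(Bar A, Aᵉ)` to `Σ^{-d} A` (zero in the degrees other than `d`). It is
nondegenerate if this map is a quasi-isomorphism. -/
def Nondegenerate (d : ℕ) (c : chainDeg k A d) : Prop :=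
  (∀ i : ℤ, i ≠ d → ∀ Φ, envDiff k A (show i + 1 = i + 1 from rfl) Φ = 0 →
    Φ ∈ LinearMap.range (envDiff k A (show i = (i - 1) + 1 by ring))) ∧
  (∀ Φ, envDiff k A (show (d : ℤ) + 1 = d + 1 from rfl) Φ = 0 → evalEnv Φ c.1 = 0 →
    Φ ∈ LinearMap.range (envDiff k A (show (d : ℤ) = (d - 1) + 1 by ring))) ∧
  ∀ a : A, ∃ Φ, envDiff k A (show (d : ℤ) + 1 = d + 1 from rfl) Φ = 0 ∧ evalEnv Φ c.1 = a

end CalabiYau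

end NCCalculus

open NCCalculus

open scoped TensorProduct

/-! The proof combines the Cartan calculus of Hochschild cochains on negative cyclic chains with the
duality between Hochschild cohomology and homology. All formulas below are up to signs. Write `I_x =
i_x + u S_x`.

The bracket. Let `(x, m)` and `(y, m')` be cycles of the twisted algebra: `x` and `y` are cocycles,
`(b + uB) m = L_x η₀` and `(b + uB) m' = L_y η₀`. Apart from `I_{[x,y]} η₀`, the image of their
bracket under `Ψ` consists of `u L_x m'` and `u L_y m`. For a cocycle the Cartan homotopy formula
reads `[b + uB, I_x] = u L_x` (`ccL_capU`); it turns these two terms into `I_x L_y η₀` and `I_y L_x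
η₀`, up to boundaries. An explicit homotopy `T` between `[L_y, I_x]` and `I_{[y,x]}` (`lieL_capU`)
removes `I_{[x,y]} η₀` and trades `I_x L_y η₀` for `L_y I_x η₀`. What remains is a combination of
`L_y I_x η₀` and `I_y L_x η₀`, and `u` times it equals `(b + uB) (I_y I_x η₀)`. One cannot simply
cancel `u`: an equality `u z = (b + uB) W` makes `z` homologous to `B (W₀)`, the connecting map of
the sequence `u CC⁻ → CC⁻ → C` (`eq_of_uL_eq_ccL`). Here `W₀ = i_y i_x π(η₀)`, which is `(x ∪ y) ∩
π(η₀)`, and so `B` of the product appears (`exists_psi_ddBracket`). Since `π Ψ (x, m) = x ∩ π(η₀)`,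
the classes of `x` and `y` are `j π` of the images under `Ψ`.

`Ψ` is a quasi-isomorphism. The twisted algebra is an extension of the cochains by `CC⁻`, and the
target is an extension of the Hochschild chains by `u CC⁻`. `Ψ` respects these extensions; it is
multiplication by `u` on the subcomplexes and the cap product on the quotients. So everything
follows from the bijectivity of the cap product, by a chase with elements (`exists_ddDiff_eq`,
`exists_psi_eq`).

The cap product. Allow coefficients in any `Aᵉ`-module `M` and call `M` good if the cone of the cap
product with `π(η₀)` is acyclic (`CapAcyclic`). For `M = Aᵉ` the chains have homology `A` in degree
zero only, and goodness is the nondegeneracy of `π(η₀)` (`capAcyclic_outer`). Good modules are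
stable under finite sums and summands and under cokernels of injections, so smoothness makes `A`
good (`CapAcyclic.of_resolution`).

The chain identities. `b`, `B`, `L_x`, `i_x`, `S_x` and `T` are all cyclic sums of functions of a
word in which the letter `a₀` is marked. Composition with `L_x` or `b` then amounts to inserting `x`
or the product in all places of the marked word (`lam_cyc`), and composition with `i_y` or `T` is
described similarly (`tau_cyc`). The identities thereby reduce to commutators of insertions. The
essential one is `opR_opD`: inserting `y` to the right of the mark commutes with inserting `x`
anywhere, up to the bracket and up to the terms in which `x` swallows both `y` and the mark. -/

namespace NCCalculus

universe u v w

set_option linter.unusedSectionVars false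

/-! ### Sums over the splittings of a word -/

section Splittings

variable {α : Type*} {M N : Type*} [AddCommGroup M] [AddCommGroup N]

/-- The sum of `f u v` over all splittings `l = u ++ v`. -/
def spl (f : List α → List α → M) : List α → M
  | [] => f [] []
  | a :: l => f [] (a :: l) + spl (fun u v => f (a :: u) v) l

@[simp] theorem spl_nil (f : List α → List α → M) : spl f [] = f [] [] := rfl

theorem spl_cons (f : List α → List α → M) (a : α) (l : List α) :
    spl f (a :: l) = f [] (a :: l) + spl (fun u v => f (a :: u) v) l := rfl

theorem spl_congr {f g : List α → List α → M} {l : List α}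
    (h : ∀ u v, u ++ v = l → f u v = g u v) : spl f l = spl g l := by
  induction l generalizing f g with
  | nil => exact h [] [] rfl
  | cons a l ih =>
    rw [spl_cons, spl_cons, h [] (a :: l) rfl]
    congr 1
    exact ih fun u v huv => h (a :: u) v (by simp [huv])

theorem spl_add (f g : List α → List α → M) (l : List α) :
    spl (fun u v => f u v + g u v) l = spl f l + spl g l := by
  induction l generalizing f g with
  | nil => rfl
  | cons a l ih => rw [spl_cons, spl_cons, spl_cons, ih]; abel

theorem spl_sub (f g : List α → List α → M) (l : List α) :
    spl (fun u v => f u v - g u v) l = spl f l - spl g l := by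
  induction l generalizing f g with
  | nil => rfl
  | cons a l ih => rw [spl_cons, spl_cons, spl_cons, ih]; abel

theorem spl_zero (l : List α) : spl (fun _ _ => (0 : M)) l = 0 := by
  induction l with
  | nil => rfl
  | cons a l ih => rw [spl_cons, ih, add_zero]

theorem spl_eq_zero {f : List α → List α → M} {l : List α}
    (h : ∀ u v, u ++ v = l → f u v = 0) : spl f l = 0 :=
  (spl_congr h).trans (spl_zero l)

theorem map_spl {F : Type*} [FunLike F M N] [AddMonoidHomClass F M N] (φ : F)
    (f : List α → List α → M) (l : List α) : φ (spl f l) = spl (fun u v => φ (f u v)) l := by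
  induction l generalizing f with
  | nil => rfl
  | cons a l ih => rw [spl_cons, spl_cons, map_add, ih]

theorem smul_spl {R : Type*} [Ring R] [Module R M] (r : R) (f : List α → List α → M)
    (l : List α) : r • spl f l = spl (fun u v => r • f u v) l :=
  map_spl (DistribSMul.toAddMonoidHom M r) f l

/-- The cut lies before or after the distinguished letter `c`. Every computation with a marked
letter starts from this dichotomy. -/
theorem spl_append (f : List α → List α → M) (s : List α) (c : α) (t : List α) :
    spl f (s ++ c :: t)
      = spl (fun u v => f u (v ++ c :: t)) s + spl (fun u v => f (s ++ c :: u) v) t := by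
  induction s generalizing f with
  | nil => simp [spl_cons]
  | cons a s ih => simp only [List.cons_append, spl_cons, ih]; abel

/-- Coassociativity of the deconcatenation coproduct. -/
theorem spl_assoc (f : List α → List α → List α → M) (l : List α) :
    spl (fun u t => spl (fun v w => f u v w) t) l
      = spl (fun s w => spl (fun u v => f u v w) s) l := by
  induction l generalizing f with
  | nil => rfl
  | cons a l ih =>
    simp only [spl_cons, spl_nil, ih, spl_add]
    abel

/-- Reassociation of iterated splittings to the right. -/
theorem spl_left (f : List α → List α → List α → List α → M) (l : List α) :
    spl (fun s w => spl (fun u v => f s u v w) s) l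
      = spl (fun u t => spl (fun v w => f (u ++ v) u v w) t) l := by
  rw [spl_assoc (fun u v w => f (u ++ v) u v w)]
  exact spl_congr fun s w _ => spl_congr fun u v huv => by rw [huv]

theorem spl_comm {β : Type*} (f : List α → List α → List β → List β → M) (l : List α)
    (l' : List β) :
    spl (fun u v => spl (fun s t => f u v s t) l') l
      = spl (fun s t => spl (fun u v => f u v s t) l) l' := by
  induction l generalizing f with
  | nil => rfl
  | cons a l ih => simp only [spl_cons, ih, spl_add]

/-- Reassociation of iterated splittings. -/
theorem spl_left_right
    (f : List α → List α → List α → List α → List α → List α → M) (l : List α) :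
    spl (fun s t => spl (fun v w => spl (fun u₁ u₂ => f s t v w u₁ u₂) s) t) l
      = spl (fun u₁ r => spl (fun u₂ t => spl (fun v w => f (u₁ ++ u₂) t v w u₁ u₂) t) r) l := by
  rw [← spl_left (fun s u₁ u₂ t => spl (fun v w => f s t v w u₁ u₂) t)]
  exact spl_congr fun s t _ => spl_comm _ _ _

/-- A telescoping sum over splittings. -/
theorem spl_telescope (f h : List α → List α → M) (l : List α)
    (hh : ∀ w c t, h (w ++ [c]) t = f w (c :: t)) : spl f l - spl h l = f l [] - h [] l := by
  induction l generalizing f h with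
  | nil => rfl
  | cons a l ih =>
    have h1 := ih (fun u v => f (a :: u) v) (fun u v => h (a :: u) v)
      (fun w c t => hh (a :: w) c t)
    have h2 := hh [] a l
    rw [spl_cons, spl_cons, add_sub_add_comm, h1]
    simp only [List.nil_append] at h2
    rw [h2]
    abel

theorem spl_eq_sum (f : List α → List α → M) (l : List α) :
    spl f l = ∑ i ∈ Finset.range (l.length + 1), f (l.take i) (l.drop i) := by
  induction l generalizing f with
  | nil => simp
  | cons a l ih =>
    rw [spl_cons, ih, List.length_cons, Finset.sum_range_succ' _ (l.length + 1), add_comm]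
    simp

theorem spl_eq_right_nil {f : List α → List α → M} (l : List α)
    (h : ∀ u v, v ≠ [] → f u v = 0) : spl f l = f l [] := by
  induction l generalizing f with
  | nil => rfl
  | cons a l ih => rw [spl_cons, h _ _ (by simp), zero_add, ih fun u v hv => h _ v hv]

theorem spl_eq_left_nil {f : List α → List α → M} (l : List α)
    (h : ∀ u v, u ≠ [] → f u v = 0) : spl f l = f [] l := by
  cases l with
  | nil => rfl
  | cons a l => rw [spl_cons, spl_eq_zero fun u v _ => h _ v (by simp), add_zero]

/-- If `f u v` vanishes unless `u` has length `n`, only one splitting contributes. -/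
theorem spl_eq_single (f : List α → List α → M) (l : List α) (n : ℕ)
    (hf : ∀ u v, u.length ≠ n → f u v = 0) : spl f l = f (l.take n) (l.drop n) := by
  rw [spl_eq_sum]
  by_cases h : n ≤ l.length
  · refine Finset.sum_eq_single_of_mem n (by simp; omega) fun i hi hne => hf _ _ ?_
    simp at hi ⊢; omega
  · rw [hf (l.take n) _ (by simp; omega)]
    refine Finset.sum_eq_zero fun i hi => hf _ _ ?_
    simp at hi ⊢; omega

end Splittings

/-! ### Signs and parities -/

section Signs

variable (k : Type u) [Field k]

/-- The sign `(-1)ⁿ`. -/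
def sg (n : ℤ) : k := (-1) ^ n

variable {k}

theorem sg_add (a b : ℤ) : sg k (a + b) = sg k a * sg k b :=
  zpow_add₀ (by simp) a b

/-- Only the parity of the exponent matters. Sign comparisons thus become propositional statements
about `Even`, once the lengths of words are expanded. -/
theorem sg_congr {a b : ℤ} (h : Even a ↔ Even b) : sg k a = sg k b := by
  unfold sg
  by_cases ha : Even a
  · rw [ha.neg_one_zpow, (h.1 ha).neg_one_zpow]
  · rw [(Int.not_even_iff_odd.1 ha).neg_one_zpow,
      (Int.not_even_iff_odd.1 fun hb => ha (h.2 hb)).neg_one_zpow]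

theorem sg_even {a : ℤ} (h : Even a) : sg k a = 1 := h.neg_one_zpow

theorem sg_odd {a : ℤ} (h : Odd a) : sg k a = -1 := h.neg_one_zpow

@[simp] theorem sg_zero : sg k 0 = 1 := by simp [sg]

@[simp] theorem sg_one : sg k 1 = -1 := by simp [sg]

theorem sg_mul_self (a : ℤ) : sg k a * sg k a = 1 := by
  rw [← sg_add]; exact sg_even ⟨a, rfl⟩

theorem sg_ne_zero (a : ℤ) : sg k a ≠ 0 := zpow_ne_zero _ (by simp)

theorem sg_eq_or (a : ℤ) : sg k a = 1 ∨ sg k a = -1 :=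
  (Int.even_or_odd a).imp sg_even sg_odd

theorem sg_smul_smul {M : Type*} [AddCommGroup M] [Module k M] (a b : ℤ) (x : M) :
    sg k a • sg k b • x = sg k (a + b) • x := by rw [smul_smul, sg_add]

theorem neg_sg_smul {M : Type*} [AddCommGroup M] [Module k M] (a : ℤ) (x : M) :
    -(sg k a • x) = sg k (a + 1) • x := by rw [sg_add]; simp

end Signs

/-! ### Coderivations of the tensor coalgebra -/

section Derivations

variable {k : Type u} {A : Type v} [Field k] [Ring A] [Algebra k A]
variable {M : Type w} [AddCommGroup M] [Module k M]

theorem SlotLinear.zero_mid {f : List A → M} (hf : SlotLinear k f) (s t : List A) :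
    f (s ++ 0 :: t) = 0 := hf.eq_zero (by simp)

theorem SlotLinear.add_mid {f : List A → M} (hf : SlotLinear k f) (s t : List A) (a b : A) :
    f (s ++ (a + b) :: t) = f (s ++ a :: t) + f (s ++ b :: t) := by
  simpa using hf s t 1 a b

theorem SlotLinear.smul_mid {f : List A → M} (hf : SlotLinear k f) (s t : List A) (c : k) (a : A) :
    f (s ++ (c • a) :: t) = c • f (s ++ a :: t) := by
  simpa [hf.zero_mid] using hf s t c a 0

theorem SlotLinear.sub_mid {f : List A → M} (hf : SlotLinear k f) (s t : List A) (a b : A) :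
    f (s ++ (a - b) :: t) = f (s ++ a :: t) - f (s ++ b :: t) := by
  have := hf s t (-1) b a
  rw [neg_one_smul, neg_one_smul] at this
  rw [sub_eq_neg_add, this, sub_eq_neg_add]

/-- `a ↦ f (s ++ a :: t)` as a linear map. -/
def SlotLinear.mid {f : List A → M} (hf : SlotLinear k f) (s t : List A) : A →ₗ[k] M where
  toFun a := f (s ++ a :: t)
  map_add' := hf.add_mid s t
  map_smul' c a := hf.smul_mid s t c a

theorem SlotLinear.spl_mid {f : List A → M} (hf : SlotLinear k f) (s t : List A)
    {α : Type*} (g : List α → List α → A) (l : List α) :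
    f (s ++ spl g l :: t) = spl (fun u v => f (s ++ g u v :: t)) l :=
  map_spl (hf.mid s t) g l

theorem SlotLinear.smul {f : List A → M} (hf : SlotLinear k f) (c : k) :
    SlotLinear k (fun l => c • f l) := hf.smul_length fun _ => c

theorem SlotLinear.spl_const {α : Type*} {f : List A → List α → List α → M} (t : List α)
    (hf : ∀ v w, SlotLinear k (fun l => f l v w)) : SlotLinear k (fun l => spl (f l) t) := by
  intro s t' c y z
  simp only [smul_spl, ← spl_add]
  exact spl_congr fun v w _ => hf v w s t' c y z

theorem SlotLinear.spl {f : List A → List A → M} (h1 : ∀ u, SlotLinear k (f u))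
    (h2 : ∀ v, SlotLinear k (fun u => f u v)) : SlotLinear k (spl f) := by
  intro s t c y z
  have e1 : ∀ u v : List A, f u (v ++ (c • y + z) :: t)
      = c • f u (v ++ y :: t) + f u (v ++ z :: t) := fun u v => h1 u v t c y z
  have e2 : ∀ u v : List A, f (s ++ (c • y + z) :: u) v
      = c • f (s ++ y :: u) v + f (s ++ z :: u) v := fun u v => h2 v s u c y z
  simp only [spl_append, e1, e2, spl_add, smul_add, smul_spl]
  abel

theorem SlotLinear.append_left {f : List A → M} (hf : SlotLinear k f) (r : List A) :
    SlotLinear k (fun l => f (r ++ l)) := by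
  intro s t c y z
  simpa using hf (r ++ s) t c y z

theorem SlotLinear.append_right {f : List A → M} (hf : SlotLinear k f) (r : List A) :
    SlotLinear k (fun l => f (l ++ r)) := by
  intro s t c y z
  simpa using hf s (t ++ r) c y z

theorem SlotLinear.apply_mid {f : List A → M} (hf : SlotLinear k f) {x : List A → A}
    (hx : SlotLinear k x) (r r' : List A) : SlotLinear k (fun l => f (r ++ x l :: r')) := by
  intro s t c y z
  simp only [hx s t c y z]
  exact hf _ _ _ _ _

variable (k) in
/-- Cochains with `p + 1` arguments, not necessarily normalized. -/
structure IsCo (x : List A → A) (p : ℤ) : Prop where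
  slot : SlotLinear k x
  supp : ∀ l, (l.length : ℤ) ≠ p + 1 → x l = 0

variable (k) in
/-- The coderivation defined by `x`, acting on functions on lists:
`G ↦ ∑ (-1)^{p |u|} G (u, x (v), w)` over all splittings of the argument. -/
def der (x : List A → A) (p : ℤ) (G : List A → M) (l : List A) : M :=
  spl (fun u t => spl (fun v w => sg k (p * u.length) • G (u ++ x v :: w)) t) l

theorem slotLinear_der {x : List A → A} (hx : SlotLinear k x) (p : ℤ) {G : List A → M}
    (hG : SlotLinear k G) : SlotLinear k (der k x p G) := by
  refine SlotLinear.spl (fun u => SlotLinear.spl (fun v => ?_) fun w => ?_) fun t =>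
    SlotLinear.spl_const t fun v w => ?_
  · have := (hG.append_left (u ++ [x v])).smul (sg k (p * u.length))
    simpa using this
  · exact (hG.apply_mid hx u w).smul _
  · exact (hG.append_right (x v :: w)).smul_length fun n => sg k (p * n)

theorem map_der {N : Type*} [AddCommGroup N] [Module k N] (φ : M →ₗ[k] N) (x : List A → A) (p : ℤ)
    (G : List A → M) (l : List A) : φ (der k x p G l) = der k x p (fun l => φ (G l)) l := by
  simp only [der, map_spl, map_smul]

theorem der_add (x : List A → A) (p : ℤ) (G H : List A → M) (l : List A) :
    der k x p (fun l => G l + H l) l = der k x p G l + der k x p H l := by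
  simp only [der, smul_add, spl_add]

theorem der_smul (x : List A → A) (p : ℤ) (c : k) (G : List A → M) (l : List A) :
    der k x p (fun l => c • G l) l = c • der k x p G l := by
  simp only [der, smul_spl, smul_comm c]

theorem der_zero (x : List A → A) (p : ℤ) (l : List A) :
    der k x p (fun _ => (0 : M)) l = 0 := by
  simp only [der, smul_zero, spl_zero]

theorem der_fun_sub (x y : List A → A) (c : k) (p : ℤ) {G : List A → M} (hG : SlotLinear k G)
    (l : List A) : der k (fun l => x l - c • y l) p G l = der k x p G l - c • der k y p G l := by
  have e : ∀ (u w : List A) (a b : A), G (u ++ (a - c • b) :: w)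
      = G (u ++ a :: w) + (-c) • G (u ++ b :: w) := fun u w a b => by
    rw [hG.sub_mid, hG.smul_mid, neg_smul, sub_eq_add_neg]
  rw [sub_eq_add_neg, ← neg_smul]
  simp only [der, e, smul_spl, ← spl_add, smul_add]
  refine spl_congr fun u t _ => spl_congr fun v w _ => ?_
  rw [smul_comm]

/-- Where `x v` does not vanish the length of `v` is `p + 1`, so this value may be used when signs
in front of `x v` are compared. -/
theorem IsCo.smul_congr {x : List A → A} {p : ℤ} (hx : IsCo k x p) {f : A → M} (hf : f 0 = 0)
    {v : List A} {a b : ℤ}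
    (h : (v.length : ℤ) = p + 1 → (Even a ↔ Even b)) : sg k a • f (x v) = sg k b • f (x v) := by
  by_cases hv : (v.length : ℤ) = p + 1
  · rw [sg_congr (h hv)]
  · rw [hx.supp v hv, hf, smul_zero, smul_zero]

theorem isCo_der {x y : List A → A} {p q : ℤ} (hx : IsCo k x p) (hy : IsCo k y q) :
    IsCo k (der k y q x) (p + q) where
  slot := slotLinear_der hy.slot q hx.slot
  supp l hl := by
    refine spl_eq_zero fun u t hut => spl_eq_zero fun v w hvw => ?_
    by_cases hv : (v.length : ℤ) = q + 1
    · rw [hx.supp, smul_zero]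
      subst hvw; subst hut
      simp at hl ⊢
      omega
    · rw [hy.supp v hv, hx.slot.zero_mid, smul_zero]

end Derivations

/-! ### Insertions in a word with a marked letter -/

section Marked

variable {k : Type u} {A : Type v} [Field k] [Ring A] [Algebra k A]
variable {M : Type w} [AddCommGroup M] [Module k M]

/-- Functions of a list with a marked letter, linear in all letters. -/
structure IsML (k : Type u) {A : Type v} [Field k] [Ring A] [Algebra k A]
    {M : Type w} [AddCommGroup M] [Module k M] (F : List A → A → List A → M) : Prop where
  left : ∀ a v, SlotLinear k (fun u => F u a v)
  mid : ∀ u v (c : k) (a b : A), F u (c • a + b) v = c • F u a v + F u b v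
  right : ∀ u a, SlotLinear k (F u a)

variable (k) in
/-- `x` applied to the left of the mark. -/
def opL (x : List A → A) (p : ℤ) (F : List A → A → List A → M) (u : List A) (a : A)
    (v : List A) : M :=
  der k x p (fun u => F u a v) u

variable (k) in
/-- `x` applied to a word containing the mark. -/
def opM (x : List A → A) (p : ℤ) (F : List A → A → List A → M) (u : List A) (a : A)
    (v : List A) : M :=
  spl (fun u₁ u₂ => spl (fun v₁ v₂ =>
    sg k (p * u₁.length) • F u₁ (x (u₂ ++ a :: v₁)) v₂) v) u

variable (k) in
/-- `x` applied to the right of the mark. -/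
def opR (x : List A → A) (p : ℤ) (F : List A → A → List A → M) (u : List A) (a : A)
    (v : List A) : M :=
  sg k (p * (u.length + 1)) • der k x p (F u a) v

variable (k) in
/-- `x` applied anywhere in a marked word. -/
def opD (x : List A → A) (p : ℤ) (F : List A → A → List A → M) (u : List A) (a : A)
    (v : List A) : M :=
  opL k x p F u a v + opM k x p F u a v + opR k x p F u a v

/-- A subword lies to the left of `c`, contains `c`, or lies to the right of it. The exponent `|u| +
1` in `opR` accounts for the marked letter, which precedes the insertion. -/
theorem der_append (x : List A → A) (p : ℤ) (G : List A → M) (s : List A) (c : A) (t : List A) :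
    der k x p G (s ++ c :: t) = opD k x p (fun u a v => G (u ++ a :: v)) s c t := by
  simp only [der, opD, opL, opM, opR, spl_append, spl_add, smul_spl]
  refine congrArg₂ (· + ·) (congrArg₂ (· + ·) ?_ ?_) ?_
  · simp
  · rfl
  · refine spl_congr fun u t _ => spl_congr fun v w _ => ?_
    rw [sg_smul_smul]
    simp only [List.append_assoc, List.cons_append]
    congr 2
    simp; ring

end Marked

/-! ### Commutators of coderivations -/

section Commutators

variable {k : Type u} {A : Type v} [Field k] [Ring A] [Algebra k A]
variable {M : Type w} [AddCommGroup M] [Module k M]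
variable {x y : List A → A} {p q : ℤ}

/-- Insertions at disjoint places can be made in either order. The insertion of `x` on the left
replaces `p + 1` letters by one, which shifts the position of `y` by `p` and produces the sign
`(-1)^{pq}`. -/
theorem der_der_disjoint (hx : IsCo k x p) {G : List A → M}
    (hG : SlotLinear k G) (l : List A) :
    spl (fun u t => spl (fun v w => sg k (q * u.length) •
      opL k x p (fun u a v => G (u ++ a :: v)) u (y v) w) t) l
    = sg k (p * q) • spl (fun u t => spl (fun v w => sg k (p * u.length) •
      opR k y q (fun u a v => G (u ++ a :: v)) u (x v) w) t) l := by
  simp only [opL, opR, der, smul_spl, sg_smul_smul]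
  have h1 : ∀ u t : List A, spl (fun v w => spl (fun u₁ s => spl (fun u₂ u₃ =>
      sg k (q * u.length + p * u₁.length) • G (u₁ ++ x u₂ :: u₃ ++ y v :: w)) s) u) t
      = spl (fun u₁ s => spl (fun u₂ u₃ => spl (fun v w =>
      sg k (q * u.length + p * u₁.length) • G (u₁ ++ x u₂ :: u₃ ++ y v :: w)) t) s) u := by
    intro u t
    rw [spl_comm]
    exact spl_congr fun u₁ s _ => by rw [spl_comm]
  simp only [h1, spl_left]
  refine spl_congr fun u₁ r _ => spl_congr fun u₂ r _ => spl_congr fun u₃ t _ =>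
    spl_congr fun v w _ => ?_
  simp only [List.append_assoc, List.cons_append]
  refine hx.smul_congr (f := fun a => G (u₁ ++ a :: (u₃ ++ y v :: w))) (hG.zero_mid _ _) fun h => ?_
  simp only [List.length_append, Nat.cast_add, h, Int.even_add, Int.even_mul, Int.not_even_one]
  grind

/-- If `x` takes the letter produced by `y` among its arguments, the two insertions together form
one insertion of the brace `x{y}`. -/
theorem der_der_nested {G : List A → M}
    (hG : SlotLinear k G) (l : List A) :
    spl (fun u t => spl (fun v w => sg k (q * u.length) •
      opM k x p (fun u a v => G (u ++ a :: v)) u (y v) w) t) l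
    = der k (der k y q x) (p + q) G l := by
  simp only [opM, der, smul_spl, sg_smul_smul, hG.spl_mid, hG.smul_mid]
  have h1 : ∀ u t : List A, spl (fun v w => spl (fun u₁ u₂ => spl (fun v₁ v₂ =>
      sg k (q * u.length + p * u₁.length) • G (u₁ ++ x (u₂ ++ y v :: v₁) :: v₂)) w) u) t
      = spl (fun u₁ u₂ => spl (fun v w => spl (fun v₁ v₂ =>
      sg k (q * u.length + p * u₁.length) • G (u₁ ++ x (u₂ ++ y v :: v₁) :: v₂)) w) t) u :=
    fun u t => spl_comm _ _ _
  simp only [h1, spl_left]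
  refine spl_congr fun u₁ r _ => spl_congr fun u₂ r _ => spl_congr fun u₃ t _ =>
    spl_congr fun v w _ => ?_
  congr 1
  refine sg_congr ?_
  simp only [List.length_append, Nat.cast_add, Int.even_add, Int.even_mul]
  grind

/-- `[D_x, D_y] = D_{[x, y]}` for coderivations. -/
theorem der_comm (hx : IsCo k x p) (hy : IsCo k y q) {G : List A → M} (hG : SlotLinear k G)
    (l : List A) :
    der k y q (der k x p G) l - sg k (p * q) • der k x p (der k y q G) l
      = der k (der k y q x) (p + q) G l - sg k (p * q) • der k (der k x p y) (p + q) G l := by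
  -- The letter produced by `y` serves as the mark. Insertions of `x` on either side of it cancel
  -- against the opposite order; insertions across it give the brace.
  have e : ∀ (x y : List A → A) (p q : ℤ), der k y q (der k x p G) l
      = spl (fun u t => spl (fun v w => sg k (q * u.length) •
          opL k x p (fun u a v => G (u ++ a :: v)) u (y v) w) t) l
        + der k (der k y q x) (p + q) G l
        + spl (fun u t => spl (fun v w => sg k (q * u.length) •
          opR k x p (fun u a v => G (u ++ a :: v)) u (y v) w) t) l := by
    intro x y p q
    rw [← der_der_nested hG]
    nth_rw 1 [der]
    simp only [der_append, opD, smul_add, spl_add]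
  rw [e, e, der_der_disjoint hx hG, der_der_disjoint hy hG, add_comm q p, mul_comm q p]
  simp only [smul_add, smul_smul, sg_mul_self, one_smul]
  abel

end Commutators

/-! ### Commutators of insertions in marked words -/

section MarkedCommutators

variable {k : Type u} {A : Type v} [Field k] [Ring A] [Algebra k A]
variable {M : Type w} [AddCommGroup M] [Module k M]
variable {x y : List A → A} {p q : ℤ} {F : List A → A → List A → M}

theorem IsML.mid_zero (hF : IsML k F) (u v : List A) : F u 0 v = 0 := by
  simpa using hF.mid u v (-1) 0 0

/-- `a ↦ F u a v` as a linear map. -/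
def IsML.midMap (hF : IsML k F) (u v : List A) : A →ₗ[k] M where
  toFun a := F u a v
  map_add' a b := by simpa using hF.mid u v 1 a b
  map_smul' c a := by simpa [hF.mid_zero] using hF.mid u v c a 0

theorem IsML.mid_spl (hF : IsML k F) (u v : List A) {α : Type*} (g : List α → List α → A)
    (l : List α) : F u (spl g l) v = spl (fun s t => F u (g s t) v) l :=
  map_spl (hF.midMap u v) g l

theorem IsML.mid_smul (hF : IsML k F) (u v : List A) (c : k) (a : A) :
    F u (c • a) v = c • F u a v := map_smul (hF.midMap u v) c a

theorem IsML.mid_add (hF : IsML k F) (u v : List A) (a b : A) :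
    F u (a + b) v = F u a v + F u b v := map_add (hF.midMap u v) a b

theorem IsML.mid_sub (hF : IsML k F) (u v : List A) (a b : A) :
    F u (a - b) v = F u a v - F u b v := map_sub (hF.midMap u v) a b

theorem SlotLinear.isML {G : List A → M} (hG : SlotLinear k G) :
    IsML k (fun u a v => G (u ++ a :: v)) where
  left a v := hG.append_right (a :: v)
  mid u v c a b := hG u v c a b
  right u a := by simpa using hG.append_left (u ++ [a])

variable (k) in
/-- The marked letter is combined by `g` with neighbouring letters. -/
def opG (g : List A → A → List A → A) (r : ℤ) (F : List A → A → List A → M) (u : List A) (a : A)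
    (v : List A) : M :=
  spl (fun u₁ u₂ => spl (fun v₁ v₂ => sg k (r * u₁.length) • F u₁ (g u₂ a v₁) v₂) v) u

theorem opM_eq_opG : opM k x p F = opG k (fun u a v => x (u ++ a :: v)) p F := rfl

theorem IsML.opG (hF : IsML k F) {g : List A → A → List A → A} (hg : IsML k g) (r : ℤ) :
    IsML k (opG k g r F) where
  left a v := by
    refine SlotLinear.spl (fun u₁ => SlotLinear.spl_const v fun v₁ v₂ => ?_) fun u₂ =>
      SlotLinear.spl_const v fun v₁ v₂ => ?_
    · intro s t c y z
      have := hg.left a v₁ s t c y z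
      simp only at this ⊢
      rw [this, hF.mid, smul_add, smul_comm]
    · exact (hF.left (g u₂ a v₁) v₂).smul_length fun n => sg k (r * n)
  mid u v c a b := by
    simp only [NCCalculus.opG, smul_spl, ← spl_add]
    refine spl_congr fun u₁ u₂ _ => spl_congr fun v₁ v₂ _ => ?_
    rw [hg.mid, hF.mid, smul_add, smul_comm]
  right u a := by
    refine SlotLinear.spl_const u fun u₁ u₂ => SlotLinear.spl (fun v₁ => ?_) fun v₂ => ?_
    · exact (hF.right u₁ (g u₂ a v₁)).smul _
    · intro s t c y z
      simp only [hg.right u₂ a s t c y z, hF.mid, smul_add, smul_comm c]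

theorem IsML.opM (hF : IsML k F) (hx : SlotLinear k x) (p : ℤ) : IsML k (opM k x p F) :=
  hF.opG hx.isML p

theorem IsML.opL (hF : IsML k F) (hx : SlotLinear k x) (p : ℤ) : IsML k (opL k x p F) where
  left a v := slotLinear_der hx p (hF.left a v)
  mid u v c a b := by
    simp only [NCCalculus.opL, ← der_smul, ← der_add, hF.mid]
  right u a := by
    refine SlotLinear.spl_const u fun u₁ u₂ => SlotLinear.spl_const _ fun v₁ v₂ => ?_
    exact (hF.right _ a).smul _

theorem IsML.opR (hF : IsML k F) (hx : SlotLinear k x) (p : ℤ) : IsML k (opR k x p F) where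
  left a v := by
    have : SlotLinear k (fun u => der k x p (F u a) v) :=
      SlotLinear.spl_const v fun u₁ u₂ => SlotLinear.spl_const _ fun v₁ v₂ =>
        (hF.left a _).smul _
    exact this.smul_length fun n => sg k (p * (n + 1))
  mid u v c a b := by
    have : F u (c • a + b) = fun v => c • F u a v + F u b v := funext fun v => hF.mid u v c a b
    simp only [NCCalculus.opR, this, der_add, der_smul, smul_add, smul_comm c]
  right u a := (slotLinear_der hx p (hF.right u a)).smul _

theorem IsML.add {F' : List A → A → List A → M} (hF : IsML k F) (hF' : IsML k F') :
    IsML k (fun u a v => F u a v + F' u a v) where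
  left a v := (hF.left a v).add (hF'.left a v)
  mid u v c a b := by simp only [hF.mid, hF'.mid, smul_add]; abel
  right u a := (hF.right u a).add (hF'.right u a)

theorem IsML.opD (hF : IsML k F) (hx : SlotLinear k x) (p : ℤ) : IsML k (opD k x p F) :=
  ((hF.opL hx p).add (hF.opM hx p)).add (hF.opR hx p)

theorem opM_der (hF : IsML k F) (r : ℤ) (u : List A) (a : A) (v : List A) :
    opM k (der k y q x) r F u a v
      = opG k (opL k y q fun u a v => x (u ++ a :: v)) r F u a v
        + opG k (opM k y q fun u a v => x (u ++ a :: v)) r F u a v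
        + opG k (opR k y q fun u a v => x (u ++ a :: v)) r F u a v := by
  simp only [opM_eq_opG, opG, der_append, opD, hF.mid_add, smul_add, spl_add]

/-- Both insertions contain the mark, so one is nested in the other. -/
theorem opM_opM (hF : IsML k F) (u : List A) (a : A) (v : List A) :
    opM k y q (opM k x p F) u a v
      = opG k (opM k y q fun u a v => x (u ++ a :: v)) (p + q) F u a v := by
  simp only [opM, opG, smul_spl, sg_smul_smul, hF.mid_spl, hF.mid_smul]
  have h1 : ∀ u₁ u₂ : List A, spl (fun v₁ v₂ => spl (fun s₁ s₂ => spl (fun t₁ t₂ =>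
      sg k (q * u₁.length + p * s₁.length) • F s₁ (x (s₂ ++ y (u₂ ++ a :: v₁) :: t₁)) t₂) v₂) u₁) v
      = spl (fun s₁ s₂ => spl (fun v₁ v₂ => spl (fun t₁ t₂ =>
      sg k (q * u₁.length + p * s₁.length) • F s₁ (x (s₂ ++ y (u₂ ++ a :: v₁) :: t₁)) t₂) v₂) v) u₁ :=
    fun u₁ u₂ => spl_comm _ _ _
  simp only [h1, spl_left]
  refine spl_congr fun s₁ r _ => ?_
  symm
  rw [spl_comm]
  simp only [spl_left]
  refine spl_congr fun s₂ u₂ _ => spl_congr fun v₁ r _ => spl_congr fun t₁ t₂ _ => ?_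
  congr 1
  refine sg_congr ?_
  simp only [List.length_append, Nat.cast_add, Int.even_add, Int.even_mul]
  grind

/-- The word taken by `x` contains the mark. Either it extends far enough to the left to swallow the
letter produced by `y`, or it does not, and then the insertions are disjoint and commute up to sign.
-/
theorem opL_opM (hy : IsCo k y q) (hF : IsML k F) (u : List A) (a : A) (v : List A) :
    opL k y q (opM k x p F) u a v
      = opG k (opL k y q fun u a v => x (u ++ a :: v)) (p + q) F u a v
        + sg k (p * q) • opM k x p (opL k y q F) u a v := by
  simp only [opL, opM, opG, der, spl_append, spl_add, smul_add, smul_spl, sg_smul_smul, hF.mid_spl,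
    hF.mid_smul]
  congr 1
  · refine (spl_left_right _ _).trans ?_
    refine spl_congr fun u₁ r _ => ?_
    symm
    rw [spl_comm]
    refine spl_congr fun u₂ t _ => ?_
    rw [spl_comm]
    refine spl_congr fun s₂ s₃ _ => spl_congr fun v₁ v₂ _ => ?_
    congr 1
    refine sg_congr ?_
    simp only [List.length_append, Nat.cast_add, Int.even_add, Int.even_mul]
    grind
  · have h1 : ∀ u₁ u₂ : List A, spl (fun v₁ v₂ => spl (fun s₁ t => spl (fun s₂ s₃ =>
        sg k (p * q + p * u₁.length + q * s₁.length) •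
          F (s₁ ++ y s₂ :: s₃) (x (u₂ ++ a :: v₁)) v₂) t) u₁) v
        = spl (fun s₁ t => spl (fun s₂ s₃ => spl (fun v₁ v₂ =>
        sg k (p * q + p * u₁.length + q * s₁.length) •
          F (s₁ ++ y s₂ :: s₃) (x (u₂ ++ a :: v₁)) v₂) v) t) u₁ := by
      intro u₁ u₂
      rw [spl_comm]
      exact spl_congr fun _ _ _ => spl_comm _ _ _
    simp only [← add_assoc, h1, spl_left]
    refine spl_congr fun s₁ r _ => spl_congr fun s₂ t _ => spl_congr fun s₃ u₂ _ =>
      spl_congr fun v₁ v₂ _ => ?_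
    refine hy.smul_congr (f := fun b => F (s₁ ++ b :: s₃) (x (u₂ ++ a :: v₁)) v₂)
      ((hF.left _ _).zero_mid _ _) fun h => ?_
    simp only [List.length_append, List.length_cons, Nat.cast_add, h, Nat.cast_one, Int.even_add,
      Int.even_mul, Int.not_even_one]
    grind

/-- The mirror image of `opL_opM`. The swallowed terms are those in which `x` contains the mark and,
further to the right, the letter produced by `y`; they later become the contraction and the homotopy
`T`. -/
theorem opR_opM (hx : IsCo k x p) (hF : IsML k F) (u : List A) (a : A) (v : List A) :
    opR k y q (opM k x p F) u a v
      = opG k (opR k y q fun u a v => x (u ++ a :: v)) (p + q) F u a v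
        + sg k (p * q) • opM k x p (opR k y q F) u a v := by
  simp only [opR, opM, opG, der, spl_append, spl_add, smul_add, smul_spl, sg_smul_smul, hF.mid_spl,
    hF.mid_smul]
  rw [add_comm]
  congr 1
  · have h1 : ∀ s₁ t : List A, spl (fun s₂ s₃ => spl (fun u₁ u₂ => spl (fun v₁ v₂ =>
        sg k (q * (u.length + 1) + (q * s₁.length + p * u₁.length)) •
          F u₁ (x (u₂ ++ a :: (s₁ ++ y s₂ :: v₁))) v₂) s₃) u) t
        = spl (fun u₁ u₂ => spl (fun s₂ s₃ => spl (fun v₁ v₂ =>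
        sg k (q * (u.length + 1) + (q * s₁.length + p * u₁.length)) •
          F u₁ (x (u₂ ++ a :: (s₁ ++ y s₂ :: v₁))) v₂) s₃) t) u := fun s₁ t => spl_comm _ _ _
    refine (spl_congr fun s₁ t _ => h1 s₁ t).trans ?_
    rw [spl_comm]
    refine spl_congr fun u₁ u₂ hu => ?_
    symm
    simp only [spl_left]
    refine spl_congr fun s₁ t _ => spl_congr fun s₂ s₃ _ => spl_congr fun v₁ v₂ _ => ?_
    congr 1
    refine sg_congr ?_
    simp only [← hu, List.length_append, Nat.cast_add, Int.even_add, Int.even_mul,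
      Int.not_even_one]
    grind
  · have h1 : ∀ s₁ t : List A, spl (fun s₂ s₃ => spl (fun u₁ u₂ => spl (fun v₁ v₂ =>
        sg k (q * (u.length + 1) + (q * s₁.length + p * u₁.length)) •
          F u₁ (x (u₂ ++ a :: v₁)) (v₂ ++ y s₂ :: s₃)) s₁) u) t
        = spl (fun u₁ u₂ => spl (fun s₂ s₃ => spl (fun v₁ v₂ =>
        sg k (q * (u.length + 1) + (q * s₁.length + p * u₁.length)) •
          F u₁ (x (u₂ ++ a :: v₁)) (v₂ ++ y s₂ :: s₃)) s₁) t) u := fun s₁ t => spl_comm _ _ _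
    refine (spl_congr fun s₁ t _ => h1 s₁ t).trans ?_
    rw [spl_comm]
    refine spl_congr fun u₁ u₂ hu => ?_
    refine (spl_left_right _ _).trans ?_
    refine spl_congr fun v₁ r _ => spl_congr fun v₂ t _ => spl_congr fun s₂ s₃ _ => ?_
    refine hx.smul_congr (f := fun b => F u₁ b (v₂ ++ y s₂ :: s₃))
      (hF.mid_zero _ _) fun h => ?_
    simp only [List.length_append, List.length_cons, Nat.cast_add, Nat.cast_one] at h
    have h2 : (u.length : ℤ) = u₁.length + p - v₁.length := by
      rw [← hu, List.length_append]; push_cast; linarith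
    simp only [h2, List.length_append, Nat.cast_add, Int.even_add, Int.even_sub, Int.even_mul,
      Int.not_even_one]
    grind

theorem opL_opR (hy : IsCo k y q) (hF : IsML k F) (u : List A) (a : A)
    (v : List A) :
    opL k y q (opR k x p F) u a v = sg k (p * q) • opR k x p (opL k y q F) u a v := by
  simp only [opL, opR, der, smul_spl, sg_smul_smul]
  refine (spl_congr fun s₁ t _ => spl_comm _ _ _).trans ((spl_comm _ _ _).trans ?_)
  refine spl_congr fun t₁ t _ => ?_
  refine (spl_congr fun s₁ t _ => spl_comm _ _ _).trans ((spl_comm _ _ _).trans ?_)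
  refine spl_congr fun t₂ t₃ _ => ?_
  refine spl_congr fun s₁ s hs => spl_congr fun s₂ s₃ hs' => ?_
  refine hy.smul_congr (f := fun b => F (s₁ ++ b :: s₃) a (t₁ ++ x t₂ :: t₃))
    ((hF.left _ _).zero_mid _ _) fun h => ?_
  simp only [← hs, ← hs', List.length_append, List.length_cons, Nat.cast_add, h, Nat.cast_one,
    Int.even_add, Int.even_mul, Int.not_even_one]
  grind

theorem opL_add (F F' : List A → A → List A → M) :
    opL k x p (fun u a v => F u a v + F' u a v)
      = fun u a v => opL k x p F u a v + opL k x p F' u a v := by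
  funext u a v; exact der_add x p (fun u => F u a v) (fun u => F' u a v) u

theorem opM_add (F F' : List A → A → List A → M) :
    opM k x p (fun u a v => F u a v + F' u a v)
      = fun u a v => opM k x p F u a v + opM k x p F' u a v := by
  funext u a v; simp only [opM, smul_add, spl_add]

theorem opR_add (F F' : List A → A → List A → M) :
    opR k x p (fun u a v => F u a v + F' u a v)
      = fun u a v => opR k x p F u a v + opR k x p F' u a v := by
  funext u a v; simp only [opR, ← smul_add, ← der_add]

theorem opL_opL (hx : IsCo k x p) (hy : IsCo k y q) (hF : IsML k F) (u : List A) (a : A)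
    (v : List A) :
    opL k y q (opL k x p F) u a v - sg k (p * q) • opL k x p (opL k y q F) u a v
      = opL k (der k y q x) (p + q) F u a v
        - sg k (p * q) • opL k (der k x p y) (p + q) F u a v :=
  der_comm hx hy (hF.left a v) u

theorem opR_opR (hx : IsCo k x p) (hy : IsCo k y q) (hF : IsML k F) (u : List A) (a : A)
    (v : List A) :
    opR k y q (opR k x p F) u a v - sg k (p * q) • opR k x p (opR k y q F) u a v
      = opR k (der k y q x) (p + q) F u a v
        - sg k (p * q) • opR k (der k x p y) (p + q) F u a v := by
  have h := congrArg (sg k ((p + q) * (u.length + 1)) • ·) (der_comm hx hy (hF.right u a) v)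
  simp only [smul_sub] at h
  have e : ∀ (x y : List A → A) (p q : ℤ), opR k y q (opR k x p F) u a v
      = sg k ((p + q) * (u.length + 1)) • der k y q (der k x p (F u a)) v := by
    intro x y p q
    have : opR k x p F u a = fun v => sg k (p * (u.length + 1)) • der k x p (F u a) v := rfl
    rw [opR, this, der_smul, sg_smul_smul, add_mul, add_comm]
  rw [e, e, opR, opR, add_comm q p, smul_comm (sg k (p * q)), smul_comm (sg k (p * q))]
  exact h

theorem opR_opL (hx : IsCo k x p) (hF : IsML k F) (u : List A) (a : A) (v : List A) :
    opR k y q (opL k x p F) u a v = sg k (p * q) • opL k x p (opR k y q F) u a v := by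
  rw [opL_opR hx hF, smul_smul, mul_comm q p, sg_mul_self, one_smul]

/-- `[D_x, D_y] = D_{[x, y]}` on functions of marked words. -/
theorem opD_comm (hx : IsCo k x p) (hy : IsCo k y q) (hF : IsML k F) (u : List A) (a : A)
    (v : List A) :
    opD k y q (opD k x p F) u a v - sg k (p * q) • opD k x p (opD k y q F) u a v
      = opD k (der k y q x) (p + q) F u a v
        - sg k (p * q) • opD k (der k x p y) (p + q) F u a v := by
  have e : ∀ (x : List A → A) (p : ℤ), opD k x p F
    = fun u a v => opL k x p F u a v + opM k x p F u a v + opR k x p F u a v := fun _ _ => rfl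
  have h1 := opL_opL hx hy hF u a v
  have h2 := opR_opR hx hy hF u a v
  rw [sub_eq_iff_eq_add] at h1 h2
  rw [opD, opD, e, e]
  simp only [e, opL_add, opM_add, opR_add, h1, h2, opL_opM hy hF, opL_opM hx hF, opR_opM hx hF,
    opR_opM hy hF, opR_opL hx hF, opR_opL hy hF, opM_opM hF, opM_der hF, smul_add, smul_smul,
    mul_comm q p, sg_mul_self, one_smul, add_comm q p]
  abel

/-- The commutator of `D_x` with the insertion of `y` to the right of the mark. -/
theorem opR_opD (hx : IsCo k x p) (hy : IsCo k y q) (hF : IsML k F) (u : List A) (a : A)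
    (v : List A) :
    opR k y q (opD k x p F) u a v - sg k (p * q) • opD k x p (opR k y q F) u a v
      = opR k (der k y q x) (p + q) F u a v
        - sg k (p * q) • opR k (der k x p y) (p + q) F u a v
        + opG k (opR k y q fun u a v => x (u ++ a :: v)) (p + q) F u a v := by
  have e : opD k x p F
    = fun u a v => opL k x p F u a v + opM k x p F u a v + opR k x p F u a v := rfl
  -- Insertions to the left of the mark commute with that of `y`, insertions to the right give the
  -- bracket, and only insertions across the mark leave swallowed terms.
  have h2 := opR_opR hx hy hF u a v
  rw [sub_eq_iff_eq_add] at h2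
  rw [opD, e]
  simp only [opR_add, h2, opR_opM hx hF, opR_opL hx hF, smul_add]
  abel

end MarkedCommutators

/-! ### Cyclic sums and the Lie derivative -/

section Cyclic

variable {k : Type u} {A : Type v} [Field k] [Ring A] [Algebra k A]
variable {M : Type w} [AddCommGroup M] [Module k M]
variable {x y : List A → A} {p q : ℤ} {F : List A → A → List A → M}

variable (k) in
/-- The sum over the cyclic rotations of `a₀, l`, the letter `a₀` being marked. -/
def cyc (F : List A → A → List A → M) (a : A) (l : List A) : M :=
  spl (fun l₁ l₂ => sg k (l₂.length * (l₁.length + 1)) • F l₂ a l₁) l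

variable (k) in
/-- The Lie derivative, acting on functions of `a₀, l`. -/
def lam (x : List A → A) (p : ℤ) (G : A → List A → M) (a : A) (l : List A) : M :=
  spl (fun u t => spl (fun v w => sg k (p * (u.length + 1)) • G a (u ++ x v :: w)) t) l
    + spl (fun u t => spl (fun v w =>
        sg k (w.length * (1 + u.length + v.length)) • G (x (w ++ a :: u)) v) t) l

variable (k) in
/-- The operation `G ↦ ∑ ± G (x (t, a₀, u, y (v), w), z)` over all splittings `u, v, w, z, t`
of the argument. -/
def tau (x : List A → A) (y : List A → A) (q : ℤ) (G : A → List A → M) (a : A)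
    (l : List A) : M :=
  spl (fun s r => spl (fun z t => sg k (t.length * (1 + s.length + z.length)) •
    G (opR k y q (fun u a v => x (u ++ a :: v)) t a s) z) r) l

theorem map_cyc {N : Type*} [AddCommGroup N] [Module k N] (φ : M →ₗ[k] N)
    (F : List A → A → List A → M) (a : A) (l : List A) :
    φ (cyc k F a l) = cyc k (fun u a v => φ (F u a v)) a l := by
  simp only [cyc, map_spl, map_smul]

theorem cyc_add (F F' : List A → A → List A → M) (a : A) (l : List A) :
    cyc k (fun u a v => F u a v + F' u a v) a l = cyc k F a l + cyc k F' a l := by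
  simp only [cyc, smul_add, spl_add]

theorem cyc_smul (c : k) (F : List A → A → List A → M) (a : A) (l : List A) :
    cyc k (fun u a v => c • F u a v) a l = c • cyc k F a l := by
  simp only [cyc, smul_spl, smul_comm c]

/-- Inserting `x` in a cyclic word and cutting the circle are independent operations. If `x` avoids
`a₀`, its letter ends up to the left or to the right of the mark according to the place of the cut;
if `x` takes `a₀`, its value becomes the marked letter. -/
theorem lam_cyc (hx : IsCo k x p) (hF : IsML k F) (a : A) (l : List A) :
    lam k x p (cyc k F) a l = cyc k (opD k x p F) a l := by
  simp only [lam, cyc, opD, opL, opM, opR, der, spl_append, spl_add, smul_add, smul_spl,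
    sg_smul_smul]
  have h1 : spl (fun u t => spl (fun v w => spl (fun l₁ l₂ =>
      sg k (p * (u.length + 1) + (l₂ ++ x v :: w).length * (l₁.length + 1)) •
        F (l₂ ++ x v :: w) a l₁) u) t) l
      = spl (fun l₁ l₂ => spl (fun u₁ t => spl (fun u₂ u₃ =>
        sg k (l₂.length * (l₁.length + 1) + p * u₁.length) • F (u₁ ++ x u₂ :: u₃) a l₁) t) l₂) l := by
    refine (spl_left_right _ _).trans ?_
    refine spl_congr fun l₁ r h1 => spl_congr fun u t h2 => spl_congr fun v w h3 => ?_
    refine hx.smul_congr (f := fun b => F (u ++ b :: w) a l₁) ((hF.left _ _).zero_mid _ _) fun h => ?_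
    simp only [← h2, ← h3, List.length_append, List.length_cons, Nat.cast_add, h,
      Nat.cast_one, Int.even_add, Int.even_mul, Int.not_even_one]
    grind
  have h2 : spl (fun u t => spl (fun v w => spl (fun u₁ l₂ =>
      sg k (p * (u.length + 1) + l₂.length * ((u ++ x v :: u₁).length + 1)) •
        F l₂ a (u ++ x v :: u₁)) w) t) l
      = spl (fun l₁ l₂ => spl (fun v₁ t => spl (fun v₂ v₃ =>
        sg k (l₂.length * (l₁.length + 1) + (p * (l₂.length + 1) + p * v₁.length)) •
          F l₂ a (v₁ ++ x v₂ :: v₃)) t) l₁) l := by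
    symm
    simp only [spl_left]
    refine spl_congr fun v₁ r h1 => spl_congr fun v₂ t h2 => spl_congr fun v₃ l₂ h3 => ?_
    refine hx.smul_congr (f := fun b => F l₂ a (v₁ ++ b :: v₃)) ((hF.right _ _).zero_mid _ _) fun h => ?_
    simp only [List.length_append, List.length_cons, Nat.cast_add, h,
      Nat.cast_one, Int.even_add, Int.even_mul, Int.not_even_one]
    grind
  have h3 : spl (fun u t => spl (fun v w => spl (fun l₁ l₂ =>
      sg k (w.length * (1 + u.length + v.length) + l₂.length * (l₁.length + 1)) •
        F l₂ (x (w ++ a :: u)) l₁) v) t) l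
      = spl (fun l₁ l₂ => spl (fun u₁ u₂ => spl (fun v₁ v₂ =>
        sg k (l₂.length * (l₁.length + 1) + p * u₁.length) •
          F u₁ (x (u₂ ++ a :: v₁)) v₂) l₁) l₂) l := by
    symm
    refine (spl_congr fun l₁ l₂ _ => spl_comm _ _ _).trans ?_
    simp only [spl_left]
    refine spl_congr fun v₁ r h1 => spl_congr fun v₂ t h2 => spl_congr fun u₁ u₂ h3 => ?_
    refine hx.smul_congr (f := fun b => F u₁ b v₂) (hF.mid_zero _ _) fun h => ?_
    simp only [List.length_append, List.length_cons, Nat.cast_add, Nat.cast_one] at h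
    have h4 : (u₂.length : ℤ) = p - v₁.length := by linarith
    simp only [← h3, List.length_append, Nat.cast_add, h4, Int.even_sub,
      Int.even_add, Int.even_mul, Int.not_even_one]
    grind
  rw [h1, h2, h3]
  abel

/-- The same principle as `lam_cyc`, for the insertions in which `x` takes both `a₀` and a later
letter produced by `y`. -/
theorem tau_cyc (hx : IsCo k x p) (hy : IsCo k y q) (hF : IsML k F) (a : A) (l : List A) :
    tau k x y q (cyc k F) a l
      = cyc k (opG k (opR k y q fun u a v => x (u ++ a :: v)) (p + q) F) a l := by
  simp only [tau, cyc, opG, smul_spl, sg_smul_smul]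
  symm
  refine (spl_congr fun l₁ l₂ _ => spl_comm _ _ _).trans ?_
  simp only [spl_left]
  refine spl_congr fun s r h1 => spl_congr fun z₁ t h2 => spl_congr fun z₂ t h3 => ?_
  -- Together `x` and `y` consume exactly `p + q + 1` letters; otherwise the new marked letter is
  -- zero.
  by_cases hl : (t.length : ℤ) + 1 + s.length = p + q + 1
  · congr 1
    refine sg_congr ?_
    have h4 : (t.length : ℤ) = p + q - s.length := by linarith
    simp only [← h3, List.length_append, Nat.cast_add, h4, Int.even_sub,
      Int.even_add, Int.even_mul, Int.not_even_one]
    grind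
  · have : opR k y q (fun u a v => x (u ++ a :: v)) t a s = 0 := by
      rw [opR, der]
      refine smul_eq_zero_of_right _ (spl_eq_zero fun u r h5 => spl_eq_zero fun v w h6 => ?_)
      by_cases hv : (v.length : ℤ) = q + 1
      · rw [hx.supp, smul_zero]
        subst h6; subst h5
        simp at hl ⊢; omega
      · rw [hy.supp v hv, hx.slot.eq_zero (by simp), smul_zero]
    rw [this, hF.mid_zero, smul_zero, smul_zero]

end Cyclic

/-! ### The chain operators as sums over splittings and rotations -/

section Conversions

variable {k : Type u} {A : Type v} [Field k] [Ring A] [Algebra k A]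
variable {M : Type w} [AddCommGroup M] [Module k M]
variable {x y : List A → A} {p q : ℤ}

theorem IsCo.eq_zero (hx : IsCo k x p) {l : List A} (h : l.length ≠ (p + 1).toNat) : x l = 0 :=
  hx.supp l (by omega)

theorem isCo_coe (x : Cochain k A p) : IsCo k x.1 p := ⟨x.2.1, x.2.2.2⟩

theorem isCo_mulList : IsCo k (mulList (A := A)) 1 where
  slot := slotLinear_mulList
  supp l hl := by
    rcases l with _ | ⟨a, _ | ⟨b, _ | ⟨c, l⟩⟩⟩
    · rfl
    · rfl
    · simp at hl
    · rfl

theorem der_eq_sum (hx : IsCo k x p) {G : List A → M} (hG : SlotLinear k G) (l : List A) :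
    der k x p G l = ∑ i ∈ Finset.range (l.length + 1),
      sg k (p * i) • G (ins x (p + 1).toNat i l) := by
  rw [der, spl_eq_sum]
  refine Finset.sum_congr rfl fun i hi => ?_
  rw [spl_eq_single _ _ (p + 1).toNat fun u v h => by
    rw [hx.eq_zero h, hG.zero_mid, smul_zero]]
  simp only [ins, List.drop_drop, List.length_take]
  rw [Finset.mem_range] at hi
  rw [min_eq_left (by omega)]

theorem braceFun_eq_der (hx : IsCo k x p) (hy : IsCo k y q) (l : List A) :
    braceFun (k := k) q x y l = der k y q x l := (der_eq_sum hy hx.slot l).symm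

theorem rotate_cons (a : A) (l : List A) {i : ℕ} (hi : i ≤ l.length) :
    (a :: l).rotate (i + 1) = l.drop i ++ a :: l.take i := by
  rw [List.rotate_cons_succ]
  have := List.rotate_append_length_eq (l.take i) (l.drop i ++ [a])
  rw [← List.append_assoc, List.take_append_drop, List.length_take, min_eq_left hi] at this
  simpa using this

/-- Both families are indexed by the place `i` where the arguments of `x` begin. For each `i` they
fit before the end of the word or wrap around through `a₀`, so only one of the two sums of `lam`
contributes. -/
theorem lieFun_cons (hx : IsCo k x p) (a : A) (l : List A) :
    lieFun (k := k) p x (a :: l) = sg k p • lam k x p (fun a l => chain k (a :: l)) a l := by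
  have hc := slotLinear_chain k (A := A)
  rw [lam, smul_add]
  simp only [spl_assoc (fun u v w => sg k (w.length * (1 + u.length + v.length)) •
    chain k (x (w ++ a :: u) :: v))]
  rw [spl_eq_sum, spl_eq_sum, Finset.smul_sum, Finset.smul_sum, ← Finset.sum_add_distrib, lieFun,
    List.length_cons]
  refine Finset.sum_congr rfl fun i hi => ?_
  rw [Finset.mem_range] at hi
  rw [spl_eq_single _ _ (p + 1).toNat fun u v h => by
    rw [hx.eq_zero h, ← List.cons_append, hc.zero_mid, smul_zero]]
  -- `x` takes all letters after the `i`-th and then `a₀`, which leaves `p - |l.drop i|` letters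
  -- from the start of `l`. If this is negative, `toNat` gives `0`, and the term vanishes because
  -- `x` has too many arguments.
  rw [spl_eq_single _ (l.take i) (p - (l.drop i).length).toNat fun u v h => by
    rw [hx.supp, hc.eq_zero (by simp), smul_zero]
    simp only [List.length_append, List.length_cons]
    omega]
  have hlt : (l.take i).length = i := by simp; omega
  have hld : (l.drop i).length = l.length - i := by simp
  split_ifs with h
  · rw [hx.supp (_ ++ _)]
    · rw [hc.eq_zero (l := 0 :: _) (by simp), smul_zero, smul_zero, add_zero, sg_smul_smul, hlt]
      congr 1
      · refine sg_congr (k := k) ?_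
        simp only [Int.even_add, Int.even_mul, Int.not_even_one]
        grind
      · simp only [ins, List.take_succ_cons, List.cons_append, List.drop_drop, List.drop_succ_cons]
        congr 4
        rw [show i + 1 + (p + 1).toNat = (i + (p + 1).toNat) + 1 by omega, List.drop_succ_cons]
    · simp only [List.length_append, List.length_cons, hld]
      omega
  · rw [hx.supp ((l.drop i).take _)]
    · rw [← List.cons_append, hc.zero_mid, smul_zero, smul_zero, zero_add, sg_smul_smul,
        rotate_cons a l (by omega)]
      have e1 : (l.drop i).length + (((p + 1).toNat - (l.drop i).length - 1) + 1)
        = (p + 1).toNat := by rw [hld]; omega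
      have e2 : (p - (l.drop i).length).toNat = (p + 1).toNat - (l.drop i).length - 1 := by omega
      simp only [ins, List.take_zero, List.nil_append, List.drop_zero, zero_add]
      rw [← e1, List.take_length_add_append, List.drop_length_add_append, List.take_succ_cons,
        List.drop_succ_cons, e2]
      congr 1
      refine sg_congr (k := k) ?_
      generalize (p + 1).toNat - (l.drop i).length - 1 = c
      have e3 : (1 : ℤ) + ((l.take i).take c).length + ((l.take i).drop c).length = 1 + i := by
        have := congrArg List.length (List.take_append_drop c (l.take i))
        rw [List.length_append, hlt] at this
        omega
      rw [e3, hld, Nat.cast_sub (by omega)]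
      push_cast
      simp only [Int.even_add, Int.even_sub, Int.even_mul, Int.not_even_one]
      grind
    · rw [List.length_take, hld]
      omega

/-- The function `(u, a, v) ↦ 1 ⊗ u ⊗ a ⊗ v`. -/
noncomputable def oneChain (k : Type u) {A : Type v} [Field k] [Ring A] [Algebra k A] (u : List A) (a : A)
    (v : List A) : Chain k A := chain k (1 :: (u ++ a :: v))

theorem isML_oneChain : IsML k (oneChain k (A := A)) :=
  ((slotLinear_chain k).cons 1).isML

theorem connesFun_cons (a : A) (l : List A) :
    connesFun (k := k) (a :: l) = cyc k (oneChain k) a l := by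
  rw [connesFun, cyc, spl_eq_sum, Finset.sum_range_succ, List.length_cons, Finset.sum_range_succ']
  congr 1
  · refine Finset.sum_congr rfl fun i hi => ?_
    rw [Finset.mem_range] at hi
    rw [rotate_cons a l (by omega), oneChain]
    congr 1
    have e : ∀ n : ℕ, (-1 : k) ^ n = sg k n := fun n => by simp [sg]
    rw [e]
    refine sg_congr ?_
    simp only [List.length_drop, List.length_take]
    rw [min_eq_left (by omega), Nat.cast_sub (by omega)]
    push_cast
    simp only [Int.even_add, Int.even_sub, Int.even_mul, Int.not_even_one]
    grind
  · simp [oneChain]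

/-- In `sFun` the index `m` is the place where the circle is cut, and `j` the place of the insertion
between `a₀` and the cut. So `S_x` is the operator `B` with `x` inserted to the right of the mark.
-/
theorem sFun_cons (hx : IsCo k x p) (a : A) (l : List A) :
    sFun (k := k) p x (a :: l) = sg k p • cyc k (opR k x p (oneChain k)) a l := by
  have hc := slotLinear_chain k (A := A)
  rw [sFun, Finset.sum_comm, cyc, spl_eq_sum, Finset.smul_sum, List.length_cons]
  refine Finset.sum_congr rfl fun m hm => ?_
  rw [Finset.mem_range] at hm
  obtain ⟨l₁, l₂, rfl, rfl⟩ : ∃ l₁ l₂, l = l₁ ++ l₂ ∧ l₁.length = m :=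
    ⟨l.take m, l.drop m, by simp, by simp; omega⟩
  rw [List.take_left, List.drop_left, opR, der, spl_eq_sum]
  have hs : Finset.range (l₁.length + 1) ⊆ Finset.range ((l₁ ++ l₂).length + 1) := by
    simp
  rw [← Finset.sum_subset hs]
  · simp only [Finset.smul_sum]
    refine Finset.sum_congr rfl fun j hj => ?_
    rw [Finset.mem_range] at hj
    rw [spl_eq_single _ _ (p + 1).toNat fun u v h => by
      rw [hx.eq_zero h, (isML_oneChain.right _ _).zero_mid, smul_zero]]
    split_ifs with h
    · rw [sg_smul_smul, sg_smul_smul, sg_smul_smul]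
      congr 1
      · refine sg_congr (k := k) ?_
        rw [List.length_take, min_eq_left (by omega), List.length_append]
        push_cast
        simp only [Int.even_add, Int.even_sub, Int.even_mul, Int.not_even_one]
        grind
      · rw [oneChain]
        have e1 : ins x (p + 1).toNat (j + 1) (a :: (l₁ ++ l₂))
            = (a :: (l₁.take j ++ x ((l₁.drop j).take (p + 1).toNat)
              :: (l₁.drop j).drop (p + 1).toNat)) ++ l₂ := by
          rw [ins, List.take_succ_cons, List.drop_succ_cons,
            show j + 1 + (p + 1).toNat = (j + (p + 1).toNat) + 1 by omega, List.drop_succ_cons,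
            List.take_append_of_le_length (by omega), List.drop_append_of_le_length (by omega),
            List.drop_append_of_le_length (by omega),
            List.take_append_of_le_length (by simp; omega), List.drop_drop]
          simp
        have e2 : l₁.length + 2 - (p + 1).toNat
            = (a :: (l₁.take j ++ x ((l₁.drop j).take (p + 1).toNat)
              :: (l₁.drop j).drop (p + 1).toNat)).length := by
          simp; omega
        rw [e1, e2, List.rotate_append_length_eq]
    · rw [hx.eq_zero (by simp; omega), (isML_oneChain.right _ _).zero_mid]
      simp
  · intro j hj hj'
    rw [Finset.mem_range] at hj'
    rw [if_neg (by omega)]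

/-- For the multiplication `m` of degree one, `b = -L_m`, in accordance with `μ = -m`. The factor
`(-1)^{|m|}` of `lieFun_cons` absorbs this sign. -/
theorem bFun_cons (a : A) (l : List A) :
    bFun (k := k) (a :: l) = lam k mulList 1 (fun a l => chain k (a :: l)) a l := by
  have h := lieFun_cons (k := k) (isCo_mulList (A := A)) a l
  have h2 : bFun (k := k) (a :: l) = - lieFun (k := k) 1 mulList (a :: l) := by
    rcases l with _ | ⟨c, l⟩
    · have hz : chain k [(0 : A)] = 0 := (slotLinear_chain k).eq_zero (by simp)
      simp [bFun, lieFun, ins, mulList, hz]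
    · have e2 : (1 + 1 : ℤ).toNat = 2 := rfl
      have e : ∀ n : ℕ, (-1 : k) ^ n = sg k n := fun n => by simp [sg]
      have e' : ∀ n : ℤ, (-1 : k) ^ n = sg k n := fun n => rfl
      simp only [bFun, lieFun, List.length_cons, Nat.add_sub_cancel, e2]
      rw [Finset.sum_range_succ' _ l.length, Finset.sum_range_succ _ (l.length + 1),
        Finset.sum_range_succ _ l.length, if_neg (by omega), if_neg (by omega),
        Finset.sum_congr rfl fun i hi => if_pos (by rw [Finset.mem_range] at hi; omega)]
      have hr : (a :: c :: l).rotate (l.length + 1 + 1) = a :: c :: l := by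
        have := List.rotate_length (a :: c :: l)
        simpa only [List.length_cons] using this
      simp only [hr, e, e', neg_add, ← Finset.sum_neg_distrib, neg_sg_smul]
      rw [add_right_comm _ (sg k ((0 : ℕ) : ℤ) • _)]
      congr 1
      · congr 1
        · refine Finset.sum_congr rfl fun i _ => ?_
          congr 1
          refine sg_congr ?_
          push_cast
          simp only [Int.even_add, Int.even_mul, Int.not_even_one]
          grind
        · congr 1
          refine sg_congr ?_
          push_cast
          simp only [Int.even_add, Int.even_sub, Int.even_mul, Int.not_even_one]
          grind
      · congr 1
        refine sg_congr ?_
        push_cast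
        simp only [Int.even_add, Int.even_sub, Int.even_mul, Int.not_even_one]
        grind
  rw [h2, h]
  simp

end Conversions

/-! ### The Gerstenhaber bracket and the Hochschild coboundary -/

section Brackets

variable {k : Type u} {A : Type v} [Field k] [Ring A] [Algebra k A]
variable {M : Type w} [AddCommGroup M] [Module k M]
variable {x y : List A → A} {p q : ℤ} {F : List A → A → List A → M}

variable (k) in
/-- The Gerstenhaber bracket of not necessarily normalized cochains. -/
def br (x : List A → A) (p : ℤ) (y : List A → A) (q : ℤ) (l : List A) : A :=
  der k y q x l - sg k (p * q) • der k x p y l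

theorem isCo_br (hx : IsCo k x p) (hy : IsCo k y q) : IsCo k (br k x p y q) (p + q) where
  slot := (isCo_der hx hy).slot.sub ((isCo_der hy hx).slot.smul _)
  supp l hl := by
    rw [br, (isCo_der hx hy).supp l hl, (isCo_der hy hx).supp l (by omega), smul_zero, sub_zero]

theorem opR_br (hF : IsML k F) (r : ℤ) (u : List A) (a : A) (v : List A) :
    opR k (br k x p y q) r F u a v
      = opR k (der k y q x) r F u a v - sg k (p * q) • opR k (der k x p y) r F u a v := by
  have := der_fun_sub (der k y q x) (der k x p y) (sg k (p * q)) r (hF.right u a) v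
  simp only [opR]
  rw [smul_comm (sg k (p * q)), ← smul_sub, ← this]
  rfl

theorem opD_br (hF : IsML k F) (r : ℤ) (u : List A) (a : A) (v : List A) :
    opD k (br k x p y q) r F u a v
      = opD k (der k y q x) r F u a v - sg k (p * q) • opD k (der k x p y) r F u a v := by
  have h1 := der_fun_sub (der k y q x) (der k x p y) (sg k (p * q)) r (hF.left a v) u
  have h2 : opM k (br k x p y q) r F u a v
      = opM k (der k y q x) r F u a v - sg k (p * q) • opM k (der k x p y) r F u a v := by
    have e : ∀ a b : M, a - sg k (p * q) • b = a + (-sg k (p * q)) • b := fun a b => by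
      rw [neg_smul, sub_eq_add_neg]
    rw [e]
    simp only [opM, br, hF.mid_sub, hF.mid_smul, e, smul_add, spl_add, smul_spl]
    congr 1
    refine spl_congr fun _ _ _ => spl_congr fun _ _ _ => ?_
    rw [smul_comm]
  simp only [opD, opR_br hF, h2]
  have h3 : opL k (br k x p y q) r F u a v
      = opL k (der k y q x) r F u a v - sg k (p * q) • opL k (der k x p y) r F u a v := h1
  rw [h3]
  simp only [smul_add]
  abel

theorem gerst_eq_br {r : ℤ} (h : p + q = r) (x : Cochain k A p) (y : Cochain k A q) :
    (gerst h x y).1 = br k x.1 p y.1 q := by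
  funext l
  simp only [gerst, br, Submodule.coe_sub, Submodule.coe_smul, Pi.sub_apply, Pi.smul_apply,
    braceFun_eq_der (isCo_coe x) (isCo_coe y), braceFun_eq_der (isCo_coe y) (isCo_coe x), sg]

/-- A product has two arguments, so `x` must take all letters but the first or all but the last. -/
theorem der_mulList (hx : IsCo k x p) (a : A) (l : List A) (c : A) :
    der k x p mulList (a :: l ++ [c]) = sg k p • (a * x (l ++ [c])) + x (a :: l) * c := by
  by_cases hl : (l.length : ℤ) = p
  · rw [der_eq_sum hx slotLinear_mulList]
    have hP : (p + 1).toNat = l.length + 1 := by omega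
    have h2 : (a :: l ++ [c]).length + 1 = l.length + 1 + 1 + 1 := by simp
    rw [h2, Finset.sum_range_succ', Finset.sum_range_succ', Finset.sum_eq_zero]
    · rw [hP]
      have : (a :: l ++ [c]) = a :: (l ++ [c]) := rfl
      simp only [ins, this, zero_add, List.take_succ_cons, List.take_zero, List.drop_succ_cons,
        List.drop_zero, List.cons_append, List.nil_append, Nat.add_comm 1 (l.length + 1)]
      rw [List.take_of_length_le (by simp), List.drop_eq_nil_of_le (by simp), List.take_left,
        List.drop_left]
      simp [mulList]
    · intro i _
      rw [isCo_mulList.supp (k := k), smul_zero]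
      simp only [ins, List.length_append, List.length_cons, List.length_take, List.length_drop,
        List.length_nil]
      omega
  · rw [(isCo_der isCo_mulList hx).supp, hx.supp, hx.supp]
    · simp
    · simpa using hl
    · simpa using hl
    · simp; omega

/-- The differential is the bracket with `μ`, and `μ` is minus the multiplication. The inner terms
of the coboundary come from inserting products in `x`, the two outer ones from inserting `x` in a
product. -/
theorem br_mulList {r : ℤ} (h : r = p + 1) (x : Cochain k A p) (l : List A) :
    br k mulList 1 x.1 p l = -(cochainD h x).1 l := by
  by_cases hl : (l.length : ℤ) = p + 2
  · rw [cochainD]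
    simp only [LinearMap.smul_apply, Submodule.coe_smul, Pi.smul_apply, hochDiff,
      LinearMap.coe_mk, AddHom.coe_mk, hochFun, br]
    have e' : ∀ n : ℤ, (-1 : k) ^ n = sg k n := fun n => rfl
    have e : ∀ n : ℕ, (-1 : k) ^ n = sg k n := fun n => by simp [sg]
    have hd : der k mulList 1 x.1 l = ∑ i ∈ Finset.range (l.length - 1),
        sg k i • x.1 (ins mulList 2 i l) := by
      rw [der_eq_sum isCo_mulList x.2.1]
      have : Finset.range (l.length - 1) ⊆ Finset.range (l.length + 1) := by
        simp; omega
      rw [← Finset.sum_subset this]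
      · simp
      · intro i _ hi
        rw [Finset.mem_range] at hi
        have : mulList ((l.drop i).take (1 + 1 : ℤ).toNat) = (0 : A) := by
          refine isCo_mulList.supp (k := k) _ ?_
          simp; omega
        rw [x.2.1.eq_zero (by rw [ins, this]; simp), smul_zero]
    rw [hd]
    rcases l with _ | ⟨a, l⟩
    · simp only [List.length_nil, Nat.cast_zero] at hl
      have h0 : ∀ l, l.length = 0 → x.1 l = 0 := fun l h => x.2.2.2 l (by omega)
      have h1 : der k x.1 p mulList ([] : List A) = 0 := by
        simp [der, mulList]
      rw [h1]
      simp [h0]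
    · rcases List.eq_nil_or_concat l with rfl | ⟨l, c, rfl⟩
      · have hp : p = -1 := by simp at hl; omega
        subst hp
        have h1 : der k x.1 (-1) mulList [a] = sg k (-1) • (a * x.1 []) + x.1 [] * a := by
          simp [der, spl_cons, mulList, add_comm]
        rw [h1]
        simp [sg, add_comm]
      · rw [List.concat_eq_append, ← List.cons_append, der_mulList (isCo_coe x)]
        have hdl : (a :: l ++ [c]).dropLast = a :: l := List.dropLast_concat
        have hgl : (a :: l ++ [c]).getLastD 0 = c := List.getLastD_concat
        rw [hdl, hgl]
        simp only [e, e', List.cons_append, List.headD_cons, List.tail_cons,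
          LinearMap.mul_apply', LinearMap.flip_apply, smul_add, Finset.smul_sum, neg_add,
          sub_eq_add_neg, ← Finset.sum_neg_distrib, neg_sg_smul, sg_smul_smul]
        rw [add_right_comm]
        congr 1
        · congr 1
          · congr 1
            exact sg_congr (by simp only [Int.even_add, Int.not_even_one]; grind)
          · refine Finset.sum_congr rfl fun i _ => ?_
            congr 1
            refine sg_congr ?_
            push_cast
            simp only [Int.even_add, Int.even_mul, Int.not_even_one]
            grind
        · rw [sg_even, one_smul]
          simp only [List.length_cons, List.length_append, List.length_nil, List.concat_eq_append,
            Nat.cast_add, Nat.cast_one, zero_add] at hl ⊢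
          rw [hl]
          exact ⟨p + 2, by ring⟩
  · rw [(isCo_br isCo_mulList (isCo_coe x)).supp l (by omega), (cochainD h x).2.2.2 l (by omega), neg_zero]

end Brackets

/-! ### Chains that begin with the unit -/

section CartanFormulas

variable {k : Type u} {A : Type v} [Field k] [Ring A] [Algebra k A]
variable {M : Type w} [AddCommGroup M] [Module k M]
variable {p q : ℤ}

theorem chain_hom_ext_cons {f g : Chain k A →ₗ[k] M}
    (h : ∀ a l, f (chain k (a :: l)) = g (chain k (a :: l))) : f = g :=
  chain_hom_ext fun l => by
    cases l with
    | nil => rw [chain_nil, map_zero, map_zero]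
    | cons a l => exact h a l

theorem b_cons (a : A) (l : List A) :
    b (chain k (a :: l)) = lam k mulList 1 (fun a l => chain k (a :: l)) a l := by
  rw [b, chainLift_chain, bFun_cons]

theorem connes_cons (a : A) (l : List A) :
    connes (chain k (a :: l)) = cyc k (oneChain k) a l := by
  rw [connes, chainLift_chain, connesFun_cons]

theorem lieDer_cons (x : Cochain k A p) (a : A) (l : List A) :
    lieDer x (chain k (a :: l)) = sg k p • lam k x.1 p (fun a l => chain k (a :: l)) a l := by
  rw [lieDer, chainLift_chain, lieFun_cons (isCo_coe x)]

theorem sOp_cons (x : Cochain k A p) (a : A) (l : List A) :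
    sOp x (chain k (a :: l)) = sg k p • cyc k (opR k x.1 p (oneChain k)) a l := by
  rw [sOp, chainLift_chain, sFun_cons (isCo_coe x)]

theorem contr_cons (x : Cochain k A p) (a : A) (l : List A) :
    contr x (chain k (a :: l))
      = chain k ((a * x.1 (l.take (p + 1).toNat)) :: l.drop (p + 1).toNat) := by
  rw [contr, chainLift_chain, contrFun]

theorem contr_cons_spl (x : Cochain k A p) (a : A) (l : List A) :
    contr x (chain k (a :: l)) = spl (fun u v => chain k ((a * x.1 u) :: v)) l := by
  rw [contr_cons, spl_eq_single _ _ (p + 1).toNat fun u v h => by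
    rw [(isCo_coe x).eq_zero h, mul_zero, (slotLinear_chain k).eq_zero (by simp)]]

theorem map_lam {N : Type*} [AddCommGroup N] [Module k N] (φ : M →ₗ[k] N) (x : List A → A) (p : ℤ)
    (G : A → List A → M) (a : A) (l : List A) :
    φ (lam k x p G a l) = lam k x p (fun a l => φ (G a l)) a l := by
  simp only [lam, map_add, map_spl, map_smul]

theorem lam_smul (x : List A → A) (p : ℤ) (c : k) (G : A → List A → M) (a : A) (l : List A) :
    lam k x p (fun a l => c • G a l) a l = c • lam k x p G a l := by
  simp only [lam, smul_add, smul_spl, smul_comm c]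

theorem map_opR {N : Type*} [AddCommGroup N] [Module k N] (φ : M →ₗ[k] N) (x : List A → A) (p : ℤ)
    (F : List A → A → List A → M) (u : List A) (a : A) (v : List A) :
    φ (opR k x p F u a v) = opR k x p (fun u a v => φ (F u a v)) u a v := by
  simp only [opR, map_smul, map_der]

/-- Since `x` is normalized, the terms in which it takes the leading `1` vanish; the remaining ones
form the coderivation of the word that follows. -/
theorem lieDer_one (x : Cochain k A p) (w : List A) :
    lieDer x (chain k (1 :: w)) = der k x.1 p (fun w => chain k (1 :: w)) w := by
  rw [lieDer_cons, lam, smul_add, smul_spl, der]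
  have h2 : spl (fun u t => spl (fun v w => sg k (w.length * (1 + u.length + v.length)) •
      chain k (x.1 (w ++ 1 :: u) :: v)) t) w = 0 := by
    refine spl_eq_zero fun u t _ => spl_eq_zero fun v w _ => ?_
    rw [x.2.2.1 _ (by simp), (slotLinear_chain k).eq_zero (by simp), smul_zero]
  rw [h2, smul_zero, add_zero]
  refine spl_congr fun u t _ => ?_
  rw [smul_spl]
  refine spl_congr fun v w _ => ?_
  rw [sg_smul_smul]
  congr 1
  refine sg_congr ?_
  simp only [Int.even_add, Int.even_mul, Int.not_even_one]
  grind

theorem lieDer_oneChain (x : Cochain k A p) (u : List A) (a : A) (v : List A) :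
    lieDer x (oneChain k u a v) = opD k x.1 p (oneChain k) u a v := by
  rw [oneChain, lieDer_one, der_append]
  rfl

/-- The operator `1 - t`, where `t` is the signed cyclic permutation. -/
noncomputable def oneSubT (k : Type u) {A : Type v} [Field k] [Ring A] [Algebra k A]
    (w : List A) : Chain k A :=
  chain k w - sg k (w.length + 1) • chain k (w.rotate (w.length - 1))

theorem rotate_concat (w : List A) (c : A) :
    (w ++ [c]).rotate ((w ++ [c]).length - 1) = c :: w := by
  simp

/-- The leading `1` is multiplied with the first letter of `w` and, cyclically, with the last one.
These two terms form `1 - t`; all others multiply neighbours inside `w`. -/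
theorem b_one (w : List A) (hw : w ≠ []) : b (chain k (1 :: w))
    = -der k mulList 1 (fun w => chain k (1 :: w)) w + oneSubT k w := by
  rw [b_cons, lam]
  congr 1
  · rw [der, ← neg_one_smul k, smul_spl]
    refine spl_congr fun u t _ => ?_
    rw [smul_spl]
    refine spl_congr fun v w _ => ?_
    rw [mul_add, sg_add]
    simp
  · have hz : ∀ t : List A, chain k ((0 : A) :: t) = 0 :=
      fun t => (slotLinear_chain k).eq_zero (by simp)
    have h0 : ∀ w u v : List A, w ++ u ≠ [] → (w ++ u).length ≠ 1 →
        chain k (mulList (w ++ (1 : A) :: u) :: v) = 0 := by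
      intro w u v h1 h2
      rw [isCo_mulList.supp (k := k), hz]
      simp at h1 h2 ⊢
      omega
    obtain ⟨w₀, c₀, hw₀⟩ := (List.eq_nil_or_concat w).resolve_left hw
    obtain ⟨c, w', hw'⟩ := List.exists_cons_of_ne_nil hw
    have e1 : spl (fun v z => sg k (z.length * (1 + ([] : List A).length + v.length)) •
        chain k (mulList (z ++ (1 : A) :: []) :: v)) w
        = -(sg k (w.length + 1) • chain k (w.rotate (w.length - 1))) := by
      rw [hw₀, List.concat_eq_append, spl_append, rotate_concat, spl_eq_right_nil, spl_nil]
      · have e3 : mulList [(1 : A)] = 0 := rfl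
        simp only [List.nil_append, e3, hz, smul_zero, add_zero]
        rw [neg_sg_smul]
        simp only [mulList, List.cons_append, List.nil_append, mul_one]
        congr 1
        refine sg_congr ?_
        simp only [List.length_append, List.length_cons, List.length_nil, Nat.cast_add,
          Nat.cast_one, Nat.cast_zero, Int.even_add, Int.even_mul, Int.not_even_one, Even.zero]
        grind
      · intro v z hz'
        rw [h0 _ _ _ (by simp), smul_zero]
        have := List.length_pos_iff.2 hz'
        simp; omega
    have e2 : spl (fun u t => spl (fun v z =>
        sg k (z.length * (1 + (c :: u).length + v.length)) •
        chain k (mulList (z ++ (1 : A) :: c :: u) :: v)) t) w' = chain k w := by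
      rw [spl_eq_left_nil, spl_eq_right_nil]
      · simp [mulList, hw']
      · intro v z hz'
        rw [h0 _ _ _ (by simp), smul_zero]
        have := List.length_pos_iff.2 hz'
        simp; omega
      · intro u t hu
        refine spl_eq_zero fun v z _ => ?_
        rw [h0 _ _ _ (by simp), smul_zero]
        have := List.length_pos_iff.2 hu
        simp; omega
    rw [oneSubT, sub_eq_add_neg, ← e1, ← e2, add_comm]
    nth_rw 1 [hw']
    rw [spl_cons, hw']

theorem b_oneChain (u : List A) (a : A) (v : List A) :
    b (oneChain k u a v) = -opD k mulList 1 (oneChain k) u a v + oneSubT k (u ++ a :: v) := by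
  rw [oneChain, b_one _ (by simp), der_append]
  rfl

/-- The old leading `1` becomes a letter in `A / k`. As `B` and `S_x` produce chains that begin with
`1`, this gives `B B = 0` and `B S_x = 0`. -/
theorem connes_one (l : List A) : connes (chain k (1 :: l)) = 0 := by
  rw [connes_cons]
  refine spl_eq_zero fun u v _ => ?_
  rw [oneChain, chain_one k (by simp), smul_zero]

theorem connes_connes (c : Chain k A) : connes (connes c) = 0 := by
  have : connes ∘ₗ connes = (0 : Chain k A →ₗ[k] Chain k A) := chain_hom_ext_cons fun a l => by
    rw [LinearMap.comp_apply, connes_cons, map_cyc]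
    simp only [oneChain, connes_one]
    simp [cyc, spl_zero]
  exact LinearMap.congr_fun this c

theorem connes_sOp (x : Cochain k A p) (c : Chain k A) : connes (sOp x c) = 0 := by
  have : connes ∘ₗ sOp x = 0 := chain_hom_ext_cons fun a l => by
    rw [LinearMap.comp_apply, sOp_cons, map_smul, map_cyc]
    simp only [map_opR, oneChain, connes_one]
    simp [cyc, opR, der_zero, spl_zero]
  exact LinearMap.congr_fun this c

theorem sOp_connes (x : Cochain k A p) (c : Chain k A) : sOp x (connes c) = 0 := by
  have h1 : ∀ l, sOp x (chain k (1 :: l)) = 0 := fun l => by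
    rw [sOp_cons]
    refine smul_eq_zero_of_right _ (spl_eq_zero fun u v _ => smul_eq_zero_of_right _
      (smul_eq_zero_of_right _ (spl_eq_zero fun u' t _ => spl_eq_zero fun v' w _ => ?_)))
    rw [oneChain, chain_one k (by simp), smul_zero]
  have : sOp x ∘ₗ connes = 0 := chain_hom_ext_cons fun a l => by
    rw [LinearMap.comp_apply, connes_cons, map_cyc]
    simp only [oneChain, h1]
    simp [cyc, spl_zero]
  exact LinearMap.congr_fun this c

/-- The classical `N (1 - t) = 0`: consecutive rotations telescope, and the two end terms agree
because the circle closes up. -/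
theorem cyc_oneSubT (a : A) (l : List A) :
    cyc k (fun u a v => oneSubT k (u ++ a :: v)) a l = 0 := by
  have h := spl_telescope
    (fun l₁ l₂ : List A => sg k (l₂.length * (l₁.length + 1)) • chain k (l₂ ++ a :: l₁))
    (fun l₁ l₂ : List A => sg k (l₂.length * (l₁.length + 1)) •
      sg k ((l₂ ++ a :: l₁).length + 1) •
        chain k ((l₂ ++ a :: l₁).rotate ((l₂ ++ a :: l₁).length - 1))) l ?_
  · rw [← spl_sub] at h
    simp only [← smul_sub] at h
    refine h.trans ?_
    rw [rotate_concat, sg_smul_smul, sub_eq_zero, List.nil_append]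
    congr 1
    refine sg_congr ?_
    simp only [List.length_append, List.length_cons, List.length_nil, Nat.cast_add, Nat.cast_one,
      Nat.cast_zero, Int.even_add, Int.even_mul, Int.not_even_one, Even.zero]
    grind
  · intro w c t
    have e : t ++ a :: (w ++ [c]) = (t ++ a :: w) ++ [c] := by simp
    rw [e, rotate_concat, sg_smul_smul]
    congr 1
    refine sg_congr ?_
    simp only [List.length_append, List.length_cons, List.length_nil, Nat.cast_add, Nat.cast_one,
      Int.even_add, Int.even_mul, Int.not_even_one]
    grind

end CartanFormulas

/-! ### The Cartan homotopy formula -/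

section CartanHomotopy

variable {k : Type u} {A : Type v} [Field k] [Ring A] [Algebra k A]
variable {M : Type w} [AddCommGroup M] [Module k M]
variable {p q : ℤ}

/-- On chains that begin with `1`, `b` is `-D_m` plus `1 - t`. By `lam_cyc` the cyclic sum of the
first part is `-B b`, and that of the second is zero. -/
theorem b_connes (c : Chain k A) : b (connes c) = -connes (b c) := by
  have : b ∘ₗ connes = -(connes ∘ₗ b : Chain k A →ₗ[k] Chain k A) := chain_hom_ext_cons fun a l => by
    rw [LinearMap.neg_apply, LinearMap.comp_apply, LinearMap.comp_apply, connes_cons, b_cons,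
      map_cyc, map_lam]
    simp only [connes_cons]
    rw [lam_cyc isCo_mulList isML_oneChain]
    simp only [b_oneChain]
    rw [cyc_add, cyc_oneSubT, add_zero]
    have := cyc_smul (-1 : k) (opD k mulList 1 (oneChain k (A := A))) a l
    simpa only [neg_one_smul] using this
  exact LinearMap.congr_fun this c

theorem opR_mulList {y : List A → A} (t : List A) (a : A) (s : List A) :
    opR k y q (fun u a v => mulList (u ++ a :: v)) t a s
      = if t = [] then sg k q • (a * y s) else 0 := by
  rw [opR, der]
  split_ifs with ht
  · subst ht
    rw [spl_eq_left_nil, spl_eq_right_nil]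
    · simp [mulList]
    · intro u v hv
      have := List.length_pos_iff.2 hv
      rw [isCo_mulList.supp (k := k), smul_zero]
      simp; omega
    · intro u v hv
      have := List.length_pos_iff.2 hv
      refine spl_eq_zero fun u' v' _ => ?_
      rw [isCo_mulList.supp (k := k), smul_zero]
      simp; omega
  · have := List.length_pos_iff.2 ht
    refine smul_eq_zero_of_right _ (spl_eq_zero fun u v _ => spl_eq_zero fun u' v' _ => ?_)
    rw [isCo_mulList.supp (k := k), smul_zero]
    simp; omega

theorem tau_mulList (y : Cochain k A q) {G : A → List A → M}
    (hG : ∀ (c : k) a l, G (c • a) l = c • G a l) (a : A) (l : List A) :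
    tau k mulList y.1 q G a l
      = sg k q • G (a * y.1 (l.take (q + 1).toNat)) (l.drop (q + 1).toNat) := by
  have h0 : ∀ l, G 0 l = 0 := fun l => by simpa using hG 0 0 l
  have e : tau k mulList y.1 q G a l = spl (fun s r => G (sg k q • (a * y.1 s)) r) l := by
    rw [tau]
    refine spl_congr fun s r _ => ?_
    rw [spl_eq_right_nil]
    · simp [opR_mulList]
    · intro u v hv
      rw [opR_mulList, if_neg hv, h0, smul_zero]
  rw [e, spl_eq_single _ _ (q + 1).toNat, hG]
  intro u v hu
  rw [(isCo_coe y).eq_zero hu, mul_zero, smul_zero, h0]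

/-- `a₀ y(…)` is the product applied to `a₀` and a letter produced by `y`. Hence the contraction is
the instance of `tau` where `x` is the multiplication, and the rule `tau_cyc` covers it. -/
theorem tau_mulList_chain (y : Cochain k A q) (φ : Chain k A →ₗ[k] M) (a : A) (l : List A) :
    tau k mulList y.1 q (fun a l => φ (chain k (a :: l))) a l
      = sg k q • φ (contr y (chain k (a :: l))) := by
  rw [tau_mulList, contr_cons]
  intro c a l
  rw [← map_smul]
  congr 1
  exact (slotLinear_chain k).smul_mid [] l c a

/-- Rotations telescope only while the letter `x(v)` stays to the right of the mark, so both ends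
survive. At one end `a₀` is in front, which is the part of `L_x` where `x` avoids `a₀`. At the other
end `x(v)` is in front, which is the part of `i_x B` where `x` avoids `a₀`. The terms in which `x`
takes `a₀` occur equally in `L_x` and in `i_x B`. -/
theorem cyc_opR_oneSubT (x : Cochain k A p) (a : A) (l : List A) :
    cyc k (opR k x.1 p fun u a v => oneSubT k (u ++ a :: v)) a l
      = lam k x.1 p (fun a l => chain k (a :: l)) a l
        - cyc k (fun u a v => contr x (oneChain k u a v)) a l := by
  have hx := isCo_coe x
  have hc := slotLinear_chain k (A := A)
  have e1 : cyc k (opR k x.1 p fun u a v => oneSubT k (u ++ a :: v)) a l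
      = spl (fun u r => spl (fun v s => sg k (p * (u.length + 1)) • chain k (a :: (u ++ x.1 v :: s))
        - sg k ((v.length + s.length) * (u.length + 1)) •
            chain k (x.1 v :: (s ++ a :: u))) r) l := by
    simp only [cyc, opR, der, smul_spl, sg_smul_smul, spl_left]
    refine spl_congr fun u r _ => spl_congr fun v s _ => ?_
    by_cases hv : (v.length : ℤ) = p + 1
    · have h := spl_telescope
        (fun w t : List A => sg k (t.length * ((u ++ (v ++ w)).length + 1)
          + (p * (t.length + 1) + p * u.length)) • chain k (t ++ a :: (u ++ x.1 v :: w)))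
        (fun w t : List A => sg k (t.length * ((u ++ (v ++ w)).length + 1)
          + (p * (t.length + 1) + p * u.length)) • sg k ((t ++ a :: (u ++ x.1 v :: w)).length + 1) •
            chain k ((t ++ a :: (u ++ x.1 v :: w)).rotate
              ((t ++ a :: (u ++ x.1 v :: w)).length - 1))) s ?_
      · rw [← spl_sub] at h
        simp only [← smul_sub] at h
        refine h.trans ?_
        have e : s ++ a :: (u ++ x.1 v :: []) = (s ++ a :: u) ++ [x.1 v] := by simp
        rw [e, rotate_concat, sg_smul_smul, List.nil_append]
        congr 2
        · refine sg_congr ?_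
          simp only [List.length_append, List.length_nil, Nat.cast_add,
            Nat.cast_zero, Int.even_add, Int.even_mul, Int.not_even_one, Even.zero]
          grind
        · refine sg_congr ?_
          simp only [List.length_append, List.length_cons, List.length_nil, Nat.cast_add, hv,
            Nat.cast_one, Nat.cast_zero, Int.even_add, Int.even_mul, Int.not_even_one, Even.zero]
          grind
      · intro w c t
        have e : t ++ a :: (u ++ x.1 v :: (w ++ [c])) = (t ++ a :: (u ++ x.1 v :: w)) ++ [c] := by
          simp
        rw [e, rotate_concat, sg_smul_smul]
        congr 1
        refine sg_congr ?_
        simp only [List.length_append, List.length_cons, List.length_nil, Nat.cast_add, hv,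
          Nat.cast_one, Nat.cast_zero, Int.even_add, Int.even_mul, Int.not_even_one, Even.zero]
        grind
    · rw [hx.supp v hv, hc.eq_zero (l := a :: (u ++ 0 :: s)) (by simp),
        hc.eq_zero (l := 0 :: (s ++ a :: u)) (by simp), smul_zero, smul_zero, sub_zero]
      refine spl_eq_zero fun w t _ => ?_
      rw [oneSubT, hc.eq_zero (by simp), hc.eq_zero (by simp), smul_zero, sub_zero, smul_zero]
  have e2 : cyc k (fun u a v => contr x (oneChain k u a v)) a l
      = spl (fun u r => spl (fun v s => sg k ((v.length + s.length) * (u.length + 1)) •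
            chain k (x.1 v :: (s ++ a :: u))) r) l
        + spl (fun u t => spl (fun v w =>
            sg k (w.length * (1 + u.length + v.length)) • chain k (x.1 (w ++ a :: u) :: v)) t) l := by
    simp only [cyc, oneChain, contr_cons_spl, one_mul, spl_append, smul_add, spl_add, smul_spl]
    congr 1
    · refine spl_congr fun u r _ => spl_congr fun v s h => ?_
      rw [← h, List.length_append, Nat.cast_add]
    · rw [spl_left]
      refine spl_congr fun u r _ => spl_congr fun v s h => ?_
      congr 1
      refine sg_congr ?_
      simp only [List.length_append, Nat.cast_add, Int.even_add, Int.even_mul, Int.not_even_one]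
      grind
  rw [e1, e2, lam]
  simp only [spl_sub]
  abel

theorem opR_neg {F : List A → A → List A → M} (hF : IsML k F) (x : List A → A) (p : ℤ) :
    opR k (fun l => -x l) p F = fun u a v => (-1 : k) • opR k x p F u a v := by
  funext u a v
  have : ∀ s t b, F u a (s ++ (-b) :: t) = (-1 : k) • F u a (s ++ b :: t) := fun s t b => by
    rw [← (hF.right u a).smul_mid, neg_one_smul]
  simp only [opR, der, this, smul_spl, smul_comm (-1 : k)]

theorem cyc_sub (F F' : List A → A → List A → M) (a : A) (l : List A) :
    cyc k (fun u a v => F u a v - F' u a v) a l = cyc k F a l - cyc k F' a l := by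
  simp only [cyc, smul_sub, spl_sub]

/-- The Cartan homotopy formula. -/
theorem cartan {r : ℤ} (h : r = p + 1) (x : Cochain k A p) (c : Chain k A) :
    b (sOp x c) + sg k p • sOp x (b c) + connes (contr x c) + sg k p • contr x (connes c)
      = lieDer x c - sOp (cochainD h x) c := by
  have : b ∘ₗ sOp x + sg k p • sOp x ∘ₗ b + connes ∘ₗ contr x + sg k p • contr x ∘ₗ connes
      = lieDer x - sOp (cochainD h x) := chain_hom_ext_cons fun a l => by
    simp only [LinearMap.add_apply, LinearMap.comp_apply, LinearMap.smul_apply,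
      LinearMap.sub_apply]
    have hx := isCo_coe x
    have h1 : b (sOp x (chain k (a :: l)))
        = sg k p • (-cyc k (opR k x.1 p (opD k mulList 1 (oneChain k))) a l
          + cyc k (opR k x.1 p fun u a v => oneSubT k (u ++ a :: v)) a l) := by
      rw [sOp_cons, map_smul, map_cyc]
      simp only [map_opR, b_oneChain]
      have e : (fun (u : List A) a v => -opD k mulList 1 (oneChain k) u a v)
        = fun u a v => (-1 : k) • opD k mulList 1 (oneChain k) u a v := by simp
      rw [opR_add (fun u a v => -opD k mulList 1 (oneChain k) u a v), cyc_add, e]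
      congr 2
      have e' : opR k x.1 p (fun (u : List A) a v => (-1 : k) • opD k mulList 1 (oneChain k) u a v)
          = fun u a v => (-1 : k) • opR k x.1 p (opD k mulList 1 (oneChain k)) u a v := by
        funext u a v
        simp only [opR, der_smul, smul_comm (-1 : k)]
      rw [e', cyc_smul, neg_one_smul]
    have h2 : sOp x (b (chain k (a :: l)))
        = sg k p • cyc k (opD k mulList 1 (opR k x.1 p (oneChain k))) a l := by
      rw [b_cons, map_lam]
      simp only [sOp_cons]
      rw [lam_smul, lam_cyc isCo_mulList (isML_oneChain.opR hx.slot p)]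
    have h3 : contr x (connes (chain k (a :: l)))
        = cyc k (fun u a v => contr x (oneChain k u a v)) a l := by
      rw [connes_cons, map_cyc]
    have h4 : sg k p • connes (contr x (chain k (a :: l)))
        = cyc k (opG k (opR k x.1 p fun u a v => mulList (u ++ a :: v)) (1 + p) (oneChain k)) a l := by
      rw [← tau_cyc isCo_mulList hx isML_oneChain, ← tau_mulList_chain]
      simp only [connes_cons]
    have h5 : sOp (cochainD h x) (chain k (a :: l))
        = sg k p • cyc k (opR k (br k mulList 1 x.1 p) (1 + p) (oneChain k)) a l := by
      have e : (cochainD h x).1 = fun l => -br k mulList 1 x.1 p l := by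
        funext l; rw [br_mulList h x, neg_neg]
      rw [sOp_cons, e, opR_neg isML_oneChain, cyc_smul, smul_smul, h, sg_add, add_comm 1 p]
      simp
    have h6 := cyc_opR_oneSubT x a l
    -- The commutator of `D_m` with the insertion of `x` to the right of the mark, summed
    -- cyclically: the bracket accounts for `S_{dx}`, the terms swallowed by the product for `B
    -- i_x`.
    have h7 : cyc k (opR k x.1 p (opD k mulList 1 (oneChain k))) a l
        - sg k p • cyc k (opD k mulList 1 (opR k x.1 p (oneChain k))) a l
        = cyc k (opR k (br k mulList 1 x.1 p) (1 + p) (oneChain k)) a l +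
          cyc k (opG k (opR k x.1 p fun u a v => mulList (u ++ a :: v)) (1 + p) (oneChain k)) a l := by
      rw [← cyc_smul, ← cyc_sub, ← cyc_add]
      congr 1
      funext u a v
      have := opR_opD isCo_mulList hx (isML_oneChain (k := k)) u a v
      rw [← opR_br isML_oneChain, one_mul] at this
      exact this
    rw [h1, h2, h3, h5, h6, lieDer_cons]
    rw [← h4] at h7
    rw [sub_eq_iff_eq_add] at h7
    rcases sg_eq_or (k := k) p with hs | hs <;> rw [hs] at h7 ⊢ <;> rw [h7] <;> module
  exact LinearMap.congr_fun this c

end CartanHomotopy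

/-! ### The homotopy `T` and brackets of cochains -/

section HomotopyT

variable {k : Type u} {A : Type v} [Field k] [Ring A] [Algebra k A]
variable {M : Type w} [AddCommGroup M] [Module k M]
variable {p q : ℤ}

/-- The function `(u, a, v) ↦ a ⊗ v` if `u` is empty, and zero otherwise. -/
noncomputable def headChain (k : Type u) {A : Type v} [Field k] [Ring A] [Algebra k A]
    (u : List A) (a : A) (v : List A) : Chain k A := if u = [] then chain k (a :: v) else 0

theorem isML_headChain : IsML k (headChain k (A := A)) where
  left a v s t c y z := by simp [headChain]
  mid u v c a b := by
    unfold headChain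
    split_ifs
    · exact slotLinear_chain k [] v c a b
    · simp
  right u a := by
    unfold headChain
    split_ifs
    · exact (slotLinear_chain k).cons a
    · intro s t c y z; simp

/-- Only the trivial rotation has an empty word to the left of the mark. So the identity is a cyclic
sum as well, and `lam_cyc` and `tau_cyc` apply to operators on arbitrary chains. -/
theorem cyc_headChain (a : A) (l : List A) : cyc k (headChain k) a l = chain k (a :: l) := by
  rw [cyc, spl_eq_right_nil]
  · simp [headChain]
  · intro u v hv
    rw [headChain, if_neg hv, smul_zero]

theorem isChainFun_cyc {F : List A → A → List A → M} (hF : IsML k F)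
    (h1 : ∀ a l, (1 : A) ∈ l → cyc k F a l = 0) :
    IsChainFun (k := k) (fun l => match l with | [] => 0 | a :: l => cyc k F a l) where
  nil := rfl
  slot := by
    intro s t c y z
    cases s with
    | nil =>
      simp only [List.nil_append, cyc, smul_spl, ← spl_add]
      refine spl_congr fun u v _ => ?_
      rw [hF.mid, smul_add, smul_comm c]
    | cons a s =>
      have : SlotLinear k (cyc k F a) := SlotLinear.spl
        (fun u => (hF.left a u).smul_length fun n => sg k (n * (u.length + 1)))
        fun v => (hF.right v a).smul_length fun n => sg k (v.length * (n + 1))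
      exact this s t c y z
  one := h1

/-- Every letter, including `a₀`, ends up as an argument of `x` or of `y` or in the tail, and all
these places are normalized. -/
theorem tau_one (x : Cochain k A p) (y : Cochain k A q) (a : A) (l : List A)
    (h : a = 1 ∨ 1 ∈ l) : tau k x.1 y.1 q (fun a l => chain k (a :: l)) a l = 0 := by
  refine spl_eq_zero fun s r hsr => spl_eq_zero fun z t hzt => ?_
  beta_reduce
  have hc := slotLinear_chain k (A := A)
  by_cases hz : (1 : A) ∈ z
  · rw [chain_one k hz, smul_zero]
  · have : opR k y.1 q (fun u a v => x.1 (u ++ a :: v)) t a s = 0 := by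
      refine smul_eq_zero_of_right _ (spl_eq_zero fun u r' hs => spl_eq_zero fun v w hr => ?_)
      beta_reduce
      by_cases hv : (1 : A) ∈ v
      · rw [y.2.2.1 v hv, x.2.1.eq_zero (by simp), smul_zero]
      · rw [x.2.2.1, smul_zero]
        subst hr; subst hs; subst hzt; subst hsr
        simp only [List.mem_append, List.mem_cons] at h ⊢
        tauto
    rw [this, hc.eq_zero (by simp), smul_zero]

/-- The homotopy between `[L_x, i_y]` and `i_{[x, y]}`. -/
noncomputable def tOp (x : Cochain k A p) (y : Cochain k A q) : Chain k A →ₗ[k] Chain k A :=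
  chainLift _ (isChainFun_cyc
    (F := opG k (opR k y.1 q fun u a v => x.1 (u ++ a :: v)) (p + q) (headChain k))
    (isML_headChain.opG (x.2.1.isML.opR y.2.1 q) _) fun a l h => by
      rw [← tau_cyc (isCo_coe x) (isCo_coe y) isML_headChain]
      have := tau_one x y a l (Or.inr h)
      simpa only [← cyc_headChain] using this)

theorem tOp_cons (x : Cochain k A p) (y : Cochain k A q) (a : A) (l : List A) :
    tOp x y (chain k (a :: l))
      = cyc k (opG k (opR k y.1 q fun u a v => x.1 (u ++ a :: v)) (p + q) (headChain k)) a l := by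
  rw [tOp, chainLift_chain]

theorem tOp_cons_tau (x : Cochain k A p) (y : Cochain k A q) (a : A) (l : List A) :
    tOp x y (chain k (a :: l)) = tau k x.1 y.1 q (fun a l => chain k (a :: l)) a l := by
  rw [tOp_cons, ← tau_cyc (isCo_coe x) (isCo_coe y) isML_headChain]
  simp only [← cyc_headChain]

theorem map_tau {N : Type*} [AddCommGroup N] [Module k N] (φ : M →ₗ[k] N) (x y : List A → A)
    (q : ℤ) (G : A → List A → M) (a : A) (l : List A) :
    φ (tau k x y q G a l) = tau k x y q (fun a l => φ (G a l)) a l := by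
  simp only [tau, map_spl, map_smul]

theorem tOp_connes (x : Cochain k A p) (y : Cochain k A q) (c : Chain k A) :
    tOp x y (connes c) = 0 := by
  have : tOp x y ∘ₗ connes = 0 := chain_hom_ext_cons fun a l => by
    rw [LinearMap.comp_apply, connes_cons, map_cyc]
    refine spl_eq_zero fun u v _ => ?_
    beta_reduce
    rw [oneChain, tOp_cons_tau, tau_one x y _ _ (Or.inl rfl), smul_zero]
  exact LinearMap.congr_fun this c

/-- The commutator of `L_x` and `S_y`. -/
theorem lieDer_sOp {r : ℤ} (h : p + q = r) (x : Cochain k A p) (y : Cochain k A q)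
    (c : Chain k A) :
    lieDer x (sOp y c) = sg k (p * q + p) • sOp y (lieDer x c) + sg k p • sOp (gerst h x y) c
      + sg k q • connes (tOp x y c) := by
  have : lieDer x ∘ₗ sOp y = sg k (p * q + p) • sOp y ∘ₗ lieDer x + sg k p • sOp (gerst h x y)
      + sg k q • connes ∘ₗ tOp x y := chain_hom_ext_cons fun a l => by
    subst h
    simp only [LinearMap.add_apply, LinearMap.comp_apply, LinearMap.smul_apply]
    have hx := isCo_coe x
    have hy := isCo_coe y
    have hE := isML_oneChain (k := k) (A := A)
    have h1 : lieDer x (sOp y (chain k (a :: l)))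
        = sg k q • cyc k (opR k y.1 q (opD k x.1 p (oneChain k))) a l := by
      rw [sOp_cons, map_smul, map_cyc]
      simp only [map_opR, lieDer_oneChain]
    have h2 : sOp y (lieDer x (chain k (a :: l)))
        = sg k (p + q) • cyc k (opD k x.1 p (opR k y.1 q (oneChain k))) a l := by
      rw [lieDer_cons, map_smul, map_lam]
      simp only [sOp_cons]
      rw [lam_smul, lam_cyc hx (hE.opR hy.slot q), sg_smul_smul]
    have h3 : connes (tOp x y (chain k (a :: l)))
        = cyc k (opG k (opR k y.1 q fun u a v => x.1 (u ++ a :: v)) (p + q) (oneChain k)) a l := by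
      rw [← tau_cyc hx hy hE, tOp_cons_tau, map_tau]
      simp only [connes_cons]
    have h4 : sOp (gerst rfl x y) (chain k (a :: l))
        = sg k (p + q) • cyc k (opR k (br k x.1 p y.1 q) (p + q) (oneChain k)) a l := by
      rw [sOp_cons, gerst_eq_br]
    -- As for the Cartan formula, with `x` in place of the product; the swallowed terms are now `B
    -- T`.
    have h7 : cyc k (opR k y.1 q (opD k x.1 p (oneChain k))) a l
        - sg k (p * q) • cyc k (opD k x.1 p (opR k y.1 q (oneChain k))) a l
        = cyc k (opR k (br k x.1 p y.1 q) (p + q) (oneChain k)) a l +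
          cyc k (opG k (opR k y.1 q fun u a v => x.1 (u ++ a :: v)) (p + q) (oneChain k)) a l := by
      rw [← cyc_smul, ← cyc_sub, ← cyc_add]
      congr 1
      funext u a v
      have := opR_opD hx hy hE u a v
      rwa [← opR_br hE] at this
    rw [h1, h2, h3, h4]
    simp only [sg_add] at h7 ⊢
    rw [sub_eq_iff_eq_add] at h7
    rw [h7]
    rcases sg_eq_or (k := k) p with hp | hp <;> rcases sg_eq_or (k := k) q with hq | hq <;>
      rw [hp, hq] <;> module
  exact LinearMap.congr_fun this c

/-- The value on lists of length one, as a function on lists. -/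
def letter : List A → A
  | [a] => a
  | _ => 0

theorem slotLinear_letter : SlotLinear k (letter (A := A)) := by
  intro s t c y z
  rcases s with _ | ⟨a, s⟩ <;> rcases t with _ | ⟨b, t⟩ <;> simp [letter]

/-- A coderivation is determined by its corestriction. Evaluation on `letter` therefore turns
identities between the operators `derL` into identities between cochains. -/
theorem der_letter (x : List A → A) (p : ℤ) (l : List A) : der k x p letter l = x l := by
  rw [der, spl_eq_left_nil, spl_eq_right_nil]
  · simp [letter]
  · intro u v hv
    rcases v with _ | ⟨a, v⟩
    · exact absurd rfl hv
    · simp [letter]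
  · intro u v hu
    refine spl_eq_zero fun u' v' _ => ?_
    rcases u with _ | ⟨a, _ | ⟨b, u⟩⟩
    · exact absurd rfl hu
    · simp [letter]
    · simp [letter]

variable (k) in
/-- `der` as a linear map. -/
def derL (x : List A → A) (p : ℤ) : (List A → M) →ₗ[k] (List A → M) where
  toFun := der k x p
  map_add' G H := funext fun l => der_add x p G H l
  map_smul' c G := funext fun l => der_smul x p c G l

variable {x y : List A → A} {G : List A → M}

theorem derL_derL (hx : IsCo k x p) (hy : IsCo k y q) (hG : SlotLinear k G) :
    derL k y q (derL k x p G)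
      = sg k (p * q) • derL k x p (derL k y q G) + derL k (br k x p y q) (p + q) G := by
  funext l
  have := der_comm hx hy hG l
  rw [← der_fun_sub _ _ _ _ hG, sub_eq_iff_eq_add'] at this
  exact this

theorem derL_letter (x : List A → A) (p : ℤ) : derL k x p letter = x :=
  funext fun l => der_letter x p l

theorem derL_of_zero (h : ∀ l, x l = 0) (p : ℤ) (hG : SlotLinear k G) : derL k x p G = 0 := by
  funext l
  refine spl_eq_zero fun u t _ => spl_eq_zero fun v w _ => ?_
  rw [h, hG.zero_mid, smul_zero]

/-- The bracket of two cocycles is a cocycle. -/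
theorem br_mulList_br (hx : IsCo k x p) (hy : IsCo k y q)
    (hdx : ∀ l, br k mulList 1 x p l = 0) (hdy : ∀ l, br k mulList 1 y q l = 0) (l : List A) :
    br k mulList 1 (br k x p y q) (p + q) l = 0 := by
  have hz := isCo_br hx hy
  have hm := isCo_mulList (k := k) (A := A)
  have hG := slotLinear_letter (k := k) (A := A)
  have hGm := slotLinear_der hm.slot 1 hG
  have key : ∀ {G : List A → A}, SlotLinear k G → derL k (br k x p y q) (p + q) G
      = derL k y q (derL k x p G) - sg k (p * q) • derL k x p (derL k y q G) := fun hG => by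
    rw [derL_derL hx hy hG, add_sub_cancel_left]
  have cx : ∀ {G : List A → A}, SlotLinear k G →
      derL k x p (derL k mulList 1 G) = sg k p • derL k mulList 1 (derL k x p G) := fun hG => by
    rw [derL_derL hm hx hG, derL_of_zero hdx _ hG, one_mul, add_zero]
  have cy : ∀ {G : List A → A}, SlotLinear k G →
      derL k y q (derL k mulList 1 G) = sg k q • derL k mulList 1 (derL k y q G) := fun hG => by
    rw [derL_derL hm hy hG, derL_of_zero hdy _ hG, one_mul, add_zero]
  -- The Jacobi identity, through coderivations: `D_{[x, y]}` is a commutator of `D_x` and `D_y`,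
  -- each of which commutes with `D_m` up to sign.
  have h1 := derL_derL hm hz hG
  rw [key (G := derL k mulList 1 letter) hGm, key hG, cx hG, cy hG, map_smul, map_smul] at h1
  simp only [derL_letter] at h1
  rw [cx hy.slot, cy hx.slot, map_sub, map_smul, one_mul, ← sub_eq_iff_eq_add'] at h1
  rw [← h1]
  simp only [sg_add]
  suffices h : ∀ P Q : List A → A, (sg k p • sg k q • P - sg k (p * q) • sg k q • sg k p • Q
      - (sg k p * sg k q) • (P - sg k (p * q) • Q)) = 0 from congrFun (h _ _) l
  intro P Q
  module

/-- Associativity: the value on three letters is `(a b) c - a (b c)`. -/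
theorem der_mulList_mulList (l : List A) : der k mulList 1 mulList l = (0 : A) := by
  rcases l with _ | ⟨a, l⟩
  · simp [der, mulList]
  · rcases List.eq_nil_or_concat l with rfl | ⟨l, c, rfl⟩
    · simp [der, spl, mulList]
    · rw [List.concat_eq_append, ← List.cons_append, der_mulList isCo_mulList]
      rcases l with _ | ⟨b, _ | ⟨b', l⟩⟩ <;> simp [mulList, mul_assoc]

/-- As the multiplication has odd degree, `2 D_m² = [D_m, D_m] = D_{[m, m]} = 0`. Characteristic
zero serves to divide by two. -/
theorem derL_mulList_mulList [CharZero k] (hG : SlotLinear k G) :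
    derL k mulList 1 (derL k mulList 1 G) = 0 := by
  have hm := isCo_mulList (k := k) (A := A)
  have h := derL_derL hm hm hG
  rw [derL_of_zero (x := br k mulList 1 mulList 1) _ _ hG, mul_one, sg_one, neg_one_smul, add_zero,
    eq_neg_iff_add_eq_zero, ← two_smul k] at h
  · exact (smul_eq_zero_iff_right two_ne_zero).1 h
  · intro l
    rw [br, der_mulList_mulList, smul_zero, sub_zero]

theorem br_mulList_br_mulList [CharZero k] (hx : IsCo k x p) (l : List A) :
    br k mulList 1 (br k mulList 1 x p) (1 + p) l = 0 := by
  have hm := isCo_mulList (k := k) (A := A)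
  have hz := isCo_br hm hx
  have hG := slotLinear_letter (k := k) (A := A)
  have hGm := slotLinear_der hm.slot 1 hG
  have key : ∀ {G : List A → A}, SlotLinear k G → derL k (br k mulList 1 x p) (1 + p) G
      = derL k x p (derL k mulList 1 G) - sg k p • derL k mulList 1 (derL k x p G) := fun hG => by
    rw [derL_derL hm hx hG, one_mul, add_sub_cancel_left]
  have h1 := derL_derL hm hz hG
  rw [key (G := derL k mulList 1 letter) hGm, key hG, derL_mulList_mulList hG, map_zero, map_sub,
    map_smul, derL_mulList_mulList (G := derL k x p letter) (slotLinear_der hx.slot p hG)] at h1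
  rw [derL_letter (br k mulList 1 _ _), ← sub_eq_iff_eq_add'] at h1
  rw [← h1]
  simp only [one_mul, sg_add, sg_one]
  suffices h : ∀ P : List A → A, (0 - sg k p • P - (-1 * sg k p) • (P - sg k p • 0)) = 0 from
    congrFun (h _) l
  intro P
  module

end HomotopyT

/-! ### The algebra of operators on functions of marked words -/

section MarkedOperators

variable {k : Type u} {A : Type v} [Field k] [Ring A] [Algebra k A]
variable {M : Type w} [AddCommGroup M] [Module k M]
variable {p q : ℤ} {x y : List A → A} {F : List A → A → List A → M}

theorem der_smul_fun (x : List A → A) (p : ℤ) (c : k) (G : List A → M) :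
    der k x p (c • G) = c • der k x p G := funext fun l => der_smul x p c G l

variable (k) in
/-- `opR` as a linear map. -/
def opRL (x : List A → A) (p : ℤ) :
    (List A → A → List A → M) →ₗ[k] (List A → A → List A → M) where
  toFun := opR k x p
  map_add' F F' := opR_add F F'
  map_smul' c F := by
    funext u a v
    simp only [opR, Pi.smul_apply, RingHom.id_apply, der_smul_fun, smul_comm c]

variable (k) in
/-- `opD` as a linear map. -/
def opDL (x : List A → A) (p : ℤ) :
    (List A → A → List A → M) →ₗ[k] (List A → A → List A → M) where
  toFun := opD k x p
  map_add' F F' := by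
    have h1 := opL_add (k := k) (x := x) (p := p) F F'
    have h2 := opM_add (k := k) (x := x) (p := p) F F'
    have h3 := opR_add (k := k) (x := x) (p := p) F F'
    funext u a v
    have h1 := congrFun (congrFun (congrFun h1 u) a) v
    have h2 := congrFun (congrFun (congrFun h2 u) a) v
    have h3 := congrFun (congrFun (congrFun h3 u) a) v
    change opL k x p (fun u a v => F u a v + F' u a v) u a v
      + opM k x p (fun u a v => F u a v + F' u a v) u a v
      + opR k x p (fun u a v => F u a v + F' u a v) u a v = _ + _ + _ + (_ + _ + _)
    rw [h1, h2, h3]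
    abel
  map_smul' c F := by
    funext u a v
    change opL k x p (fun u a v => c • F u a v) u a v
      + opM k x p (fun u a v => c • F u a v) u a v
      + opR k x p (fun u a v => c • F u a v) u a v = c • (_ + _ + _)
    have e : (fun v => c • F u a v) = c • F u a := rfl
    rw [opL, opM, opR, e, der_smul, der_smul_fun, opL, opM, opR, smul_add, smul_add, smul_spl]
    simp only [smul_spl, Pi.smul_apply, smul_comm c]

variable (k) in
/-- The marked letter is replaced by `x` applied to a word in which `y` is applied to the right
of the mark. -/
def opX (x y : List A → A) (p q : ℤ) :
    (List A → A → List A → M) →ₗ[k] (List A → A → List A → M) where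
  toFun := opG k (opR k y q fun u a v => x (u ++ a :: v)) (p + q)
  map_add' F F' := by
    funext u a v
    simp only [opG, Pi.add_apply, smul_add, spl_add]
  map_smul' c F := by
    funext u a v
    simp only [opG, Pi.smul_apply, smul_spl, smul_comm c, RingHom.id_apply]

variable (k) in
/-- `cyc` as a linear map. -/
def cycL (a : A) (l : List A) : (List A → A → List A → M) →ₗ[k] M where
  toFun F := cyc k F a l
  map_add' F F' := cyc_add F F' a l
  map_smul' c F := cyc_smul c F a l

theorem opDL_opDL (hx : IsCo k x p) (hy : IsCo k y q) (hF : IsML k F) :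
    opDL k y q (opDL k x p F)
      = sg k (p * q) • opDL k x p (opDL k y q F) + opDL k (br k x p y q) (p + q) F := by
  funext u a v
  have := opD_comm hx hy hF u a v
  rw [← opD_br hF, sub_eq_iff_eq_add'] at this
  exact this

theorem opRL_opDL (hx : IsCo k x p) (hy : IsCo k y q) (hF : IsML k F) :
    opRL k y q (opDL k x p F)
      = sg k (p * q) • opDL k x p (opRL k y q F) + opRL k (br k x p y q) (p + q) F
        + opX k x y p q F := by
  funext u a v
  have := opR_opD hx hy hF u a v
  rw [← opR_br hF, sub_eq_iff_eq_add', ← add_assoc] at this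
  exact this

theorem opDL_of_zero (h : ∀ l, x l = 0) (p : ℤ) (hF : IsML k F) : opDL k x p F = 0 := by
  funext u a v
  change opL k x p F u a v + opM k x p F u a v + opR k x p F u a v = 0
  have h1 : opL k x p F u a v = 0 :=
    congrFun (derL_of_zero (G := fun u => F u a v) h p (hF.left a v)) u
  have h2 : der k x p (F u a) v = 0 := congrFun (derL_of_zero h p (hF.right u a)) v
  rw [h1, opR, h2, smul_zero, zero_add, add_zero]
  refine spl_eq_zero fun _ _ _ => spl_eq_zero fun _ _ _ => ?_
  rw [h, hF.mid_zero, smul_zero]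

theorem opRL_of_zero (h : ∀ l, x l = 0) (p : ℤ) (hF : IsML k F) : opRL k x p F = 0 := by
  funext u a v
  have h2 : der k x p (F u a) v = 0 := congrFun (derL_of_zero h p (hF.right u a)) v
  exact (congrArg _ h2).trans (smul_zero _)

theorem opDL_mulList_mulList [CharZero k] (hF : IsML k F) :
    opDL k mulList 1 (opDL k mulList 1 F) = 0 := by
  have hm := isCo_mulList (k := k) (A := A)
  have h := opDL_opDL hm hm hF
  rw [opDL_of_zero (x := br k mulList 1 mulList 1) _ _ hF, mul_one, sg_one, neg_one_smul, add_zero,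
    eq_neg_iff_add_eq_zero, ← two_smul k] at h
  · exact (smul_eq_zero_iff_right two_ne_zero).1 h
  · intro l
    rw [br, der_mulList_mulList, smul_zero, sub_zero]

/-- The commutator of `opX mulList y` with the multiplication. -/
theorem opX_mulList_comm [CharZero k] (hy : IsCo k y q) (hF : IsML k F) :
    opX k mulList y 1 q (opDL k mulList 1 F) + sg k q • opDL k mulList 1 (opX k mulList y 1 q F)
      = -opX k mulList (br k mulList 1 y q) 1 (1 + q) F := by
  have hm := isCo_mulList (k := k) (A := A)
  have hF' : IsML k (opDL k mulList 1 F) := hF.opD hm.slot 1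
  -- The commutation rule for `F`, for `D_m F`, and with `[m, y]` in place of `y`. Since `D_m² = 0`
  -- and `[m, [m, y]] = 0`, eliminating all insertions to the right of the mark leaves a relation
  -- between the operators `opX`.
  have h1 := opRL_opDL hm hy hF
  have h2 := opRL_opDL hm hy hF'
  have h3 := opRL_opDL hm (isCo_br hm hy) hF
  have hR : IsML k (opRL k y q F) := hF.opR hy.slot q
  rw [opRL_of_zero (br_mulList_br_mulList hy) _ hF] at h3
  rw [opDL_mulList_mulList hF, map_zero] at h2
  have h4 := congrArg (opDL k mulList 1) h1
  simp only [map_add, map_smul, opDL_mulList_mulList hR] at h4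
  simp only [one_mul, sg_add, sg_one] at h1 h2 h3 h4
  rw [← sub_eq_iff_eq_add'] at h3
  rw [← h3]
  have h5 := h2.symm
  rw [h4] at h5
  rw [← sub_eq_zero]
  refine Eq.trans ?_ h5
  rcases sg_eq_or (k := k) q with hq | hq <;> rw [hq] <;> module

/-- `opX x y` is the commutator `[R_y, D_x]` minus `R_{[x, y]}`, where `R` denotes insertion to the
right of the mark. Move `D_m` through each factor: it commutes with `D_x`, and with `R_y` and
`R_{[x, y]}` up to the operators `opX` of the product, because `x`, `y` and `[x, y]` are cocycles.
-/
theorem opX_comm (hx : IsCo k x p) (hy : IsCo k y q) (hdx : ∀ l, br k mulList 1 x p l = 0)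
    (hdy : ∀ l, br k mulList 1 y q l = 0) (hF : IsML k F) :
    opX k x y p q (opDL k mulList 1 F) - sg k (p + q) • opDL k mulList 1 (opX k x y p q F)
      = sg k p • opX k mulList y 1 q (opDL k x p F)
        - sg k (p * q) • opDL k x p (opX k mulList y 1 q F)
        - opX k mulList (br k x p y q) 1 (p + q) F := by
  have hm := isCo_mulList (k := k) (A := A)
  have hz := isCo_br hx hy
  have cD : ∀ {F : List A → A → List A → M}, IsML k F →
      opDL k x p (opDL k mulList 1 F) = sg k p • opDL k mulList 1 (opDL k x p F) := fun hF => by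
    rw [opDL_opDL hm hx hF, opDL_of_zero hdx _ hF, one_mul, add_zero]
  have cR : ∀ {F : List A → A → List A → M}, IsML k F →
      opRL k y q (opDL k mulList 1 F)
        = sg k q • opDL k mulList 1 (opRL k y q F) + opX k mulList y 1 q F := fun hF => by
    rw [opRL_opDL hm hy hF, opRL_of_zero hdy _ hF, one_mul, add_zero]
  have cZ := opRL_opDL hm hz hF
  rw [opRL_of_zero (br_mulList_br hx hy hdx hdy) _ hF, one_mul, add_zero] at cZ
  have e : ∀ {F : List A → A → List A → M}, IsML k F → opX k x y p q F
      = opRL k y q (opDL k x p F) - sg k (p * q) • opDL k x p (opRL k y q F)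
        - opRL k (br k x p y q) (p + q) F := fun hF => by
    rw [opRL_opDL hx hy hF]; module
  have hR : IsML k (opRL k y q F) := hF.opR hy.slot q
  rw [e (F := opDL k mulList 1 F) (hF.opD hm.slot 1), e hF, cD hF, map_smul,
    cR (F := opDL k x p F) (hF.opD hx.slot p), cR hF, cZ, map_add, map_smul, cD hR]
  simp only [map_sub, map_smul, sg_add]
  module

end MarkedOperators

/-! ### Identities between `b`, `B`, `L`, `i` and `T` on chains -/

section ChainIdentities

variable {k : Type u} {A : Type v} [Field k] [Ring A] [Algebra k A]
variable {p q : ℤ}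

theorem chain_cons_eq (a : A) (l : List A) : chain k (a :: l) = cycL k a l (headChain k) :=
  (cyc_headChain a l).symm

variable {M : Type w} [AddCommGroup M] [Module k M]

/-- Composition of operators on chains is translated, in the opposite order, to composition of
operators on functions of marked words. -/
theorem map_lam_chain {F : List A → A → List A → M} (hF : IsML k F) (φ : Chain k A →ₗ[k] M)
    (h : ∀ a l, φ (chain k (a :: l)) = cycL k a l F) {x : List A → A} (hx : IsCo k x p) (a : A)
    (l : List A) :
    φ (lam k x p (fun a l => chain k (a :: l)) a l) = cycL k a l (opDL k x p F) := by
  rw [map_lam]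
  simp only [h]
  exact lam_cyc hx hF a l

theorem map_b {F : List A → A → List A → M} (hF : IsML k F) (φ : Chain k A →ₗ[k] M)
    (h : ∀ a l, φ (chain k (a :: l)) = cycL k a l F) (a : A) (l : List A) :
    φ (b (chain k (a :: l))) = cycL k a l (opDL k mulList 1 F) := by
  rw [b_cons, map_lam_chain hF φ h isCo_mulList]

theorem map_lieDer {F : List A → A → List A → M} (hF : IsML k F) (φ : Chain k A →ₗ[k] M)
    (h : ∀ a l, φ (chain k (a :: l)) = cycL k a l F) (x : Cochain k A p) (a : A) (l : List A) :
    φ (lieDer x (chain k (a :: l))) = sg k p • cycL k a l (opDL k x.1 p F) := by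
  rw [lieDer_cons, map_smul, map_lam_chain hF φ h (isCo_coe x)]

theorem map_tOp {F : List A → A → List A → M} (hF : IsML k F) (φ : Chain k A →ₗ[k] M)
    (h : ∀ a l, φ (chain k (a :: l)) = cycL k a l F) (x : Cochain k A p) (y : Cochain k A q)
    (a : A) (l : List A) :
    φ (tOp x y (chain k (a :: l))) = cycL k a l (opX k x.1 y.1 p q F) := by
  rw [tOp_cons_tau, map_tau]
  simp only [h]
  exact tau_cyc (isCo_coe x) (isCo_coe y) hF a l

theorem map_contr {F : List A → A → List A → M} (hF : IsML k F) (φ : Chain k A →ₗ[k] M)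
    (h : ∀ a l, φ (chain k (a :: l)) = cycL k a l F) (y : Cochain k A q) (a : A) (l : List A) :
    φ (contr y (chain k (a :: l))) = sg k q • cycL k a l (opX k mulList y.1 1 q F) := by
  have h1 := tau_mulList_chain y φ a l
  simp only [h] at h1
  have h2 : tau k mulList y.1 q (cyc k F) a l = cycL k a l (opX k mulList y.1 1 q F) :=
    tau_cyc isCo_mulList (isCo_coe y) hF a l
  rw [← h2]
  change _ = sg k q • tau k mulList y.1 q (fun a l => cycL k a l F) a l
  rw [h1, smul_smul, sg_mul_self, one_smul]

theorem id_chain (a : A) (l : List A) :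
    (LinearMap.id : Chain k A →ₗ[k] Chain k A) (chain k (a :: l)) = cycL k a l (headChain k) :=
  chain_cons_eq a l

theorem b_eq_cyc (a : A) (l : List A) :
    b (chain k (a :: l)) = cycL k a l (opDL k mulList 1 (headChain k)) :=
  map_b isML_headChain LinearMap.id id_chain a l

theorem lieDer_eq_cyc (x : Cochain k A p) (a : A) (l : List A) :
    lieDer x (chain k (a :: l)) = cycL k a l (sg k p • opDL k x.1 p (headChain k)) := by
  rw [map_smul]
  exact map_lieDer isML_headChain LinearMap.id id_chain x a l

theorem contr_eq_cyc (x : Cochain k A p) (a : A) (l : List A) :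
    contr x (chain k (a :: l)) = cycL k a l (sg k p • opX k mulList x.1 1 p (headChain k)) := by
  rw [map_smul]
  exact map_contr isML_headChain LinearMap.id id_chain x a l

theorem tOp_eq_cyc (x : Cochain k A p) (y : Cochain k A q) (a : A) (l : List A) :
    tOp x y (chain k (a :: l)) = cycL k a l (opX k x.1 y.1 p q (headChain k)) :=
  map_tOp isML_headChain LinearMap.id id_chain x y a l

theorem IsML.smul {F : List A → A → List A → M} (hF : IsML k F) (c : k) : IsML k (c • F) where
  left a v := (hF.left a v).smul c
  mid u v r a b := by
    simp only [Pi.smul_apply, hF.mid, smul_add, smul_comm c]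
  right u a := (hF.right u a).smul c

theorem isML_opX {F : List A → A → List A → M} (hF : IsML k F) {x y : List A → A}
    (hx : SlotLinear k x) (hy : SlotLinear k y) (p q : ℤ) : IsML k (opX k x y p q F) :=
  hF.opG (hx.isML.opR hy q) _

theorem isML_opDL {F : List A → A → List A → M} (hF : IsML k F) {x : List A → A}
    (hx : SlotLinear k x) (p : ℤ) : IsML k (opDL k x p F) := hF.opD hx p

theorem b_b [CharZero k] (c : Chain k A) : b (b c) = 0 := by
  have : b ∘ₗ b = (0 : Chain k A →ₗ[k] Chain k A) := chain_hom_ext_cons fun a l => by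
    rw [LinearMap.comp_apply, map_b (isML_opDL isML_headChain slotLinear_mulList 1) b b_eq_cyc,
      opDL_mulList_mulList isML_headChain, map_zero, LinearMap.zero_apply]
  exact LinearMap.congr_fun this c

theorem br_mulList_fun {r : ℤ} (h : r = p + 1) (x : Cochain k A p) :
    br k mulList 1 x.1 p = (-cochainD h x).1 := funext fun l => br_mulList h x l

theorem br_mulList_eq_zero {r : ℤ} {h : r = p + 1} {x : Cochain k A p} (hx : cochainD h x = 0)
    (l : List A) : br k mulList 1 x.1 p l = 0 := by
  rw [br_mulList h, hx]; simp

theorem contr_neg (x : Cochain k A p) (c : Chain k A) : contr (-x) c = -contr x c := by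
  have : contr (-x) = -contr x := chain_hom_ext_cons fun a l => by
    rw [LinearMap.neg_apply, contr_cons, contr_cons]
    have := (slotLinear_chain k).smul_mid [] (l.drop (p + 1).toNat) (-1)
      (a * x.1 (l.take (p + 1).toNat))
    simpa using this
  exact LinearMap.congr_fun this c

/-- The contraction is compatible with the differentials. -/
theorem b_contr [CharZero k] {r : ℤ} (h : r = p + 1) (x : Cochain k A p) (c : Chain k A) :
    b (contr x c) + sg k p • contr x (b c) = -contr (cochainD h x) c := by
  have : b ∘ₗ contr x + sg k p • contr x ∘ₗ b = -contr (cochainD h x) :=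
    chain_hom_ext_cons fun a l => by
      have hm := slotLinear_mulList (k := k) (A := A)
      have hF := isML_headChain (k := k) (A := A)
      simp only [LinearMap.add_apply, LinearMap.smul_apply, LinearMap.comp_apply,
        LinearMap.neg_apply]
      rw [← contr_neg, map_contr (isML_opDL hF hm 1) b b_eq_cyc,
        map_b ((isML_opX hF hm x.2.1 1 p).smul (sg k p)) (contr x) (contr_eq_cyc x), contr_eq_cyc,
        ← br_mulList_fun]
      simp only [← map_smul, ← map_add]
      congr 1
      simp only [map_smul]
      have := opX_mulList_comm (isCo_coe x) hF
      rw [← smul_add, this, smul_neg, h, add_comm 1 p, sg_add, sg_one, mul_neg_one, neg_smul]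
  exact LinearMap.congr_fun this c

/-- The commutator of `L_x` and `i_y` for cocycles. -/
theorem lieDer_contr {r p' q' : ℤ} (h : p + q = r) {hp : p' = p + 1} {hq : q' = q + 1}
    {x : Cochain k A p} {y : Cochain k A q} (hx : cochainD hp x = 0) (hy : cochainD hq y = 0)
    (c : Chain k A) :
    lieDer x (contr y c) = sg k (p * q + p) • contr y (lieDer x c) + sg k p • contr (gerst h x y) c
      + sg k q • b (tOp x y c) - sg k p • tOp x y (b c) := by
  have : lieDer x ∘ₗ contr y = sg k (p * q + p) • contr y ∘ₗ lieDer x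
      + sg k p • contr (gerst h x y) + sg k q • b ∘ₗ tOp x y - sg k p • tOp x y ∘ₗ b :=
    chain_hom_ext_cons fun a l => by
      subst h
      have hm := slotLinear_mulList (k := k) (A := A)
      have hF := isML_headChain (k := k) (A := A)
      simp only [LinearMap.add_apply, LinearMap.smul_apply, LinearMap.comp_apply,
        LinearMap.sub_apply]
      have e := opX_comm (isCo_coe x) (isCo_coe y) (br_mulList_eq_zero hx) (br_mulList_eq_zero hy)
        hF
      rw [map_contr ((isML_opDL hF x.2.1 p).smul (sg k p)) (lieDer x) (lieDer_eq_cyc x),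
        map_lieDer ((isML_opX hF hm y.2.1 1 q).smul (sg k q)) (contr y) (contr_eq_cyc y),
        contr_eq_cyc, map_tOp (isML_opDL hF hm 1) b b_eq_cyc,
        map_b (isML_opX hF x.2.1 y.2.1 p q) (tOp x y) (tOp_eq_cyc x y), gerst_eq_br]
      simp only [← map_smul, ← map_add, ← map_sub]
      congr 1
      rw [sub_eq_iff_eq_add] at e
      simp only [sg_add, map_smul] at e ⊢
      rw [e]
      rcases sg_eq_or (k := k) p with hp | hp <;> rcases sg_eq_or (k := k) q with hq | hq <;>
        rw [hp, hq] <;> module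
  exact LinearMap.congr_fun this c

theorem lieDer_connes (x : Cochain k A p) (c : Chain k A) :
    lieDer x (connes c) = sg k p • connes (lieDer x c) := by
  have : lieDer x ∘ₗ connes = sg k p • connes ∘ₗ lieDer x := chain_hom_ext_cons fun a l => by
    simp only [LinearMap.smul_apply, LinearMap.comp_apply]
    rw [map_lieDer isML_oneChain connes connes_cons, connes_cons, map_cyc, smul_smul, sg_mul_self,
      one_smul]
    simp only [lieDer_oneChain]
    rfl
  exact LinearMap.congr_fun this c

theorem lieDer_b {r : ℤ} {h : r = p + 1} {x : Cochain k A p} (hx : cochainD h x = 0)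
    (c : Chain k A) : lieDer x (b c) = sg k p • b (lieDer x c) := by
  have : lieDer x ∘ₗ b = sg k p • b ∘ₗ lieDer x := chain_hom_ext_cons fun a l => by
    have hm := slotLinear_mulList (k := k) (A := A)
    have hF := isML_headChain (k := k) (A := A)
    simp only [LinearMap.smul_apply, LinearMap.comp_apply]
    rw [map_lieDer (isML_opDL hF hm 1) b b_eq_cyc,
      map_b ((isML_opDL hF x.2.1 p).smul _) (lieDer x) (lieDer_eq_cyc x),
      opDL_opDL isCo_mulList (isCo_coe x) hF, opDL_of_zero (br_mulList_eq_zero hx) _ hF,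
      add_zero, one_mul]
    simp only [← map_smul, smul_smul, sg_mul_self, one_smul]
  exact LinearMap.congr_fun this c

theorem lieDer_lieDer {r : ℤ} (h : p + q = r) (x : Cochain k A p) (y : Cochain k A q)
    (c : Chain k A) :
    lieDer x (lieDer y c) = sg k (p * q) • lieDer y (lieDer x c) + lieDer (gerst h x y) c := by
  have : lieDer x ∘ₗ lieDer y = sg k (p * q) • lieDer y ∘ₗ lieDer x + lieDer (gerst h x y) :=
    chain_hom_ext_cons fun a l => by
      subst h
      have hF := isML_headChain (k := k) (A := A)
      simp only [LinearMap.smul_apply, LinearMap.comp_apply, LinearMap.add_apply]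
      rw [map_lieDer ((isML_opDL hF x.2.1 p).smul _) (lieDer x) (lieDer_eq_cyc x),
        map_lieDer ((isML_opDL hF y.2.1 q).smul _) (lieDer y) (lieDer_eq_cyc y), lieDer_eq_cyc,
        gerst_eq_br, map_smul (opDL k y.1 q), opDL_opDL (isCo_coe x) (isCo_coe y) hF]
      simp only [← map_smul, ← map_add]
      congr 1
      simp only [sg_add, map_smul]
      module
  exact LinearMap.congr_fun this c

theorem contr_contr {r : ℤ} (h : p + q + 1 = r) (x : Cochain k A p) (y : Cochain k A q)
    (c : Chain k A) :
    contr y (contr x c) = sg k ((p + 1) * (q + 1)) • contr (cup h x y) c := by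
  have : contr y ∘ₗ contr x = sg k ((p + 1) * (q + 1)) • contr (cup h x y) :=
    chain_hom_ext_cons fun a l => by
      simp only [LinearMap.smul_apply, LinearMap.comp_apply]
      rw [contr_cons, contr_cons, contr_cons]
      have hc := slotLinear_chain k (A := A)
      have e1 : (cup h x y).1 = fun l => sg k ((p + 1) * (q + 1)) •
        (x.1 (l.take (p + 1).toNat) * y.1 (l.drop (p + 1).toNat)) := rfl
      have e2 := fun (t : List A) (c : k) (a : A) => hc.smul_mid [] t c a
      simp only [List.nil_append] at e2
      rw [e1, mul_smul_comm, e2, smul_smul, sg_mul_self, one_smul, List.drop_drop, List.take_take,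
        List.drop_take]
      -- In degrees below `-1` there are no nonzero cochains. They are treated apart because `toNat`
      -- truncates, so that the numbers of arguments would not add up.
      rcases lt_or_ge p (-1) with hp | hp
      · have h0 : ∀ l, x.1 l = 0 := fun l => x.2.2.2 l (by omega)
        rw [h0, h0]
        simp only [mul_zero, zero_mul, hc.eq_zero List.mem_cons_self]
      rcases lt_or_ge q (-1) with hq | hq
      · have h0 : ∀ l, y.1 l = 0 := fun l => y.2.2.2 l (by omega)
        rw [h0, h0]
        simp only [mul_zero, hc.eq_zero List.mem_cons_self]
      have e3 : (r + 1).toNat = (p + 1).toNat + (q + 1).toNat := by omega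
      rw [e3, min_eq_left (by omega), Nat.add_sub_cancel_left, mul_assoc]
  exact LinearMap.congr_fun this c

end ChainIdentities

/-! ### The Hochschild coboundary with coefficients in a bimodule -/

section Bimodules

variable {k : Type u} {A : Type v} [Field k] [Ring A] [Algebra k A]
variable {M : Type w} [AddCommGroup M] [Module k M] {G : List A → M}

theorem der_mulList_singleton (hG : SlotLinear k G) (a : A) : der k mulList 1 G [a] = 0 := by
  simp [der, spl, mulList, hG.eq_zero]

theorem der_mulList_cons_cons (hG : SlotLinear k G) (a b : A) (l : List A) :
    der k mulList 1 G (a :: b :: l)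
      = G ((a * b) :: l) - der k mulList 1 (fun l => G (a :: l)) (b :: l) := by
  have h2 : ((1 : ℤ) + 1).toNat = 2 := rfl
  rw [der_eq_sum isCo_mulList hG, der_eq_sum isCo_mulList (hG.cons a), List.length_cons,
    Finset.sum_range_succ', add_comm, sub_eq_add_neg, ← Finset.sum_neg_distrib, h2]
  refine congrArg₂ (· + ·) (by simp [ins, mulList]) (Finset.sum_congr rfl fun i _ => ?_)
  have e : ins mulList 2 (i + 1) (a :: b :: l) = a :: ins mulList 2 i (b :: l) := by
    simp [ins, Nat.add_right_comm i 1 2]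
  rw [e, Nat.cast_add, Nat.cast_one, mul_add, sg_add, one_mul, one_mul, sg_one, mul_neg_one,
    neg_smul]

theorem der_mulList_concat (hG : SlotLinear k G) (l : List A) (b c : A) :
    der k mulList 1 G (l ++ [b, c])
      = der k mulList 1 (fun l => G (l ++ [c])) (l ++ [b])
        + sg k l.length • G (l ++ [b * c]) := by
  induction l generalizing G with
  | nil =>
    rw [List.nil_append, der_mulList_cons_cons hG, der_mulList_singleton (hG.cons b),
      List.nil_append, der_mulList_singleton (hG.append_right [c])]
    simp
  | cons a l ih =>
    have e : ∃ x l', l ++ [b, c] = x :: (l' ++ [c]) ∧ l ++ [b] = x :: l' := by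
      cases l with
      | nil => exact ⟨b, [], rfl, rfl⟩
      | cons x l => exact ⟨x, l ++ [b], by simp, rfl⟩
    obtain ⟨x, l', e1, e2⟩ := e
    have h1 := ih (hG.cons a)
    rw [List.cons_append, e1, der_mulList_cons_cons hG, ← e1, h1, List.cons_append, e2,
      der_mulList_cons_cons (hG.append_right [c])]
    simp only [List.length_cons, Nat.cast_add, Nat.cast_one, sg_add, sg_one, List.cons_append]
    module

/-- The first term of the Hochschild coboundary. -/
def hochL (lft : A →ₗ[k] M →ₗ[k] M) (f : List A → M) : List A → M
  | [] => 0
  | a :: l => lft a (f l)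

variable (k) in
/-- The last term of the Hochschild coboundary. -/
def hochR (rgt : A →ₗ[k] M →ₗ[k] M) (f : List A → M) (l : List A) : M :=
  sg k l.length • rgt (l.getLastD 0) (f l.dropLast)

variable {lft rgt : A →ₗ[k] M →ₗ[k] M} {f : List A → M}

theorem hochR_nil : hochR k rgt f [] = 0 := by simp [hochR]

theorem hochR_concat (l : List A) (c : A) :
    hochR k rgt f (l ++ [c]) = sg k (l.length + 1) • rgt c (f l) := by
  simp [hochR]

theorem hochFun_eq (hf : SlotLinear k f) (l : List A) :
    hochFun lft rgt f l = hochL lft f l - der k mulList 1 f l + hochR k rgt f l := by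
  rw [hochFun, sub_eq_add_neg]
  refine congrArg₂ (· + ·) (congrArg₂ (· + ·) ?_ ?_) ?_
  · cases l <;> simp [hochL]
  · rw [der_eq_sum isCo_mulList hf, ← Finset.sum_neg_distrib]
    have : Finset.range (l.length - 1) ⊆ Finset.range (l.length + 1) := by
      intro i; simp only [Finset.mem_range]; omega
    rw [← Finset.sum_subset this]
    · refine Finset.sum_congr rfl fun i _ => ?_
      rw [one_mul, pow_succ, mul_neg_one, neg_smul, sg, zpow_natCast]
      rfl
    · intro i _ hi
      rw [Finset.mem_range] at hi
      have h0 : mulList ((l.drop i).take 2) = (0 : A) :=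
        (isCo_mulList (k := k)).supp _ (by simp; omega)
      have : f (ins mulList (1 + 1 : ℤ).toNat i l) = 0 := hf.eq_zero (by
        change (0 : A) ∈ _ ++ mulList ((l.drop i).take 2) :: _
        rw [h0]; simp)
      rw [this, smul_zero, neg_zero]
  · rw [hochR, sg, zpow_natCast]

theorem slotLinear_hochL (hf : SlotLinear k f) : SlotLinear k (hochL lft f) := by
  intro s t c y z
  cases s with
  | nil => simp [hochL]
  | cons a s => simp [hochL, hf s t c y z]

theorem slotLinear_hochR (hf : SlotLinear k f) : SlotLinear k (hochR k rgt f) := by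
  have e : hochR k rgt f
      = fun l => hochFun (0 : A →ₗ[k] M →ₗ[k] M) rgt f l - hochL (0 : A →ₗ[k] M →ₗ[k] M) f l + der k mulList 1 f l := by
    funext l
    rw [hochFun_eq hf]
    abel
  rw [e]
  exact ((slotLinear_hochFun 0 rgt hf).sub (slotLinear_hochL hf)).add
    (slotLinear_der slotLinear_mulList 1 hf)

/-- `lft` and `rgt` are the actions of a bimodule. -/
structure IsBimodule (lft rgt : A →ₗ[k] M →ₗ[k] M) : Prop where
  lft_mul : ∀ a b m, lft (a * b) m = lft a (lft b m)
  rgt_mul : ∀ a b m, rgt (a * b) m = rgt b (rgt a m)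
  comm : ∀ a b m, lft a (rgt b m) = rgt b (lft a m)

theorem hochL_sub (f g : List A → M) (l : List A) :
    hochL lft (fun l => f l - g l) l = hochL lft f l - hochL lft g l := by
  cases l <;> simp [hochL]

theorem hochL_add (f g : List A → M) (l : List A) :
    hochL lft (fun l => f l + g l) l = hochL lft f l + hochL lft g l := by
  cases l <;> simp [hochL]

theorem hochR_sub (f g : List A → M) (l : List A) :
    hochR k rgt (fun l => f l - g l) l = hochR k rgt f l - hochR k rgt g l := by
  simp [hochR, smul_sub]

theorem hochR_add (f g : List A → M) (l : List A) :
    hochR k rgt (fun l => f l + g l) l = hochR k rgt f l + hochR k rgt g l := by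
  simp [hochR]

theorem der_sub (x : List A → A) (p : ℤ) (G H : List A → M) (l : List A) :
    der k x p (fun l => G l - H l) l = der k x p G l - der k x p H l := by
  simp only [der, smul_sub, spl_sub]

theorem hochL_hochR (hb : IsBimodule lft rgt) (l : List A) :
    hochL lft (hochR k rgt f) l + hochR k rgt (hochL lft f) l = 0 := by
  rcases l with _ | ⟨a, l⟩
  · simp [hochL, hochR_nil]
  · rcases List.eq_nil_or_concat l with rfl | ⟨l, c, rfl⟩
    · simp [hochL, hochR]
    · rw [List.concat_eq_append, ← List.cons_append, hochR_concat, List.cons_append, hochL,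
        hochR_concat, hochL, map_smul, hb.comm]
      simp only [List.length_cons, Nat.cast_add, Nat.cast_one, sg_add, sg_one]
      module

theorem hochL_hochL (hb : IsBimodule lft rgt) (hf : SlotLinear k f) (l : List A) :
    hochL lft (hochL lft f) l
      = hochL lft (der k mulList 1 f) l + der k mulList 1 (hochL lft f) l := by
  rcases l with _ | ⟨a, _ | ⟨b, l⟩⟩
  · simp [hochL, der, mulList]
  · rw [der_mulList_singleton (slotLinear_hochL hf)]
    simp [hochL, der, spl, mulList, hf.eq_zero]
  · rw [der_mulList_cons_cons (slotLinear_hochL hf)]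
    have : der k mulList 1 (fun l => hochL lft f (a :: l)) (b :: l)
        = lft a (der k mulList 1 f (b :: l)) := (map_der (lft a) _ _ _ _).symm
    rw [this]
    simp only [hochL, hb.lft_mul]
    abel

theorem hochR_hochR (hb : IsBimodule lft rgt) (hf : SlotLinear k f) (l : List A) :
    hochR k rgt (hochR k rgt f) l
      = hochR k rgt (der k mulList 1 f) l + der k mulList 1 (hochR k rgt f) l := by
  have hR : SlotLinear k (hochR k rgt f) := slotLinear_hochR hf
  rcases List.eq_nil_or_concat l with rfl | ⟨l, c, rfl⟩
  · simp [hochR, der, mulList]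
  · rcases List.eq_nil_or_concat l with rfl | ⟨l, b, rfl⟩
    · have := der_mulList_singleton hR c
      simp only [List.concat_eq_append, List.nil_append, this]
      simp [hochR, der, mulList, hf.eq_zero]
    · have e : (l.concat b).concat c = l ++ [b, c] := by simp
      rw [e, der_mulList_concat hR]
      have e2 : l ++ [b, c] = (l ++ [b]) ++ [c] := by simp
      rw [e2, hochR_concat, hochR_concat, hochR_concat, hochR_concat]
      have h3 : der k mulList 1 (fun l => hochR k rgt f (l ++ [c])) (l ++ [b])
          = -(sg k ((l ++ [b]).length + 1) • rgt c (der k mulList 1 f (l ++ [b]))) := by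
        simp only [hochR_concat]
        rw [map_der, ← der_smul, ← neg_one_smul k, ← der_smul]
        refine spl_congr fun s r hs => spl_congr fun v t hv => ?_
        by_cases hl : (v.length : ℤ) = 1 + 1
        · congr 1
          simp only [smul_smul]
          congr 1
          rw [← hs, ← hv]
          rw [neg_one_mul, eq_comm, ← mul_one (sg k _), ← mul_neg, ← sg_one (k := k), ← sg_add]
          refine sg_congr ?_
          simp only [List.length_append, List.length_cons, Nat.cast_add, hl, Nat.cast_one,
            Int.even_add, Int.not_even_one]
          tauto
        · beta_reduce
          rw [(isCo_mulList (k := k)).supp v hl, hf.zero_mid]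
          simp only [map_zero, smul_zero]
      rw [h3, hb.rgt_mul]
      simp only [List.length_append, List.length_cons, List.length_nil, Nat.cast_add, Nat.cast_one,
        sg_add, sg_one, map_smul, zero_add]
      rcases sg_eq_or (k := k) l.length with h | h <;> rw [h] <;> module

/-- The square of the Hochschild coboundary is zero. -/
theorem hochFun_hochFun [CharZero k] (hb : IsBimodule lft rgt) (hf : SlotLinear k f)
    (l : List A) : hochFun lft rgt (hochFun lft rgt f) l = 0 := by
  rw [hochFun_eq (slotLinear_hochFun lft rgt hf)]
  -- With `d = L - D + R`, the left and right outer terms and the inner one satisfy `L² = L D + D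
  -- L`, `R² = R D + D R`, `L R + R L = 0` and `D² = 0`.
  have e : hochFun lft rgt f = fun l => hochL lft f l - der k mulList 1 f l + hochR k rgt f l :=
    funext fun l => hochFun_eq hf l
  rw [e, hochL_add, hochL_sub, der_add, der_sub, hochR_add, hochR_sub, hochL_hochL hb hf,
    hochR_hochR hb hf]
  have h1 : der k mulList 1 (der k mulList 1 f) l = 0 := congrFun (derL_mulList_mulList hf) l
  have h2 := hochL_hochR (k := k) (f := f) hb l
  rw [← eq_neg_iff_add_eq_zero] at h2
  rw [h1, h2]
  abel

/-- The coboundary commutes with maps of bimodules. -/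
theorem map_hochFun {N : Type*} [AddCommGroup N] [Module k N] (φ : M →ₗ[k] N)
    {lft' rgt' : A →ₗ[k] N →ₗ[k] N} (hl : ∀ a m, φ (lft a m) = lft' a (φ m))
    (hr : ∀ a m, φ (rgt a m) = rgt' a (φ m)) (f : List A → M) (l : List A) :
    φ (hochFun lft rgt f l) = hochFun lft' rgt' (fun l => φ (f l)) l := by
  simp only [hochFun, map_add, map_sum, map_smul, hl, hr]

variable {N : Type*} [AddCommGroup N] [Module k N] {W : Type*} [AddCommGroup W] [Module k W]

/-- The product of cochains along a pairing of coefficients. -/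
def cupB (B : M →ₗ[k] N →ₗ[k] W) (f : List A → M) (g : List A → N) (l : List A) : W :=
  spl (fun u v => B (f u) (g v)) l

theorem slotLinear_cupB (B : M →ₗ[k] N →ₗ[k] W) {g : List A → N} (hf : SlotLinear k f)
    (hg : SlotLinear k g) : SlotLinear k (cupB B f g) :=
  SlotLinear.spl (fun u s t c y z => by simp [hg s t c y z])
    fun v s t c y z => by simp [hf s t c y z]

theorem der_cupB (B : M →ₗ[k] N →ₗ[k] W) {g : List A → N} (l : List A) :
    der k mulList 1 (cupB B f g) l
      = spl (fun u v => B (der k mulList 1 f u) (g v)) l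
        + spl (fun u v => sg k u.length • B (f u) (der k mulList 1 g v)) l := by
  simp only [der, cupB, spl_append, spl_add, smul_add, smul_spl]
  rw [add_comm]
  refine congrArg₂ (· + ·) ?_ ?_
  · have e : ∀ (u v : List A), B (spl (fun u t => spl (fun v w =>
        sg k (1 * (u.length : ℤ)) • f (u ++ mulList v :: w)) t) u) (g v)
        = spl (fun u t => spl (fun s w =>
          sg k (1 * (u.length : ℤ)) • B (f (u ++ mulList s :: w)) (g v)) t) u := by
      intro u v
      rw [← LinearMap.flip_apply B, map_spl]
      simp only [map_spl, LinearMap.map_smul, LinearMap.flip_apply, LinearMap.smul_apply]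
    refine Eq.trans ?_ (spl_congr fun u v _ => (e u v).symm)
    rw [spl_left]
    refine spl_congr fun u t _ => ?_
    rw [spl_assoc (fun v w₁ w₂ =>
      sg k (1 * (u.length : ℤ)) • B (f (u ++ mulList v :: w₁)) (g w₂))]
  · rw [spl_left_right]
    refine spl_congr fun u t _ => ?_
    simp only [map_spl, smul_spl, map_smul, sg_smul_smul]
    refine spl_congr fun u₂ t _ => spl_congr fun v w _ => ?_
    rw [List.length_append, Nat.cast_add, one_mul, one_mul]

/-- The Leibniz rule for the product of cochains along a balanced pairing. -/
theorem hochFun_cupB (B : M →ₗ[k] N →ₗ[k] W) {lftN rgtN : A →ₗ[k] N →ₗ[k] N}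
    {lftW rgtW : A →ₗ[k] W →ₗ[k] W} (hB : ∀ a m n, B (rgt a m) n = B m (lftN a n))
    (hL : ∀ a m n, B (lft a m) n = lftW a (B m n)) (hR : ∀ a m n, B m (rgtN a n) = rgtW a (B m n))
    {g : List A → N} (hf : SlotLinear k f) (hg : SlotLinear k g) (l : List A) :
    hochFun lftW rgtW (cupB B f g) l = spl (fun u v => B (hochFun lft rgt f u) (g v)) l
      + spl (fun u v => sg k u.length • B (f u) (hochFun lftN rgtN g v)) l := by
  have h1 : spl (fun u v => B (hochL lft f u) (g v)) l = hochL lftW (cupB B f g) l := by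
    cases l with
    | nil => simp [hochL]
    | cons a l => simp [spl_cons, hochL, cupB, map_spl, hL]
  have h2 : spl (fun u v => sg k u.length • B (f u) (hochR k rgtN g v)) l
      = hochR k rgtW (cupB B f g) l := by
    rcases List.eq_nil_or_concat l with rfl | ⟨l, c, rfl⟩
    · simp [hochR_nil]
    · rw [List.concat_eq_append, spl_append, hochR_concat, cupB, map_spl, smul_spl]
      simp only [spl_nil, hochR_nil, map_zero, smul_zero, add_zero, hochR_concat, map_smul, hR]
      refine spl_congr fun u v h => ?_
      rw [sg_smul_smul, ← h]
      simp [add_assoc]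
  -- The left outer term of `g` at one cut equals, up to sign, the right outer term of `f` at the
  -- next cut, because the pairing is balanced. The sum telescopes, and both ends are zero.
  have h3 : spl (fun u v => sg k u.length • B (f u) (hochL lftN g v)) l
      - spl (fun u v => -B (hochR k rgt f u) (g v)) l = 0 := by
    rw [spl_telescope]
    · simp [hochL, hochR_nil]
    · intro w c t
      rw [hochR_concat, hochL, map_smul, LinearMap.smul_apply, hB, neg_sg_smul, sg_add, sg_add]
      simp
  rw [hochFun_eq (slotLinear_cupB B hf hg), der_cupB]
  simp only [hochFun_eq hf, hochFun_eq hg, map_add, map_sub, LinearMap.add_apply,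
    LinearMap.sub_apply, smul_add, smul_sub, spl_add, spl_sub, h1, h2]
  have h4 : spl (fun u v => -B (hochR k rgt f u) (g v)) l
      = -spl (fun u v => B (hochR k rgt f u) (g v)) l := by
    rw [← neg_one_smul k (spl _ l), smul_spl]; simp only [neg_one_smul]
  rw [h4, sub_neg_eq_add, ← eq_neg_iff_add_eq_zero] at h3
  rw [h3]
  abel

end Bimodules

/-! ### Tensor powers of `A / k` -/

noncomputable section Words

variable (k : Type u) (A : Type v) [Field k] [Ring A] [Algebra k A]

/-- The relations that present `(A / k)^{⊗ n}` by the symbols `a₁ ⊗ … ⊗ aₙ`. -/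
def wordRel (n : ℤ) : Submodule k (List A →₀ k) :=
  Submodule.span k
    ({r | ∃ (s t : List A) (c : k) (y z : A), r = Finsupp.single (s ++ (c • y + z) :: t) 1
          - (c • Finsupp.single (s ++ y :: t) 1 + Finsupp.single (s ++ z :: t) 1)}
      ∪ {r | ∃ t : List A, ((1 : A) ∈ t ∨ (t.length : ℤ) ≠ n) ∧ r = Finsupp.single t 1})

/-- The `n`-th tensor power of `A / k`. -/
def Word (n : ℤ) : Type (max u v) := (List A →₀ k) ⧸ wordRel k A n

instance (n : ℤ) : AddCommGroup (Word k A n) :=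
  inferInstanceAs (AddCommGroup ((List A →₀ k) ⧸ wordRel k A n))

instance (n : ℤ) : Module k (Word k A n) :=
  inferInstanceAs (Module k ((List A →₀ k) ⧸ wordRel k A n))

/-- The projection onto the quotient. -/
def wordMk (n : ℤ) : (List A →₀ k) →ₗ[k] Word k A n := (wordRel k A n).mkQ

theorem wordMk_eq_zero {n : ℤ} {r : List A →₀ k} (h : r ∈ wordRel k A n) : wordMk k A n r = 0 :=
  (Submodule.Quotient.mk_eq_zero _).2 h

/-- The universal normalized cochain, with value `a₁ ⊗ … ⊗ aₙ`. -/
def word (n : ℤ) : MCochain k A (Word k A n) n :=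
  ⟨fun l => wordMk k A n (Finsupp.single l 1), by
    refine ⟨fun s t c y z => ?_, fun l hl => ?_, fun l hl => ?_⟩
    · rw [← map_smul, ← map_add, ← sub_eq_zero, ← map_sub]
      exact wordMk_eq_zero k A (Submodule.subset_span (Or.inl ⟨s, t, c, y, z, rfl⟩))
    · exact wordMk_eq_zero k A (Submodule.subset_span (Or.inr ⟨l, Or.inl hl, rfl⟩))
    · exact wordMk_eq_zero k A (Submodule.subset_span (Or.inr ⟨l, Or.inr hl, rfl⟩))⟩

variable {k A}
variable {W : Type w} [AddCommGroup W] [Module k W]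

/-- The linear map `a₁ ⊗ … ⊗ aₙ ↦ f (a₁, …, aₙ)`. -/
def wordLift {n : ℤ} (f : MCochain k A W n) : Word k A n →ₗ[k] W :=
  (wordRel k A n).liftQ (Finsupp.linearCombination k f.1) (by
    rw [wordRel, Submodule.span_le]
    rintro r (⟨s, t, c, y, z, rfl⟩ | ⟨t, h, rfl⟩)
    · simp [f.2.1 s t c y z]
    · rcases h with h | h
      · simp [f.2.2.1 t h]
      · simp [f.2.2.2 t h])

@[simp]
theorem wordLift_word {n : ℤ} (f : MCochain k A W n) (l : List A) :
    wordLift f ((word k A n).1 l) = f.1 l := by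
  refine ((wordRel k A n).liftQ_apply _ _).trans ?_
  simp

theorem word_hom_ext {n : ℤ} {f g : Word k A n →ₗ[k] W}
    (h : ∀ l, f ((word k A n).1 l) = g ((word k A n).1 l)) : f = g := by
  refine Submodule.linearMap_qext _ (Finsupp.lhom_ext fun l r => ?_)
  have e : Finsupp.single l r = r • Finsupp.single l (1 : k) := by simp
  rw [e, map_smul, map_smul]
  exact congrArg (r • ·) (h l)

theorem tensor_word_hom_ext {M : Type*} [AddCommGroup M] [Module k M] {n : ℤ}
    {f g : M ⊗[k] Word k A n →ₗ[k] W}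
    (h : ∀ m l, f (m ⊗ₜ (word k A n).1 l) = g (m ⊗ₜ (word k A n).1 l)) : f = g :=
  TensorProduct.ext (LinearMap.ext fun m => word_hom_ext fun l => h m l)

/-- Change of the coefficients of a cochain. -/
def MCochain.map {M N : Type*} [AddCommGroup M] [Module k M] [AddCommGroup N] [Module k N]
    (φ : M →ₗ[k] N) {n : ℤ} : MCochain k A M n →ₗ[k] MCochain k A N n where
  toFun f := ⟨fun l => φ (f.1 l), fun s t c y z => by simp [f.2.1 s t c y z],
    fun l hl => by simp [f.2.2.1 l hl], fun l hl => by simp [f.2.2.2 l hl]⟩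
  map_add' f g := by ext l; simp
  map_smul' c f := by ext l; simp

end Words

/-! ### Hochschild chains and the cap product with coefficients -/

noncomputable section Coefficients

variable (k : Type u) (A : Type v) [Field k] [Ring A] [Algebra k A]
variable (M : Type w) [AddCommGroup M] [Module k M] [Module (A ⊗[k] Aᵐᵒᵖ) M]
  [IsScalarTower k (A ⊗[k] Aᵐᵒᵖ) M]
variable {N : Type*} [AddCommGroup N] [Module k N] [Module (A ⊗[k] Aᵐᵒᵖ) N]
  [IsScalarTower k (A ⊗[k] Aᵐᵒᵖ) N]

/-- The left action of `A` on an `Aᵉ`-module. -/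
def lftM : A →ₗ[k] M →ₗ[k] M :=
  LinearMap.mk₂ k (fun a m => (a ⊗ₜ[k] (1 : Aᵐᵒᵖ)) • m)
    (by intros; rw [TensorProduct.add_tmul, add_smul])
    (by intros; rw [← TensorProduct.smul_tmul', smul_assoc])
    (by intros; rw [smul_add])
    (by intro c a m; rw [← algebraMap_smul (A ⊗[k] Aᵐᵒᵖ) c m,
          ← algebraMap_smul (A ⊗[k] Aᵐᵒᵖ) c ((a ⊗ₜ[k] (1 : Aᵐᵒᵖ)) • m), smul_smul, smul_smul,
          Algebra.commutes])

/-- The right action of `A` on an `Aᵉ`-module. -/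
def rgtM : A →ₗ[k] M →ₗ[k] M :=
  LinearMap.mk₂ k (fun a m => ((1 : A) ⊗ₜ[k] MulOpposite.op a) • m)
    (by intros; rw [MulOpposite.op_add, TensorProduct.tmul_add, add_smul])
    (by intros; rw [MulOpposite.op_smul, TensorProduct.tmul_smul, smul_assoc])
    (by intros; rw [smul_add])
    (by intro c a m; rw [← algebraMap_smul (A ⊗[k] Aᵐᵒᵖ) c m,
          ← algebraMap_smul (A ⊗[k] Aᵐᵒᵖ) c (((1 : A) ⊗ₜ[k] MulOpposite.op a) • m), smul_smul,
          smul_smul, Algebra.commutes])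

variable {A M}

theorem lftM_apply (a : A) (m : M) : lftM k A M a m = (a ⊗ₜ[k] (1 : Aᵐᵒᵖ)) • m := rfl

theorem rgtM_apply (a : A) (m : M) :
    rgtM k A M a m = ((1 : A) ⊗ₜ[k] MulOpposite.op a) • m := rfl

theorem lftM_one : lftM k A M 1 = LinearMap.id :=
  LinearMap.ext fun m => one_smul (A ⊗[k] Aᵐᵒᵖ) m

theorem rgtM_one : rgtM k A M 1 = LinearMap.id :=
  LinearMap.ext fun m => one_smul (A ⊗[k] Aᵐᵒᵖ) m

theorem isBimodule_lftM : IsBimodule (lftM k A M) (rgtM k A M) where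
  lft_mul a b m := by simp [lftM_apply, smul_smul]
  rgt_mul a b m := by simp [rgtM_apply, smul_smul]
  comm a b m := by simp [lftM_apply, rgtM_apply, smul_smul]

theorem map_lftM (φ : M →ₗ[A ⊗[k] Aᵐᵒᵖ] N) (a : A) (m : M) :
    φ (lftM k A M a m) = lftM k A N a (φ m) := map_smul φ _ _

theorem map_rgtM (φ : M →ₗ[A ⊗[k] Aᵐᵒᵖ] N) (a : A) (m : M) :
    φ (rgtM k A M a m) = rgtM k A N a (φ m) := map_smul φ _ _

/-- The Hochschild differential with coefficients in an `Aᵉ`-module. -/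
def coD {i j : ℤ} (h : j = i + 1) : MCochain k A M i →ₗ[k] MCochain k A M j :=
  hochDiff (lftM k A M) (rgtM k A M) (lftM_one k) (rgtM_one k) h

theorem coe_coD {i j : ℤ} (h : j = i + 1) (f : MCochain k A M i) :
    (coD k h f).1 = hochFun (lftM k A M) (rgtM k A M) f.1 := rfl

variable {k}

/-- An action on `M` acts on maps out of `M`. -/
def homAct {M W : Type*} [AddCommGroup M] [Module k M] [AddCommGroup W] [Module k W]
    (act : A →ₗ[k] M →ₗ[k] M) : A →ₗ[k] (M →ₗ[k] W) →ₗ[k] (M →ₗ[k] W) :=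
  LinearMap.mk₂ k (fun a φ => φ ∘ₗ act a) (by intros; ext; simp) (by intros; ext; simp)
    (by intros; ext; simp) (by intros; ext; simp)

theorem homAct_apply {M W : Type*} [AddCommGroup M] [Module k M] [AddCommGroup W] [Module k W]
    (act : A →ₗ[k] M →ₗ[k] M) (a : A) (φ : M →ₗ[k] W) (m : M) :
    homAct act a φ m = φ (act a m) := rfl

theorem homAct_one {M W : Type*} [AddCommGroup M] [Module k M] [AddCommGroup W] [Module k W]
    {act : A →ₗ[k] M →ₗ[k] M} (h : act 1 = LinearMap.id) :
    homAct (W := W) act 1 = LinearMap.id := by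
  ext φ m; simp [homAct_apply, h]

/-- The coboundary of cochains with values in linear maps, after composition with a map. -/
theorem comp_hochFun {M W W' : Type*} [AddCommGroup M] [Module k M] [AddCommGroup W] [Module k W]
    [AddCommGroup W'] [Module k W'] (T : W →ₗ[k] W') (lft rgt : A →ₗ[k] M →ₗ[k] M)
    (θ : List A → M →ₗ[k] W) (l : List A) (m : M) :
    T (hochFun (homAct rgt) (homAct lft) θ l m)
      = hochFun (homAct rgt) (homAct lft) (fun l => T ∘ₗ θ l) l m := by
  simp [hochFun, homAct_apply]

/-- The coboundary of cochains with values in linear maps, restricted along a map. -/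
theorem hochFun_comp {M N W : Type*} [AddCommGroup M] [Module k M] [AddCommGroup N] [Module k N]
    [AddCommGroup W] [Module k W] (φ : M →ₗ[k] N) {lft rgt : A →ₗ[k] M →ₗ[k] M}
    {lft' rgt' : A →ₗ[k] N →ₗ[k] N} (hl : ∀ a m, φ (lft a m) = lft' a (φ m))
    (hr : ∀ a m, φ (rgt a m) = rgt' a (φ m)) (θ : List A → N →ₗ[k] W) (l : List A) (m : M) :
    hochFun (homAct rgt') (homAct lft') θ l (φ m)
      = hochFun (homAct rgt) (homAct lft) (fun l => θ l ∘ₗ φ) l m := by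
  simp [hochFun, homAct_apply, hl, hr]

theorem isBimodule_homAct {M W : Type*} [AddCommGroup M] [Module k M] [AddCommGroup W]
    [Module k W] {lft rgt : A →ₗ[k] M →ₗ[k] M} (h : IsBimodule lft rgt) :
    IsBimodule (homAct (W := W) rgt) (homAct lft) where
  lft_mul a b φ := by ext m; simp [homAct_apply, h.rgt_mul]
  rgt_mul a b φ := by ext m; simp [homAct_apply, h.lft_mul]
  comm a b φ := by ext m; simp [homAct_apply, h.comm]

variable (k A M) in
/-- The universal cochain with values in `Hom (M, M ⊗ (A / k)^{⊗ n})`. -/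
def theta (n : ℤ) : MCochain k A (M →ₗ[k] M ⊗[k] Word k A n) n :=
  MCochain.map (TensorProduct.mk k M (Word k A n)).flip (word k A n)

theorem theta_apply (n : ℤ) (l : List A) (m : M) :
    (theta k A M n).1 l m = m ⊗ₜ (word k A n).1 l := rfl

/-- The differential of the Hochschild chains with coefficients in `M`. -/
def bM {n m : ℤ} (h : n = m + 1) : M ⊗[k] Word k A n →ₗ[k] M ⊗[k] Word k A m :=
  TensorProduct.lift (wordLift (hochDiff (homAct (rgtM k A M)) (homAct (lftM k A M))
    (homAct_one (rgtM_one k)) (homAct_one (lftM_one k)) h (theta k A M m))).flip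

/-- The chain differential is the coboundary of the universal cochain `theta`, the two actions of
`A` on `M` being exchanged by passage to `Hom (M, -)`. Hence `bM_bM` and the compatibility with cap
products are instances of facts about cochains. -/
theorem bM_tmul {n m : ℤ} (h : n = m + 1) (x : M) (l : List A) :
    bM h (x ⊗ₜ[k] (word k A n).1 l)
      = hochFun (homAct (rgtM k A M)) (homAct (lftM k A M)) (theta k A M m).1 l x := by
  rw [bM, TensorProduct.lift.tmul, LinearMap.flip_apply, wordLift_word]
  rfl

theorem bM_bM [CharZero k] {n m r : ℤ} (h : n = m + 1) (h' : m = r + 1)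
    (z : M ⊗[k] Word k A n) : bM h' (bM h z) = 0 := by
  have : bM h' ∘ₗ bM h = (0 : M ⊗[k] Word k A n →ₗ[k] M ⊗[k] Word k A r) :=
    tensor_word_hom_ext fun x l => by
      rw [LinearMap.comp_apply, bM_tmul, LinearMap.zero_apply, comp_hochFun]
      have e : (fun l => bM h' ∘ₗ (theta k A M m).1 l)
          = hochFun (homAct (rgtM k A M)) (homAct (lftM k A M)) (theta k A M r).1 :=
        funext fun l => LinearMap.ext fun x => bM_tmul h' x l
      rw [e, hochFun_hochFun (isBimodule_homAct (isBimodule_lftM k)) (theta k A M r).2.1]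
      rfl
  exact LinearMap.congr_fun this z

theorem coD_coD [CharZero k] {i j l : ℤ} (h : j = i + 1) (h' : l = j + 1)
    (f : MCochain k A M i) : coD k h' (coD k h f) = 0 := by
  ext w
  exact hochFun_hochFun (isBimodule_lftM k) f.2.1 w

/-- The map `a ↦ a ⊗ a₁ ⊗ … ⊗ aₙ`. -/
def headMap (l : List A) : A →ₗ[k] Chain k A := (slotLinear_chain k).mid [] l

/-- The same description for `M = A`: the product `a₀ a₁` is the left outer term and the cyclic
product `aₙ a₀` the right outer term. -/
theorem b_eq_hochFun (a : A) (l : List A) :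
    b (chain k (a :: l)) = hochFun (homAct (LinearMap.mul k A).flip) (homAct (LinearMap.mul k A))
      (headMap (k := k)) l a := by
  have h0 : ∀ l, chain k ((0 : A) :: l) = 0 := fun l => (slotLinear_chain k).eq_zero (by simp)
  rw [b, chainLift_chain, bFun]
  have e0 : ∀ (a : A) l, headMap (k := k) l a = chain k (a :: l) := fun _ _ => rfl
  rcases List.eq_nil_or_concat l with rfl | ⟨l, c, rfl⟩
  · simp [hochFun, ins, mulList, h0]
  · have hr := rotate_concat (a :: l) c
    rw [List.concat_eq_append, ← List.cons_append, hr]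
    have e1 : chain k (ins mulList 2 0 (c :: a :: l)) = chain k ((c * a) :: l) := by
      simp [ins, mulList]
    rw [e1, hochFun]
    have e2 : (a :: l ++ [c]).length - 1 = ((l ++ [c]).length - 1) + 1 := by simp
    rw [e2, Finset.sum_range_succ']
    simp only [LinearMap.add_apply, LinearMap.sum_apply, LinearMap.smul_apply, homAct_apply, e0]
    have e3 : ∀ i, ins mulList 2 (i + 1) (a :: l ++ [c]) = a :: ins mulList 2 i (l ++ [c]) := by
      intro i; simp [ins, Nat.add_right_comm i 1 2]
    have e4 : (-1 : k) ^ 0 • chain k (ins mulList 2 0 (a :: l ++ [c]))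
        = chain k ((LinearMap.mul k A).flip ((l ++ [c]).headD 0) a :: (l ++ [c]).tail) := by
      rw [pow_zero, one_smul]
      cases l <;> simp [ins, mulList]
    rw [e4]
    simp only [e3]
    rw [add_comm (Finset.sum _ _)]
    simp

variable (A) in
/-- The pairing underlying the cap product. -/
def capPair (W : Type*) [AddCommGroup W] [Module k W] :
    M →ₗ[k] (M →ₗ[k] W) →ₗ[k] (A →ₗ[k] W) :=
  LinearMap.mk₂ k (fun m φ => φ ∘ₗ (lftM k A M).flip m) (by intros; ext; simp)
    (by intros; ext; simp) (by intros; ext; simp) (by intros; ext; simp)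

theorem capPair_apply {W : Type*} [AddCommGroup W] [Module k W] (m : M) (φ : M →ₗ[k] W) (a : A) :
    capPair A W m φ a = φ (lftM k A M a m) := rfl

/-- The Leibniz rule for `(m, φ) ↦ (a ↦ φ (a m))`; this pairing is balanced because the two actions
on `M` commute. -/
theorem hochFun_capPair {W : Type*} [AddCommGroup W] [Module k W] {f : List A → M}
    {g : List A → M →ₗ[k] W} (hf : SlotLinear k f) (hg : SlotLinear k g) (l : List A) :
    hochFun (homAct (LinearMap.mul k A).flip) (homAct (LinearMap.mul k A))
        (cupB (capPair A W) f g) l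
      = spl (fun u v => capPair A W (hochFun (lftM k A M) (rgtM k A M) f u) (g v)) l
        + spl (fun u v => sg k u.length • capPair A W (f u)
          (hochFun (homAct (rgtM k A M)) (homAct (lftM k A M)) g v)) l := by
  refine hochFun_cupB (capPair A W) (fun a m φ => ?_) (fun a m φ => ?_) (fun a m φ => ?_) hf hg l
  · ext c
    simp [capPair_apply, homAct_apply, (isBimodule_lftM k).comm]
  · ext c
    simp [capPair_apply, homAct_apply, (isBimodule_lftM k).lft_mul]
  · ext c
    simp [capPair_apply, homAct_apply, (isBimodule_lftM k).lft_mul]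

/-- The cap product with a fixed cochain, on chains of all degrees, followed by the projection to
degree `n`. -/
def capL (n : ℤ) {i : ℤ} (f : MCochain k A M i) : Chain k A →ₗ[k] M ⊗[k] Word k A n :=
  chainLift (fun l => match l with
    | [] => 0
    | a :: l => cupB (capPair A _) f.1 (theta k A M n).1 l a)
    { nil := rfl
      slot := by
        intro s t c y z
        cases s with
        | nil => simp
        | cons a s => simp [slotLinear_cupB (capPair A _) f.2.1 (theta k A M n).2.1 s t c y z]
      one := by
        intro a l h
        have : cupB (capPair A _) f.1 (theta k A M n).1 l = 0 := spl_eq_zero fun u v huv => by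
          rw [← huv, List.mem_append] at h
          rcases h with h | h
          · rw [f.2.2.1 u h]; simp
          · rw [(theta k A M n).2.2.1 v h]; simp
        simp [this] }

theorem capL_cons (n : ℤ) {i : ℤ} (f : MCochain k A M i) (a : A) (l : List A) :
    capL n f (chain k (a :: l)) = cupB (capPair A _) f.1 (theta k A M n).1 l a := by
  rw [capL, chainLift_chain]

theorem capL_cons_spl (n : ℤ) {i : ℤ} (f : MCochain k A M i) (a : A) (l : List A) :
    capL n f (chain k (a :: l))
      = spl (fun u v => lftM k A M a (f.1 u) ⊗ₜ (word k A n).1 v) l := by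
  rw [capL_cons, cupB, ← LinearMap.applyₗ_apply_apply, map_spl]
  rfl

/-- The cap product is compatible with the differentials. -/
theorem capL_b {i j n m : ℤ} (h : j = i + 1) (hn : n = m + 1) (f : MCochain k A M i)
    (c : Chain k A) :
    capL m f (b c) = capL m (coD k h f) c + sg k i • bM hn (capL n f c) := by
  have : capL m f ∘ₗ b = capL m (coD k h f) + sg k i • bM hn ∘ₗ capL n f :=
    chain_hom_ext_cons fun a l => by
      simp only [LinearMap.comp_apply, LinearMap.add_apply, LinearMap.smul_apply]
      have e : (fun l => capL m f ∘ₗ headMap (k := k) l)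
          = cupB (capPair A _) f.1 (theta k A M m).1 :=
        funext fun l => LinearMap.ext fun a => capL_cons m f a l
      rw [b_eq_hochFun, comp_hochFun, e, hochFun_capPair f.2.1 (theta k A M m).2.1,
        LinearMap.add_apply]
      rw [capL_cons m (coD k h f), cupB, coe_coD]
      congr 1
      rw [capL_cons_spl, ← LinearMap.applyₗ_apply_apply, map_spl, map_spl, smul_spl]
      refine spl_congr fun u v _ => ?_
      rw [LinearMap.applyₗ_apply_apply, LinearMap.smul_apply, capPair_apply, bM_tmul]
      by_cases hu : (u.length : ℤ) = i
      · rw [hu]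
      · rw [f.2.2.2 u hu, map_zero, map_zero, smul_zero, smul_zero]
  exact LinearMap.congr_fun this c

/-- The cap product with a fixed chain. -/
def capM (c : Chain k A) (n i : ℤ) : MCochain k A M i →ₗ[k] M ⊗[k] Word k A n where
  toFun f := capL n f c
  map_add' f g := by
    have : capL n (f + g) = capL n f + capL n g := chain_hom_ext_cons fun a l => by
      rw [LinearMap.add_apply, capL_cons_spl, capL_cons_spl, capL_cons_spl, ← spl_add]
      simp [TensorProduct.add_tmul]
    rw [this, LinearMap.add_apply]
  map_smul' r f := by
    have : capL n (r • f) = r • capL n f := chain_hom_ext_cons fun a l => by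
      rw [LinearMap.smul_apply, capL_cons_spl, capL_cons_spl, smul_spl]
      simp [TensorProduct.smul_tmul']
    rw [this, LinearMap.smul_apply]
    rfl

theorem capM_apply (c : Chain k A) (n i : ℤ) (f : MCochain k A M i) : capM c n i f = capL n f c :=
  rfl

end Coefficients

/-! ### The cone of the cap product and its acyclicity -/

noncomputable section Cone

variable {k : Type u} {A : Type v} [Field k] [Ring A] [Algebra k A]
variable {M : Type*} [AddCommGroup M] [Module k M] [Module (A ⊗[k] Aᵐᵒᵖ) M]
  [IsScalarTower k (A ⊗[k] Aᵐᵒᵖ) M]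
variable {N : Type*} [AddCommGroup N] [Module k N] [Module (A ⊗[k] Aᵐᵒᵖ) N]
  [IsScalarTower k (A ⊗[k] Aᵐᵒᵖ) N]
variable {K : Type*} [AddCommGroup K] [Module k K] [Module (A ⊗[k] Aᵐᵒᵖ) K]
  [IsScalarTower k (A ⊗[k] Aᵐᵒᵖ) K]

variable (k A M) in
/-- The terms of the cone of the cap product. -/
abbrev Cone (i n : ℤ) : Type _ := MCochain k A M i × (M ⊗[k] Word k A n)

/-- The differential of the cone of the cap product with `c`. -/
def coneD (c : Chain k A) {i j n m : ℤ} (h : j = i + 1) (hn : n = m + 1) :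
    Cone k A M i n →ₗ[k] Cone k A M j m :=
  LinearMap.prod (coD k h ∘ₗ LinearMap.fst k _ _)
    (capM c m i ∘ₗ LinearMap.fst k _ _ - sg k i • bM hn ∘ₗ LinearMap.snd k _ _)

theorem coneD_apply (c : Chain k A) {i j n m : ℤ} (h : j = i + 1) (hn : n = m + 1)
    (z : Cone k A M i n) :
    coneD c h hn z = (coD k h z.1, capL m z.1 c - sg k i • bM hn z.2) := rfl

theorem coneD_coneD [CharZero k] {c : Chain k A} (hc : b c = 0) {i j l n m r : ℤ} (h : j = i + 1)
    (h' : l = j + 1) (hn : n = m + 1) (hm : m = r + 1) (z : Cone k A M i n) :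
    coneD c h' hm (coneD c h hn z) = 0 := by
  rw [coneD_apply, coneD_apply]
  dsimp only
  rw [coD_coD, map_sub, map_smul, bM_bM, smul_zero, sub_zero]
  have := capL_b h hm z.1 c
  rw [hc, map_zero, eq_comm, ← eq_neg_iff_add_eq_zero] at this
  rw [this, h, sg_add, sg_one]
  refine Prod.ext rfl ?_
  change -(sg k i • bM hm (capL m z.1 c)) - _ = (0 : _)
  module

/-- The map of cones induced by a map of coefficients. -/
def coneMap (φ : M →ₗ[A ⊗[k] Aᵐᵒᵖ] N) (i n : ℤ) : Cone k A M i n →ₗ[k] Cone k A N i n :=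
  (MCochain.map (φ.restrictScalars k)).prodMap ((φ.restrictScalars k).rTensor _)

theorem coneMap_apply (φ : M →ₗ[A ⊗[k] Aᵐᵒᵖ] N) (i n : ℤ) (z : Cone k A M i n) :
    coneMap φ i n z
      = (MCochain.map (φ.restrictScalars k) z.1, (φ.restrictScalars k).rTensor _ z.2) := rfl

theorem coD_map (φ : M →ₗ[A ⊗[k] Aᵐᵒᵖ] N) {i j : ℤ} (h : j = i + 1) (f : MCochain k A M i) :
    coD k h (MCochain.map (φ.restrictScalars k) f)
      = MCochain.map (φ.restrictScalars k) (coD k h f) := by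
  ext l
  exact (map_hochFun (φ.restrictScalars k) (map_lftM k φ) (map_rgtM k φ) f.1 l).symm

theorem bM_map (φ : M →ₗ[A ⊗[k] Aᵐᵒᵖ] N) {n m : ℤ} (h : n = m + 1) (z : M ⊗[k] Word k A n) :
    bM h ((φ.restrictScalars k).rTensor _ z) = (φ.restrictScalars k).rTensor _ (bM h z) := by
  have : bM h ∘ₗ (φ.restrictScalars k).rTensor (Word k A n)
      = (φ.restrictScalars k).rTensor (Word k A m) ∘ₗ bM h :=
    tensor_word_hom_ext fun x l => by
      rw [LinearMap.comp_apply, LinearMap.comp_apply, LinearMap.rTensor_tmul, bM_tmul, bM_tmul,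
        comp_hochFun, hochFun_comp (φ.restrictScalars k) (lft := lftM k A M) (rgt := rgtM k A M)
          (map_lftM k φ) (map_rgtM k φ)]
      rfl
  exact LinearMap.congr_fun this z

theorem capL_map (φ : M →ₗ[A ⊗[k] Aᵐᵒᵖ] N) (n : ℤ) {i : ℤ} (f : MCochain k A M i)
    (c : Chain k A) :
    capL n (MCochain.map (φ.restrictScalars k) f) c
      = (φ.restrictScalars k).rTensor _ (capL n f c) := by
  have : capL n (MCochain.map (φ.restrictScalars k) f)
      = (φ.restrictScalars k).rTensor _ ∘ₗ capL n f := chain_hom_ext_cons fun a l => by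
    rw [LinearMap.comp_apply, capL_cons_spl, capL_cons_spl, map_spl]
    refine spl_congr fun u v _ => ?_
    rw [LinearMap.rTensor_tmul]
    congr 1
    exact (map_lftM k φ a (f.1 u)).symm
  exact LinearMap.congr_fun this c

theorem coneD_coneMap (φ : M →ₗ[A ⊗[k] Aᵐᵒᵖ] N) (c : Chain k A) {i j n m : ℤ} (h : j = i + 1)
    (hn : n = m + 1) (z : Cone k A M i n) :
    coneD c h hn (coneMap φ i n z) = coneMap φ j m (coneD c h hn z) := by
  rw [coneD_apply, coneD_apply, coneMap_apply, coneMap_apply]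
  dsimp only
  rw [coD_map, bM_map, capL_map, map_sub, map_smul]

theorem coneMap_comp (φ : N →ₗ[A ⊗[k] Aᵐᵒᵖ] K) (ψ : M →ₗ[A ⊗[k] Aᵐᵒᵖ] N) (i n : ℤ)
    (z : Cone k A M i n) : coneMap φ i n (coneMap ψ i n z) = coneMap (φ ∘ₗ ψ) i n z := by
  refine Prod.ext rfl ?_
  change LinearMap.rTensor _ _ (LinearMap.rTensor _ _ _) = LinearMap.rTensor _ _ _
  rw [← LinearMap.comp_apply, ← LinearMap.rTensor_comp]
  rfl

theorem coneMap_add (φ ψ : M →ₗ[A ⊗[k] Aᵐᵒᵖ] N) (i n : ℤ) (z : Cone k A M i n) :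
    coneMap (φ + ψ) i n z = coneMap φ i n z + coneMap ψ i n z := by
  refine Prod.ext rfl ?_
  change ((φ.restrictScalars k + ψ.restrictScalars k).rTensor (Word k A n)) z.2
    = (φ.restrictScalars k).rTensor (Word k A n) z.2 + (ψ.restrictScalars k).rTensor _ z.2
  rw [LinearMap.rTensor_add, LinearMap.add_apply]

theorem coneMap_zero (i n : ℤ) (z : Cone k A M i n) :
    coneMap (0 : M →ₗ[A ⊗[k] Aᵐᵒᵖ] N) i n z = 0 := by
  refine Prod.ext rfl ?_
  change ((0 : M →ₗ[k] N).rTensor (Word k A n)) z.2 = 0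
  rw [LinearMap.rTensor_zero, LinearMap.zero_apply]

theorem coneMap_sum {ι : Type*} (s : Finset ι) (φ : ι → M →ₗ[A ⊗[k] Aᵐᵒᵖ] N) (i n : ℤ)
    (z : Cone k A M i n) : coneMap (∑ j ∈ s, φ j) i n z = ∑ j ∈ s, coneMap (φ j) i n z := by
  classical
  induction s using Finset.induction_on with
  | empty => rw [Finset.sum_empty, Finset.sum_empty, coneMap_zero]
  | insert j s hj ih =>
    rw [Finset.sum_insert hj, Finset.sum_insert hj, ← ih, coneMap_add]

theorem coneMap_id (i n : ℤ) (z : Cone k A M i n) : coneMap LinearMap.id i n z = z := by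
  refine Prod.ext rfl ?_
  have e : (LinearMap.id : M →ₗ[A ⊗[k] Aᵐᵒᵖ] M).restrictScalars k = LinearMap.id := rfl
  rw [coneMap_apply, e, LinearMap.rTensor_id, LinearMap.id_apply]

variable (M) in
/-- The cap product with a chain of degree `d` is a quasi-isomorphism for the coefficients `M`:
its cone is acyclic. -/
def CapAcyclic (d : ℤ) (c : Chain k A) : Prop :=
  ∀ (i n : ℤ), i + n = d + 1 → ∀ z : Cone k A M i n,
    coneD c (show i + 1 = i + 1 from rfl) (show n = (n - 1) + 1 by ring) z = 0 →
      ∃ w : Cone k A M (i - 1) (n + 1),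
        coneD c (show i = (i - 1) + 1 by ring) (show n + 1 = n + 1 from rfl) w = z

theorem CapAcyclic.exists {d : ℤ} {c : Chain k A} (hM : CapAcyclic M d c) {h i j m n r : ℤ}
    (hin : i + n = d + 1) (hj : j = i + 1) (hn : n = m + 1) (hi : i = h + 1) (hr : r = n + 1)
    (z : Cone k A M i n) (hz : coneD c hj hn z = 0) : ∃ w, coneD c hi hr w = z := by
  obtain rfl : h = i - 1 := by omega
  obtain rfl : m = n - 1 := by omega
  subst hj hr
  exact hM i n hin z hz

/-- The class of modules with acyclic cone is closed under cokernels of injective maps. -/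
theorem CapAcyclic.of_exact [CharZero k] {d : ℤ} {c : Chain k A} (hc : b c = 0)
    {ι : K →ₗ[A ⊗[k] Aᵐᵒᵖ] N} {ε : N →ₗ[A ⊗[k] Aᵐᵒᵖ] M} (hι : Function.Injective ι)
    (hε : Function.Surjective ε) (hex : Function.Exact ι ε) (hK : CapAcyclic K d c)
    (hN : CapAcyclic N d c) : CapAcyclic M d c := by
  have hsurj : ∀ i n, Function.Surjective (coneMap ε i n) := by
    intro i n ⟨f, z⟩
    -- A section linear over the field `k` lifts the values of a cochain; it need not respect the
    -- bimodule structures.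
    obtain ⟨σ, hσ⟩ := (ε.restrictScalars k).exists_rightInverse_of_surjective
      (LinearMap.range_eq_top.2 hε)
    obtain ⟨z', hz'⟩ := LinearMap.rTensor_surjective (Word k A n) (g := ε.restrictScalars k) hε z
    refine ⟨(MCochain.map σ f, z'), Prod.ext ?_ hz'⟩
    ext l
    exact LinearMap.congr_fun hσ (f.1 l)
  have hinj : ∀ i n, Function.Injective (coneMap ι i n) := by
    intro i n ⟨f, z⟩ ⟨f', z'⟩ h
    refine Prod.ext ?_ ?_
    · ext l
      exact hι (congrFun (congrArg Subtype.val (congrArg Prod.fst h)) l)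
    · exact Module.Flat.rTensor_preserves_injective_linearMap (M := Word k A n)
        (ι.restrictScalars k) hι (congrArg Prod.snd h)
  have hker : ∀ i n z, coneMap ε i n z = 0 → ∃ y, coneMap ι i n y = z := by
    intro i n ⟨f, z⟩ h
    have h1 : ∀ l, ∃ y, ι y = f.1 l := fun l => (hex _).1
      (congrFun (congrArg Subtype.val (congrArg Prod.fst h)) l)
    choose g hg using h1
    obtain ⟨y, hy⟩ := (rTensor_exact (Word k A n) (f := ι.restrictScalars k)
      (g := ε.restrictScalars k) hex hε z).1 (congrArg Prod.snd h)
    refine ⟨(⟨g, ?_, ?_, ?_⟩, y), Prod.ext (Subtype.ext (funext hg)) hy⟩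
    · intro s t r a a'
      apply hι
      rw [map_add, ← LinearMap.coe_restrictScalars k, map_smul, LinearMap.coe_restrictScalars, hg,
        hg, hg, f.2.1]
    · intro l hl
      apply hι
      rw [hg, map_zero, f.2.2.1 l hl]
    · intro l hl
      apply hι
      rw [hg, map_zero, f.2.2.2 l hl]
  intro i n hin z hz
  -- The chase in the short exact sequence of cones: lift the cycle to `N`; its differential comes
  -- from a cycle over `K`, hence from a boundary; correcting the lift by a primitive makes it a
  -- cycle, thus a boundary.
  obtain ⟨z', rfl⟩ := hsurj i n z
  rw [coneD_coneMap] at hz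
  obtain ⟨y, hy⟩ := hker _ _ _ hz
  have hy0 : coneD c (show i + 1 + 1 = i + 1 + 1 from rfl) (show n - 1 = (n - 1 - 1) + 1 by ring) y
      = 0 := by
    apply hinj
    rw [map_zero, ← coneD_coneMap, hy, coneD_coneD hc]
  obtain ⟨x, rfl⟩ := hK.exists (by omega) _ _ rfl (show n = n - 1 + 1 by ring) y hy0
  have h2 : coneD c (show i + 1 = i + 1 from rfl) (show n = n - 1 + 1 by ring)
      (z' - coneMap ι i n x) = 0 := by
    rw [map_sub, coneD_coneMap, hy, sub_self]
  obtain ⟨w, hw⟩ := hN i n hin _ h2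
  refine ⟨coneMap ε _ _ w, ?_⟩
  rw [coneD_coneMap, hw, map_sub, coneMap_comp, hex.linearMap_comp_eq_zero, coneMap_zero,
    sub_zero]

/-- The class of modules with acyclic cone contains the finitely generated projective modules if
it contains the free module of rank one. -/
theorem CapAcyclic.of_projective {d : ℤ} {c : Chain k A}
    (hS : CapAcyclic (A ⊗[k] Aᵐᵒᵖ) d c) [Module.Finite (A ⊗[k] Aᵐᵒᵖ) M]
    [Module.Projective (A ⊗[k] Aᵐᵒᵖ) M] : CapAcyclic M d c := by
  obtain ⟨r, p, s, -, -, hps⟩ := Module.Finite.exists_comp_eq_id_of_projective (A ⊗[k] Aᵐᵒᵖ) M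
  intro i n hin z hz
  -- The identity of `M` is a finite sum of maps that factor through the free module of rank one.
  have hid : ∑ j, (p ∘ₗ LinearMap.single (A ⊗[k] Aᵐᵒᵖ) (fun _ => A ⊗[k] Aᵐᵒᵖ) j) ∘ₗ
      (LinearMap.proj j ∘ₗ s) = LinearMap.id := by
    rw [← hps]
    ext m
    simp only [LinearMap.sum_apply, LinearMap.comp_apply, ← map_sum, LinearMap.proj_apply]
    congr 1
    exact LinearMap.sum_single_apply (fun _ => A ⊗[k] Aᵐᵒᵖ) (s m)
  have h1 : ∀ j, ∃ w : Cone k A (A ⊗[k] Aᵐᵒᵖ) (i - 1) (n + 1),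
      coneD c (show i = (i - 1) + 1 by ring) (show n + 1 = n + 1 from rfl) w
        = coneMap (LinearMap.proj j ∘ₗ s) i n z := fun j =>
    hS i n hin _ (by rw [coneD_coneMap, hz, map_zero])
  choose w hw using h1
  refine ⟨∑ j, coneMap (p ∘ₗ LinearMap.single (A ⊗[k] Aᵐᵒᵖ) (fun _ => A ⊗[k] Aᵐᵒᵖ) j) _ _ (w j), ?_⟩
  rw [map_sum]
  simp only [coneD_coneMap, hw, coneMap_comp]
  rw [← coneMap_sum, hid, coneMap_id]

theorem CapAcyclic.of_subsingleton {d : ℤ} {c : Chain k A} [Subsingleton M] :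
    CapAcyclic M d c := by
  intro i n hin z hz
  refine ⟨0, ?_⟩
  have h0 : ∀ x : M ⊗[k] Word k A n, x = 0 := fun x => by
    induction x using TensorProduct.induction_on with
    | zero => rfl
    | tmul m y => rw [Subsingleton.elim m 0, TensorProduct.zero_tmul]
    | add x y hx hy => rw [hx, hy, add_zero]
  refine Prod.ext ?_ ((h0 _).trans (h0 _).symm)
  ext l
  exact Subsingleton.elim _ _

/-- The class of modules with acyclic cone contains all modules with a finite resolution by
finitely generated projective modules if it contains the free module of rank one. -/
theorem CapAcyclic.of_resolution [CharZero k] {d : ℤ} {c : Chain k A} (hc : b c = 0)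
    (hS : CapAcyclic (A ⊗[k] Aᵐᵒᵖ) d c) (r : ℕ) {M : Type w} [AddCommGroup M] [Module k M]
    [Module (A ⊗[k] Aᵐᵒᵖ) M] [IsScalarTower k (A ⊗[k] Aᵐᵒᵖ) M] (P : ℕ → Type w)
    [∀ i, AddCommGroup (P i)] [∀ i, Module k (P i)] [∀ i, Module (A ⊗[k] Aᵐᵒᵖ) (P i)]
    [∀ i, IsScalarTower k (A ⊗[k] Aᵐᵒᵖ) (P i)] [∀ i, Module.Finite (A ⊗[k] Aᵐᵒᵖ) (P i)]
    [∀ i, Module.Projective (A ⊗[k] Aᵐᵒᵖ) (P i)] (δ : ∀ i, P (i + 1) →ₗ[A ⊗[k] Aᵐᵒᵖ] P i)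
    (ε : P 0 →ₗ[A ⊗[k] Aᵐᵒᵖ] M) (hP : ∀ i, r ≤ i → Subsingleton (P i))
    (hε : Function.Surjective ε) (h0 : Function.Exact (δ 0) ε)
    (hδ : ∀ i, Function.Exact (δ (i + 1)) (δ i)) : CapAcyclic M d c := by
  induction r generalizing M P with
  | zero =>
    have := hP 0 le_rfl
    have : Subsingleton M := hε.subsingleton
    exact CapAcyclic.of_subsingleton
  | succ r ih =>
    -- The truncated resolution resolves the first syzygy and is shorter by one.
    have hK : CapAcyclic (LinearMap.ker ε) d c := by
      refine ih (fun i => P (i + 1)) (fun i => δ (i + 1))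
        ((δ 0).codRestrict (LinearMap.ker ε) fun x => (h0 _).2 ⟨x, rfl⟩)
        (fun i hi => hP (i + 1) (by omega)) ?_ ?_ (fun i => hδ (i + 1))
      · rintro ⟨x, hx⟩
        obtain ⟨y, hy⟩ := (h0 x).1 hx
        exact ⟨y, Subtype.ext hy⟩
      · intro x
        rw [← hδ 0 x, Subtype.ext_iff]
        rfl
    exact CapAcyclic.of_exact hc (LinearMap.ker ε).injective_subtype hε
      (fun x => ⟨fun hx => ⟨⟨x, hx⟩, rfl⟩, by rintro ⟨y, rfl⟩; exact y.2⟩) hK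
      (CapAcyclic.of_projective hS)

end Cone

/-! ### A criterion for acyclicity of the cone -/

noncomputable section Augmentation

variable {k : Type u} {A : Type v} [Field k] [Ring A] [Algebra k A]
variable {M : Type*} [AddCommGroup M] [Module k M] [Module (A ⊗[k] Aᵐᵒᵖ) M]
  [IsScalarTower k (A ⊗[k] Aᵐᵒᵖ) M]
variable {Q : Type*} [AddCommGroup Q] [Module k Q]

/-- A criterion for the acyclicity of the cone, if the Hochschild homology of `M` is concentrated
in degree zero and the Hochschild cohomology in degree `d`. -/
theorem capAcyclic_of_augmentation {d : ℤ} {c : Chain k A} (hc : b c = 0)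
    (aug : M ⊗[k] Word k A 0 →ₗ[k] Q)
    (h1 : ∀ {h i j : ℤ} (hj : j = i + 1) (hi : i = h + 1), i ≠ d → ∀ f : MCochain k A M i,
      coD k hj f = 0 → ∃ g, coD k hi g = f)
    (h2 : ∀ {h j : ℤ} (hj : j = d + 1) (hi : d = h + 1) (f : MCochain k A M d),
      coD k hj f = 0 → aug (capL 0 f c) = 0 → ∃ g, coD k hi g = f)
    (h3 : ∀ {j : ℤ} (hj : j = d + 1) (a : Q), ∃ f : MCochain k A M d,
      coD k hj f = 0 ∧ aug (capL 0 f c) = a)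
    (ha : ∀ z : M ⊗[k] Word k A 1, aug (bM (zero_add (1 : ℤ)).symm z) = 0)
    (hb0 : ∀ z, aug z = 0 → ∃ e : M ⊗[k] Word k A 1, bM (zero_add (1 : ℤ)).symm e = z)
    (hb : ∀ {m n r : ℤ} (hn : n = m + 1) (hr : r = n + 1), n ≠ 0 → ∀ z : M ⊗[k] Word k A n,
      bM hn z = 0 → ∃ e, bM hr e = z) : CapAcyclic M d c := by
  suffices H : ∀ {h i j m n r : ℤ} (hin : i + n = d + 1) (hj : j = i + 1) (hn : n = m + 1)
      (hi : i = h + 1) (hr : r = n + 1) (z : Cone k A M i n), coneD c hj hn z = 0 →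
      ∃ w, coneD c hi hr w = z from fun i n hin z hz => H hin _ _ _ _ z hz
  intro h i j m n r hin hj hn hi hr ⟨f, y⟩ hz
  rw [coneD_apply, Prod.mk_eq_zero] at hz
  dsimp only at hz
  obtain ⟨hf, hy⟩ := hz
  rw [sub_eq_zero] at hy
  -- In degree `d` the cone equation says that `f ∩ c` is a boundary, so its augmentation vanishes.
  have hg : ∃ g, coD k hi g = f := by
    by_cases hid : i = d
    · subst hid
      obtain rfl : m = 0 := by omega
      obtain rfl : n = 1 := by omega
      refine h2 hj hi f hf ?_
      rw [hy, map_smul, ha, smul_zero]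
    · exact h1 hj hi hid f hf
  obtain ⟨g, hg⟩ := hg
  have hcap := capL_b hi hn g c
  have hbz : bM hn (y - capL n g c) = 0 := by
    have e : sg k i = -sg k h := by rw [hi, sg_add, sg_one, mul_neg_one]
    rw [hc, map_zero, hg, hy, e] at hcap
    rw [map_sub, sub_eq_zero]
    refine smul_right_injective _ (sg_ne_zero (k := k) h) ?_
    change sg k h • bM hn y = sg k h • bM hn (capL n g c)
    rw [← sub_eq_zero, ← neg_eq_zero, hcap]
    module
  -- The cycle `y - g ∩ c` bounds unless `n = 0`. In that case its class is hit by a cocycle `g'` of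
  -- degree `d`, by which `g` is corrected.
  suffices ∃ g' e, coD k hi g' = 0 ∧ capL n g' c - bM hr e = y - capL n g c by
    obtain ⟨g', e, hg', he⟩ := this
    refine ⟨(g + g', sg k h • e), ?_⟩
    rw [coneD_apply]
    refine Prod.ext ?_ ?_
    · change coD k hi (g + g') = f
      rw [map_add, hg, hg', add_zero]
    · change capM c n h (g + g') - sg k h • bM hr (sg k h • e) = y
      rw [map_smul, smul_smul, sg_mul_self, one_smul, map_add, capM_apply, capM_apply,
        add_sub_assoc, he, add_sub_cancel]
  by_cases h0 : n = 0
  · subst h0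
    obtain rfl : h = d := by omega
    obtain rfl : r = 1 := by omega
    obtain ⟨g', hg', hg''⟩ := h3 hi (aug (y - capL 0 g c))
    obtain ⟨e, he⟩ := hb0 (capL 0 g' c - (y - capL 0 g c)) (by rw [map_sub, hg'', sub_self])
    refine ⟨g', e, hg', ?_⟩
    rw [he, sub_sub_cancel]
  · obtain ⟨e, he⟩ := hb hn hr h0 _ hbz
    refine ⟨0, -e, map_zero _, ?_⟩
    have e0 : capL n (0 : MCochain k A M h) c = 0 := map_zero (capM c n h)
    rw [map_neg, he, e0, zero_sub, neg_neg]

end Augmentation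

/-! ### The cone for the free bimodule of rank one -/

noncomputable section FreeCoefficients

variable {k : Type u} {A : Type v} [Field k] [Ring A] [Algebra k A]
variable {E : Type*} [AddCommGroup E] [Module k E] [Module (A ⊗[k] Aᵐᵒᵖ) E]
  [IsScalarTower k (A ⊗[k] Aᵐᵒᵖ) E]

/-- The bimodule structure on `E` is the outer structure on `A ⊗ A`. -/
structure IsOuter (e : A ⊗[k] A ≃ₗ[k] E) : Prop where
  lft : ∀ a x y, lftM k A E a (e (x ⊗ₜ y)) = e ((a * x) ⊗ₜ y)
  rgt : ∀ a x y, rgtM k A E a (e (x ⊗ₜ y)) = e (x ⊗ₜ (y * a))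

variable {e : A ⊗[k] A ≃ₗ[k] E}

theorem coD_equiv (he : IsOuter e) {i j : ℤ} (h : j = i + 1) (Φ : MCochain k A (A ⊗[k] A) i) :
    coD k h (MCochain.map e.toLinearMap Φ) = MCochain.map e.toLinearMap (envDiff k A h Φ) := by
  ext l
  refine (map_hochFun e.toLinearMap (fun a m => ?_) (fun a m => ?_) Φ.1 l).symm
  · induction m using TensorProduct.induction_on with
    | zero => simp
    | tmul x y => simp [he.lft]
    | add x y hx hy => simp only [map_add, hx, hy]
  · induction m using TensorProduct.induction_on with
    | zero => simp
    | tmul x y => simp [he.rgt]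
    | add x y hx hy => simp only [map_add, hx, hy]

theorem exists_map_equiv (e : A ⊗[k] A ≃ₗ[k] E) {i : ℤ} (f : MCochain k A E i) :
    ∃ Φ, MCochain.map e.toLinearMap Φ = f :=
  ⟨MCochain.map e.symm.toLinearMap f, by ext l; exact e.apply_symm_apply (f.1 l)⟩

theorem map_equiv_injective (e : A ⊗[k] A ≃ₗ[k] E) {i : ℤ} :
    Function.Injective (MCochain.map (k := k) (A := A) e.toLinearMap (n := i)) := fun Φ Ψ h => by
  ext l
  exact e.injective (congrFun (congrArg Subtype.val h) l)

variable (k A) in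
/-- Words of length zero are scalars. -/
def wordZero : Word k A 0 →ₗ[k] k :=
  wordLift ⟨fun l => if l = [] then 1 else 0, fun s t c y z => by simp,
    fun l hl => if_neg (List.ne_nil_of_mem hl), fun l hl => if_neg fun h => hl (by simp [h])⟩

theorem wordZero_word (l : List A) :
    wordZero k A ((word k A 0).1 l) = if l = [] then 1 else 0 := wordLift_word _ _

/-- The augmentation `x ⊗ y ↦ y x` of the complex computing the Hochschild homology of the
enveloping algebra. -/
def augment (e : A ⊗[k] A ≃ₗ[k] E) : E ⊗[k] Word k A 0 →ₗ[k] A :=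
  (TensorProduct.rid k A).toLinearMap ∘ₗ
    TensorProduct.map (sandwich 1 ∘ₗ e.symm.toLinearMap) (wordZero k A)

theorem augment_tmul (m : A ⊗[k] A) (l : List A) :
    augment e (e m ⊗ₜ (word k A 0).1 l) = if l = [] then sandwich 1 m else 0 := by
  rw [augment, LinearMap.comp_apply, TensorProduct.map_tmul, wordZero_word]
  split_ifs <;> simp

theorem sandwich_tmul (a x y : A) : sandwich (k := k) a (x ⊗ₜ y) = y * a * x := by
  simp [sandwich]

theorem sandwich_lftM (he : IsOuter e) (a : A) (m : A ⊗[k] A) :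
    sandwich 1 (e.symm (lftM k A E a (e m))) = sandwich a m := by
  induction m using TensorProduct.induction_on with
  | zero => simp
  | tmul x y => simp [he.lft, sandwich_tmul, mul_assoc]
  | add x y hx hy => simp only [map_add, hx, hy]

/-- Only the splitting with empty second part survives in degree zero, and there `y (a x) = y a x`.
This identifies the map in the definition of `Nondegenerate` with the augmented cap product. -/
theorem augment_capL (he : IsOuter e) {i : ℤ} (Φ : MCochain k A (A ⊗[k] A) i) (c : Chain k A) :
    augment e (capL 0 (MCochain.map e.toLinearMap Φ) c) = evalEnv Φ c := by
  have : augment e ∘ₗ capL 0 (MCochain.map e.toLinearMap Φ) = evalEnv Φ :=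
    chain_hom_ext_cons fun a l => by
      have h : ∀ u v, augment e (lftM k A E a ((MCochain.map e.toLinearMap Φ).1 u) ⊗ₜ
          (word k A 0).1 v) = if v = [] then sandwich a (Φ.1 u) else 0 := by
        intro u v
        rw [← sandwich_lftM he, ← augment_tmul (e := e), e.apply_symm_apply]
        rfl
      rw [LinearMap.comp_apply, capL_cons_spl, map_spl]
      simp only [h]
      rw [spl_eq_right_nil _ fun u v hv => if_neg hv, if_pos rfl, evalEnv, chainLift_chain]
  exact LinearMap.congr_fun this c

theorem bM_singleton {n m : ℤ} (h : n = m + 1) (x : E) (a : A) :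
    bM h (x ⊗ₜ[k] (word k A n).1 [a])
      = rgtM k A E a x ⊗ₜ (word k A m).1 [] - lftM k A E a x ⊗ₜ (word k A m).1 [] := by
  rw [bM_tmul, hochFun]
  simp [homAct_apply, theta_apply, sub_eq_add_neg]

theorem augment_bM (he : IsOuter e) (h : (1 : ℤ) = 0 + 1) (z : E ⊗[k] Word k A 1) :
    augment e (bM h z) = 0 := by
  have : augment e ∘ₗ bM (k := k) (A := A) (M := E) h = 0 := tensor_word_hom_ext fun m l => by
    rw [LinearMap.comp_apply, LinearMap.zero_apply]
    by_cases hl : (l.length : ℤ) = 1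
    · obtain ⟨a, rfl⟩ := List.length_eq_one_iff.1 (by exact_mod_cast hl)
      obtain ⟨m, rfl⟩ := e.surjective m
      rw [bM_singleton, map_sub]
      induction m using TensorProduct.induction_on with
      | zero => simp
      | tmul x y => simp [he.lft, he.rgt, augment_tmul, sandwich_tmul, mul_assoc]
      | add x y hx hy =>
        simp only [map_add, TensorProduct.add_tmul] at hx hy ⊢
        rw [add_sub_add_comm, hx, hy, add_zero]
    · rw [(word k A 1).2.2.2 l hl, TensorProduct.tmul_zero, map_zero, map_zero]
  exact LinearMap.congr_fun this z

/-- The map `x ⊗ y ↦ (x ⊗ 1) ⊗ (y, a₁, …, aₙ)`. -/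
def contractFun (e : A ⊗[k] A ≃ₗ[k] E) (n : ℤ) (l : List A) : E →ₗ[k] E ⊗[k] Word k A n :=
  TensorProduct.lift (LinearMap.mk₂ k
    (fun x y => e (x ⊗ₜ[k] 1) ⊗ₜ[k] (word k A n).1 (y :: l))
    (by intros; simp [TensorProduct.add_tmul])
    (by intros; simp [← TensorProduct.smul_tmul'])
    (by intro x y z
        have := (word k A n).2.1.add_mid [] l y z
        simp only [List.nil_append] at this
        simp [this, TensorProduct.tmul_add])
    (by intro c x y
        have := (word k A n).2.1.smul_mid [] l c y
        simp only [List.nil_append] at this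
        simp [this])) ∘ₗ e.symm.toLinearMap

theorem contractFun_tmul (n : ℤ) (l : List A) (x y : A) :
    contractFun e n l (e (x ⊗ₜ y)) = e (x ⊗ₜ[k] 1) ⊗ₜ[k] (word k A n).1 (y :: l) := by
  simp [contractFun]

/-- Linear maps on `E` are determined by their values on elementary tensors. -/
theorem outer_hom_ext (e : A ⊗[k] A ≃ₗ[k] E) {W : Type*} [AddCommGroup W] [Module k W]
    {φ ψ : E →ₗ[k] W} (h : ∀ x y, φ (e (x ⊗ₜ y)) = ψ (e (x ⊗ₜ y))) : φ = ψ := by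
  have : φ ∘ₗ e.toLinearMap = ψ ∘ₗ e.toLinearMap := TensorProduct.ext' h
  ext m
  obtain ⟨m, rfl⟩ := e.surjective m
  exact LinearMap.congr_fun this m

theorem slotLinear_contractFun (e : A ⊗[k] A ≃ₗ[k] E) (n : ℤ) :
    SlotLinear k (contractFun e n) := by
  intro s t c a a'
  refine outer_hom_ext e fun x y => ?_
  have := (word k A n).2.1 (y :: s) t c a a'
  simp only [List.cons_append] at this
  rw [LinearMap.add_apply, LinearMap.smul_apply, contractFun_tmul, contractFun_tmul,
    contractFun_tmul, this, TensorProduct.tmul_add, TensorProduct.tmul_smul]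

/-- The contraction of the complex computing the Hochschild homology of the enveloping algebra. -/
def contraction (e : A ⊗[k] A ≃ₗ[k] E) {n r : ℤ} (h : r = n + 1) :
    E ⊗[k] Word k A n →ₗ[k] E ⊗[k] Word k A r :=
  TensorProduct.lift (wordLift (n := n) ⟨contractFun e r, slotLinear_contractFun e r,
    fun l hl => outer_hom_ext e fun x y => by
      rw [contractFun_tmul, (word k A r).2.2.1 _ (by simp [hl]), TensorProduct.tmul_zero]; rfl,
    fun l hl => outer_hom_ext e fun x y => by
      rw [contractFun_tmul, (word k A r).2.2.2 _ (by simp; omega), TensorProduct.tmul_zero]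
      rfl⟩).flip

theorem contraction_tmul (e : A ⊗[k] A ≃ₗ[k] E) {n r : ℤ} (h : r = n + 1) (m : E) (l : List A) :
    contraction e h (m ⊗ₜ (word k A n).1 l) = contractFun e r l m := by
  rw [contraction, TensorProduct.lift.tmul, LinearMap.flip_apply, wordLift_word]

theorem der_apply {M W : Type*} [AddCommGroup M] [Module k M] [AddCommGroup W] [Module k W]
    (x : List A → A) (p : ℤ) (θ : List A → M →ₗ[k] W) (l : List A) (m : M) :
    der k x p θ l m = der k x p (fun l => θ l m) l :=
  map_der (LinearMap.applyₗ m) x p θ l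

theorem hochR_contractFun (he : IsOuter e) (n : ℤ) (x y a : A) (l : List A) :
    hochR k (homAct (lftM k A E)) (theta k A E n).1 (y :: a :: l) (e (x ⊗ₜ 1))
      = -hochR k (homAct (lftM k A E)) (contractFun e n) (a :: l) (e (x ⊗ₜ y)) := by
  obtain ⟨l', c, h⟩ : ∃ l' c, a :: l = l' ++ [c] :=
    ⟨(a :: l).dropLast, (a :: l).getLast (List.cons_ne_nil _ _),
      (List.dropLast_append_getLast _).symm⟩
  rw [h, hochR_concat, ← List.cons_append, hochR_concat, LinearMap.smul_apply,
    LinearMap.smul_apply, homAct_apply, homAct_apply, he.lft, he.lft, contractFun_tmul,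
    theta_apply, List.length_cons, Nat.cast_add, Nat.cast_one, sg_add, sg_add, sg_one]
  module

/-- An extra degeneracy: the term in which the new first letter `y` acts on `x ⊗ 1` from the right
gives back the chain, and all other terms cancel. -/
theorem bM_contraction_tmul (he : IsOuter e) {m n r : ℤ} (hn : n = m + 1) (hr : r = n + 1)
    (x y a : A) (l : List A) :
    bM hr (contraction e hr (e (x ⊗ₜ y) ⊗ₜ (word k A n).1 (a :: l)))
      + contraction e hn (bM hn (e (x ⊗ₜ y) ⊗ₜ (word k A n).1 (a :: l)))
      = e (x ⊗ₜ y) ⊗ₜ (word k A n).1 (a :: l) := by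
  rw [contraction_tmul, contractFun_tmul, bM_tmul, bM_tmul, comp_hochFun]
  have e1 : (fun l => contraction e hn ∘ₗ (theta k A E m).1 l) = contractFun e n :=
    funext fun l => LinearMap.ext fun m => contraction_tmul e hn m l
  have s2 : SlotLinear k (fun l => (theta k A E n).1 l (e (x ⊗ₜ 1))) := by
    intro s t c a a'
    beta_reduce
    rw [(theta k A E n).2.1 s t c a a']
    rfl
  rw [e1, hochFun_eq (slotLinear_contractFun e n), hochFun_eq (theta k A E n).2.1]
  simp only [LinearMap.add_apply, LinearMap.sub_apply, der_apply]
  rw [der_mulList_cons_cons s2, hochR_contractFun he]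
  simp only [hochL, homAct_apply, he.rgt, one_mul, contractFun_tmul, theta_apply]
  abel

theorem bM_contraction (he : IsOuter e) {m n r : ℤ} (hn : n = m + 1) (hr : r = n + 1) (h0 : n ≠ 0)
    (z : E ⊗[k] Word k A n) :
    bM hr (contraction e hr z) + contraction e hn (bM hn z) = z := by
  have : bM hr ∘ₗ contraction e hr + contraction e hn ∘ₗ bM hn = LinearMap.id := by
    refine TensorProduct.ext (outer_hom_ext e fun x y => word_hom_ext fun l => ?_)
    change bM hr (contraction e hr (e (x ⊗ₜ y) ⊗ₜ (word k A n).1 l))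
      + contraction e hn (bM hn (e (x ⊗ₜ y) ⊗ₜ (word k A n).1 l)) = _ ⊗ₜ (word k A n).1 l
    by_cases hl : (l.length : ℤ) = n
    · rcases l with _ | ⟨a, l⟩
      · exact absurd (by simpa using hl.symm) h0
      · exact bM_contraction_tmul he hn hr x y a l
    · rw [(word k A n).2.2.2 l hl]; simp
  exact LinearMap.congr_fun this z

/-- In degree zero nothing cancels the term `y x ⊗ 1` of the left action, and this is the
augmentation. So the homology in degree zero is `A`. -/
theorem bM_contraction_zero (he : IsOuter e) {r : ℤ} (hr : r = 0 + 1) (z : E ⊗[k] Word k A 0) :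
    bM hr (contraction e hr z)
      = z - e (augment e z ⊗ₜ[k] 1) ⊗ₜ[k] (word k A 0).1 [] := by
  have : bM hr ∘ₗ contraction e hr = LinearMap.id -
      (TensorProduct.mk k E (Word k A 0)).flip ((word k A 0).1 []) ∘ₗ e.toLinearMap ∘ₗ
        (TensorProduct.mk k A A).flip 1 ∘ₗ augment e := by
    refine TensorProduct.ext (outer_hom_ext e fun x y => word_hom_ext fun l => ?_)
    change bM hr (contraction e hr (e (x ⊗ₜ y) ⊗ₜ (word k A 0).1 l)) = _ ⊗ₜ (word k A 0).1 l
      - e (augment e (e (x ⊗ₜ y) ⊗ₜ (word k A 0).1 l) ⊗ₜ[k] 1) ⊗ₜ[k] (word k A 0).1 []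
    by_cases hl : l = []
    · subst hl
      rw [augment_tmul, if_pos rfl, contraction_tmul, contractFun_tmul, bM_singleton, he.lft,
        he.rgt, sandwich_tmul, one_mul, mul_one]
    · rw [(word k A 0).2.2.2 l (by simpa using hl)]; simp
  exact LinearMap.congr_fun this z

/-- The cone is acyclic for the free module of rank one if the cycle is nondegenerate. -/
theorem capAcyclic_outer (he : IsOuter e) {d : ℕ} {c : chainDeg k A d} (hc : b c.1 = 0)
    (h : Nondegenerate d c) : CapAcyclic E d c.1 := by
  obtain ⟨h1, h2, h3⟩ := h
  have hΦ : ∀ {i j : ℤ} (h : j = i + 1) (Φ : MCochain k A (A ⊗[k] A) i),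
      coD k h (MCochain.map e.toLinearMap Φ) = 0 → envDiff k A h Φ = 0 := by
    intro i j h Φ hf
    apply map_equiv_injective e
    rw [← coD_equiv he, hf, map_zero]
  refine capAcyclic_of_augmentation hc (augment e) ?_ ?_ ?_ (augment_bM he _) ?_ ?_
  · intro h i j hj hi hid f hf
    obtain ⟨Φ, rfl⟩ := exists_map_equiv e f
    obtain rfl : h = i - 1 := by omega
    subst hj
    obtain ⟨Ψ, rfl⟩ := h1 i hid Φ (hΦ _ _ hf)
    exact ⟨_, coD_equiv he _ Ψ⟩
  · intro h j hj hi f hf hev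
    obtain ⟨Φ, rfl⟩ := exists_map_equiv e f
    obtain rfl : h = d - 1 := by omega
    subst hj
    rw [augment_capL he] at hev
    obtain ⟨Ψ, rfl⟩ := h2 Φ (hΦ _ _ hf) hev
    exact ⟨_, coD_equiv he _ Ψ⟩
  · intro j hj a
    subst hj
    obtain ⟨Ψ, h, h'⟩ := h3 a
    refine ⟨MCochain.map e.toLinearMap Ψ, ?_, ?_⟩
    · rw [coD_equiv he, h, map_zero]
    · rw [augment_capL he, h']
  · intro z hz
    refine ⟨contraction e (zero_add (1 : ℤ)).symm z, ?_⟩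
    rw [bM_contraction_zero he, hz]
    simp
  · intro m n r hn hr h0 z hz
    refine ⟨contraction e hr z, ?_⟩
    have := bM_contraction he hn hr h0 z
    rwa [hz, map_zero, add_zero] at this

variable (k A) in
/-- The identification of `A ⊗ A` with the enveloping algebra. -/
def envEquiv : A ⊗[k] A ≃ₗ[k] A ⊗[k] Aᵐᵒᵖ :=
  TensorProduct.congr (LinearEquiv.refl k A) (MulOpposite.opLinearEquiv k)

theorem isOuter_envEquiv : IsOuter (envEquiv k A) where
  lft a x y := by simp [lftM_apply, envEquiv]
  rgt a x y := by simp [rgtM_apply, envEquiv]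

end FreeCoefficients

/-! ### Bijectivity of the cap product for smooth algebras -/

noncomputable section CapProduct

variable {k : Type u} {A : Type v} [Field k] [Ring A] [Algebra k A]

/-- The component in degree `n` of a normalized chain, as an element of `A ⊗ (A / k)^{⊗ n}`. -/
def toWord (n : ℤ) : Chain k A →ₗ[k] A ⊗[k] Word k A n :=
  chainLift (fun l => match l with
    | [] => 0
    | a :: l => a ⊗ₜ (word k A n).1 l)
    { nil := rfl
      slot := by
        intro s t c y z
        cases s with
        | nil => simp [TensorProduct.add_tmul, TensorProduct.smul_tmul']
        | cons a s => simp [(word k A n).2.1 s t c y z, TensorProduct.tmul_add]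
      one := by
        intro a t h
        simp [(word k A n).2.2.1 t h] }

theorem toWord_cons (n : ℤ) (a : A) (l : List A) :
    toWord n (chain k (a :: l)) = a ⊗ₜ (word k A n).1 l := by
  rw [toWord, chainLift_chain]

variable (k A) in
/-- `headMap` restricted to lists of length `n`, as a normalized cochain. -/
def headCochain (n : ℤ) : MCochain k A (A →ₗ[k] Chain k A) n :=
  ⟨fun l => if (l.length : ℤ) = n then headMap l else 0,
    SlotLinear.ite_length (fun r : ℕ => (r : ℤ) = n)
      (fun s t c y z => LinearMap.ext fun a => slotLinear_chain k (a :: s) t c y z)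
      (fun s t c y z => by simp),
    fun l hl => by
      beta_reduce
      split_ifs
      · exact LinearMap.ext fun a => chain_one k hl
      · rfl,
    fun l hl => if_neg hl⟩

/-- The inclusion of `A ⊗ (A / k)^{⊗ n}` into the normalized chains. -/
def ofWord (n : ℤ) : A ⊗[k] Word k A n →ₗ[k] Chain k A :=
  TensorProduct.lift (wordLift (headCochain k A n)).flip

theorem ofWord_tmul (n : ℤ) (a : A) (l : List A) :
    ofWord n (a ⊗ₜ (word k A n).1 l) = if (l.length : ℤ) = n then chain k (a :: l) else 0 := by
  rw [ofWord, TensorProduct.lift.tmul, LinearMap.flip_apply, wordLift_word]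
  change (if (l.length : ℤ) = n then headMap l else 0 : A →ₗ[k] Chain k A) a = _
  split_ifs <;> rfl

theorem toWord_ofWord (n : ℤ) (z : A ⊗[k] Word k A n) : toWord n (ofWord n z) = z := by
  have : toWord n ∘ₗ ofWord n = (LinearMap.id : A ⊗[k] Word k A n →ₗ[k] _) :=
    tensor_word_hom_ext fun a l => by
      rw [LinearMap.comp_apply, ofWord_tmul, LinearMap.id_apply]
      split_ifs with h
      · rw [toWord_cons]
      · rw [(word k A n).2.2.2 l h, TensorProduct.tmul_zero, map_zero]
  exact LinearMap.congr_fun this z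

theorem ofWord_mem (n : ℤ) (z : A ⊗[k] Word k A n) : ofWord n z ∈ chainDeg k A n := by
  have : (chainDeg k A n).mkQ ∘ₗ ofWord n = (0 : A ⊗[k] Word k A n →ₗ[k] _) :=
    tensor_word_hom_ext fun a l => by
      rw [LinearMap.comp_apply, ofWord_tmul, LinearMap.zero_apply, Submodule.mkQ_apply,
        Submodule.Quotient.mk_eq_zero]
      split_ifs with h
      · exact chain_mem (by simp [h])
      · exact Submodule.zero_mem _
  exact (Submodule.Quotient.mk_eq_zero _).1 (LinearMap.congr_fun this z)

theorem ofWord_toWord {n : ℤ} {c : Chain k A} (hc : c ∈ chainDeg k A n) :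
    ofWord n (toWord n c) = c := by
  induction hc using Submodule.span_induction with
  | mem c h =>
    obtain ⟨l, hl, rfl⟩ := h
    rcases l with _ | ⟨a, l⟩
    · rw [chain_nil, map_zero, map_zero]
    · rw [toWord_cons, ofWord_tmul, if_pos (by simpa using hl)]
  | zero => simp
  | add x y _ _ hx hy => rw [map_add, map_add, hx, hy]
  | smul r x _ hx => rw [map_smul, map_smul, hx]

section Bimodule

variable [Module (A ⊗[k] Aᵐᵒᵖ) A] [IsScalarTower k (A ⊗[k] Aᵐᵒᵖ) A]

theorem capL_eq_toWord (hl : lftM k A A = LinearMap.mul k A) (n : ℤ) {p : ℤ} (x : Cochain k A p)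
    (c : Chain k A) : capL n x c = toWord n (contr x c) := by
  have : capL n x = toWord n ∘ₗ contr x := chain_hom_ext_cons fun a l => by
    rw [LinearMap.comp_apply, contr_cons_spl, map_spl, capL_cons_spl]
    simp only [toWord_cons, hl, LinearMap.mul_apply']
  exact LinearMap.congr_fun this c

theorem toWord_b (hl : lftM k A A = LinearMap.mul k A) (hr : rgtM k A A = (LinearMap.mul k A).flip)
    {n m : ℤ} (h : n = m + 1) (c : Chain k A) : toWord m (b c) = bM h (toWord n c) := by
  have : toWord m ∘ₗ b = bM (k := k) (A := A) (M := A) h ∘ₗ toWord n :=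
    chain_hom_ext_cons fun a l => by
      rw [LinearMap.comp_apply, LinearMap.comp_apply, toWord_cons, bM_tmul, b_eq_hochFun,
        comp_hochFun, hl, hr]
      congr 2
      exact funext fun l => LinearMap.ext fun a => toWord_cons m a l
  exact LinearMap.congr_fun this c

theorem cochainD_eq_coD (hl : lftM k A A = LinearMap.mul k A)
    (hr : rgtM k A A = (LinearMap.mul k A).flip) {p q : ℤ} (h : q = p + 1) (x : Cochain k A p) :
    cochainD h x = sg k (p + 1) • coD k (by omega) x := by
  ext l
  change sg k (p + 1) • hochFun _ _ x.1 l = sg k (p + 1) • hochFun _ _ x.1 l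
  rw [hl, hr]

/-- A cycle `y` gives the cone cycle `(0, y)`. A primitive `(f, e)` consists of a cocycle `f` and a
chain `e` that bounds the difference of `f ∩ c` and `y` up to sign. -/
theorem exists_contr_eq (hl : lftM k A A = LinearMap.mul k A)
    (hr : rgtM k A A = (LinearMap.mul k A).flip) {d : ℤ} {c : Chain k A}
    (hcd : c ∈ chainDeg k A d) (hac : CapAcyclic A d c) {p q n m : ℤ} (hq : q = p + 1)
    (hn : p + 1 + n = d) (hm : m = n + 1) {y : Chain k A} (hy : y ∈ chainDeg k A n)
    (hby : b y = 0) :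
    ∃ x : Cochain k A p, cochainD hq x = 0 ∧ ∃ w ∈ chainDeg k A m, contr x c = y + b w := by
  obtain ⟨⟨f, e⟩, hfe⟩ := hac.exists (i := p + 1 + 1) (n := n) (by omega) (h := p + 1)
    (j := p + 1 + 1 + 1) (m := n - 1) (r := m) rfl (by omega) rfl hm (0, toWord n y) (by
      rw [coneD_apply, map_zero]
      have e0 : capL (n - 1) (0 : MCochain k A A (p + 1 + 1)) c = 0 :=
        map_zero (capM c (n - 1) (p + 1 + 1))
      rw [e0, ← toWord_b hl hr, hby, map_zero, smul_zero, sub_zero]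
      rfl)
  rw [coneD_apply, Prod.mk.injEq] at hfe
  dsimp only at hfe
  obtain ⟨h1, h2⟩ := hfe
  refine ⟨f, ?_, sg k (p + 1) • ofWord m e, Submodule.smul_mem _ _ (ofWord_mem m e), ?_⟩
  · rw [cochainD_eq_coD hl hr, smul_eq_zero_iff_right (sg_ne_zero _)]
    subst hq
    exact h1
  · have h3 : contr f c ∈ chainDeg k A n := contr_mem (by omega) f c hcd
    have h4 : b (ofWord m e) ∈ chainDeg k A n := b_mem hm _ (ofWord_mem m e)
    rw [capL_eq_toWord hl n (p := p) f, ← toWord_ofWord m e, ← toWord_b hl hr hm, sub_eq_iff_eq_add] at h2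
    have h5 := congrArg (ofWord n) h2
    rwa [map_add, map_smul, ofWord_toWord h3, ofWord_toWord h4, ofWord_toWord hy,
      ← map_smul] at h5

/-- If `i_x c = b w`, then `(x, ± w)` is a cone cycle, and the first component of a primitive bounds
`x`, up to a sign. The chain `w` need not be homogeneous, as `toWord m` keeps only its relevant
component. -/
theorem exists_cochainD_eq (hl : lftM k A A = LinearMap.mul k A)
    (hr : rgtM k A A = (LinearMap.mul k A).flip) {d : ℤ} {c : Chain k A}
    (hac : CapAcyclic A d c) {p q r n m : ℤ} (hq : q = p + 1) (hr' : p = r + 1)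
    (hn : p + 1 + n = d) (hm : m = n + 1) {x : Cochain k A p} (hx : cochainD hq x = 0)
    {w : Chain k A} (hw : contr x c = b w) :
    ∃ x' : Cochain k A r, cochainD hr' x' = x := by
  rw [cochainD_eq_coD hl hr, smul_eq_zero_iff_right (sg_ne_zero _)] at hx
  obtain ⟨⟨f, e⟩, hfe⟩ := hac.exists (i := p + 1) (n := m) (by omega) (h := r + 1)
    (j := q + 1) (m := n) (r := m + 1) (by omega) hm (by omega) rfl
    (x, sg k (p + 1) • toWord m w) (by
      rw [coneD_apply]
      refine Prod.ext hx ?_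
      change capL n x c - sg k (p + 1) • bM hm (sg k (p + 1) • toWord m w) = 0
      rw [map_smul, smul_smul, sg_mul_self, one_smul, ← toWord_b hl hr, capL_eq_toWord hl n,
        hw, sub_self])
  rw [coneD_apply, Prod.mk.injEq] at hfe
  refine ⟨sg k (r + 1) • f, ?_⟩
  rw [map_smul, cochainD_eq_coD hl hr, smul_smul, sg_mul_self, one_smul]
  exact hfe.1

end Bimodule

section Smooth

variable (k A) in
/-- The cap product with a nondegenerate cycle of a homologically smooth algebra is an
isomorphism: the form for cycles and boundaries. -/
structure CapIso (d : ℤ) (c : Chain k A) : Prop where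
  surj : ∀ {p q n m : ℤ} (hq : q = p + 1), p + 1 + n = d → m = n + 1 →
    ∀ y ∈ chainDeg k A n, b y = 0 →
    ∃ x : Cochain k A p, cochainD hq x = 0 ∧ ∃ w ∈ chainDeg k A m, contr x c = y + b w
  inj : ∀ {p q r : ℤ} (hq : q = p + 1) (hr : p = r + 1) (x : Cochain k A p), cochainD hq x = 0 →
    ∀ w, contr x c = b w → ∃ x' : Cochain k A r, cochainD hr x' = x

theorem capIso_of_nondegenerate [CharZero k] (hA : HomologicallySmooth k A) {d : ℕ}
    {c : chainDeg k A d} (hc : b c.1 = 0) (h : Nondegenerate d c) : CapIso k A d c.1 := by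
  let _ : Module (A ⊗[k] Aᵐᵒᵖ) A := instModuleTensorProductMop k A
  have smul_def : ∀ (a : A) (a' : Aᵐᵒᵖ) (m : A), (a ⊗ₜ[k] a') • m = a • a' • m :=
    fun a a' m => TensorProduct.Algebra.smul_def a a' m
  have : IsScalarTower k (A ⊗[k] Aᵐᵒᵖ) A := ⟨fun r s m => by
    induction s using TensorProduct.induction_on with
    | zero =>
      have z : (0 : A ⊗[k] Aᵐᵒᵖ) • m = 0 := by
        rw [← TensorProduct.zero_tmul A (0 : Aᵐᵒᵖ), smul_def, zero_smul]
      rw [smul_zero]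
      exact z.trans ((congrArg (r • ·) z).trans (smul_zero r)).symm
    | tmul x y => rw [TensorProduct.smul_tmul', smul_def, smul_def, smul_assoc]
    | add x y hx hy => rw [smul_add, add_smul, add_smul, hx, hy, smul_add]⟩
  have hl : lftM k A A = LinearMap.mul k A := by
    ext a m
    rw [lftM_apply, smul_def, one_smul, smul_eq_mul]
    rfl
  have hr : rgtM k A A = (LinearMap.mul k A).flip := by
    ext a m
    rw [rgtM_apply, smul_def, one_smul, op_smul_eq_mul]
    rfl
  have hac : CapAcyclic A d c.1 := by
    obtain ⟨P, δ, ε, N, hP, hN, hε, h0, hδ⟩ := hA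
    -- The terms of the resolution are modules over the enveloping algebra only; `k` acts on them
    -- through it.
    let _ : ∀ i, Module k (P i) := fun i => Module.compHom (P i) (algebraMap k (A ⊗[k] Aᵐᵒᵖ))
    have : ∀ i, IsScalarTower k (A ⊗[k] Aᵐᵒᵖ) (P i) := fun i => ⟨fun r s m =>
      (congrArg (· • m) (Algebra.smul_def r s)).trans (mul_smul (algebraMap k _ r) s m)⟩
    have := fun i => (hP i).1
    have := fun i => (hP i).2
    exact CapAcyclic.of_resolution hc (capAcyclic_outer isOuter_envEquiv hc h) (N + 1)
      (fun i => P i) δ ε (fun i hi => hN i (by omega)) hε h0 hδ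
  exact ⟨fun hq hn hm y hy hby => exists_contr_eq hl hr c.2 hac hq hn hm hy hby,
    fun {p q r} hq hr' x hx w hw =>
      exists_cochainD_eq hl hr hac hq hr' (n := d - (p + 1)) (by omega) rfl hx hw⟩

end Smooth

end CapProduct

/-! ### Linearity and degrees of the operators -/

section Linearity

variable {k : Type u} {A : Type v} [Field k] [Ring A] [Algebra k A] {p q : ℤ}

theorem spl_mem {α M : Type*} [AddCommGroup M] [Module k M] (S : Submodule k M)
    {f : List α → List α → M} {l : List α} (h : ∀ u v, u ++ v = l → f u v ∈ S) : spl f l ∈ S := by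
  rw [← Submodule.Quotient.mk_eq_zero, ← Submodule.mkQ_apply, map_spl]
  exact spl_eq_zero fun u v hl => (Submodule.Quotient.mk_eq_zero _).2 (h u v hl)

theorem contr_lin (r : k) (x y : Cochain k A p) (c : Chain k A) :
    contr (r • x + y) c = r • contr x c + contr y c := by
  have : contr (r • x + y) = r • contr x + contr y := chain_hom_ext_cons fun a l => by
    rw [LinearMap.add_apply, LinearMap.smul_apply, contr_cons, contr_cons, contr_cons]
    have := slotLinear_chain k [] (l.drop (p + 1).toNat) r (a * x.1 (l.take (p + 1).toNat))
      (a * y.1 (l.take (p + 1).toNat))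
    simpa [mul_add] using this
  exact LinearMap.congr_fun this c

theorem sOp_lin (r : k) (x y : Cochain k A p) (c : Chain k A) :
    sOp (r • x + y) c = r • sOp x c + sOp y c := by
  have : sOp (r • x + y) = r • sOp x + sOp y := by
    refine chain_hom_ext fun l => ?_
    have key : ∀ (P j m : ℕ) (l : List A), chain k (1 :: (ins (r • x.1 + y.1) P j l).rotate m)
        = r • chain k (1 :: (ins x.1 P j l).rotate m) + chain k (1 :: (ins y.1 P j l).rotate m) :=
      fun P j m l => (((slotLinear_chain k).cons 1).rotate m) _ _ r _ _
    simp only [sOp, chainLift_chain, LinearMap.add_apply, LinearMap.smul_apply, sFun,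
      Submodule.coe_add, Submodule.coe_smul, key, Finset.smul_sum, ← Finset.sum_add_distrib]
    refine Finset.sum_congr rfl fun i _ => Finset.sum_congr rfl fun j _ => ?_
    split_ifs
    · rw [smul_add, smul_comm r]
    · rw [smul_zero, add_zero]
  exact LinearMap.congr_fun this c

theorem contr_zero (c : Chain k A) : contr (0 : Cochain k A p) c = 0 := by
  simpa using contr_lin (-1 : k) (0 : Cochain k A p) 0 c

theorem tOp_mem {n m : ℤ} (h : m = n - p - q) (x : Cochain k A p) (y : Cochain k A q)
    {c : Chain k A} (hc : c ∈ chainDeg k A n) : tOp x y c ∈ chainDeg k A m := by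
  induction hc using Submodule.span_induction with
  | mem c hl =>
    obtain ⟨l, hl, rfl⟩ := hl
    rcases l with _ | ⟨a, l⟩
    · rw [chain_nil, map_zero]
      exact Submodule.zero_mem _
    · rw [tOp_cons_tau, tau]
      refine spl_mem _ fun s r h1 => spl_mem _ fun z t h2 => Submodule.smul_mem _ _ ?_
      by_cases hz : (z.length : ℤ) = m
      · exact chain_mem (by simp [hz])
      · rw [(slotLinear_chain k).eq_zero]
        · exact Submodule.zero_mem _
        · rw [List.mem_cons]
          left
          symm
          refine smul_eq_zero_of_right _ (spl_eq_zero fun s₁ s' h3 => spl_eq_zero fun s₂ s₃ h4 =>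
            smul_eq_zero_of_right _ ?_)
          by_cases hs : (s₂.length : ℤ) = q + 1
          · refine x.2.2.2 _ ?_
            subst h1 h2 h3 h4
            simp only [List.length_append, List.length_cons] at hl ⊢
            push_cast at hl ⊢
            omega
          · rw [y.2.2.2 _ hs]
            exact x.2.1.eq_zero (by simp)
  | zero => simp
  | add x y _ _ hx hy => rw [map_add]; exact Submodule.add_mem _ hx hy
  | smul r x _ hx => rw [map_smul]; exact Submodule.smul_mem _ _ hx

theorem gerst_comm {r : ℤ} (h : p + q = r) (h' : q + p = r) (x : Cochain k A p)
    (y : Cochain k A q) : gerst h x y = -sg k (p * q) • gerst h' y x := by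
  ext l
  rw [Submodule.coe_smul, gerst_eq_br, gerst_eq_br, Pi.smul_apply, br, br, mul_comm q p, smul_sub,
    smul_smul, neg_mul, sg_mul_self]
  module

theorem cochainD_gerst {r s p' q' : ℤ} (h : p + q = r) (hs : s = r + 1) {hp : p' = p + 1}
    {hq : q' = q + 1} {x : Cochain k A p} {y : Cochain k A q} (hx : cochainD hp x = 0)
    (hy : cochainD hq y = 0) : cochainD hs (gerst h x y) = 0 := by
  subst h
  have h1 := br_mulList_fun hs (gerst rfl x y)
  rw [gerst_eq_br] at h1
  ext l
  have h2 := congrFun h1 l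
  rw [br_mulList_br (isCo_coe x) (isCo_coe y) (br_mulList_eq_zero hx) (br_mulList_eq_zero hy)] at h2
  simpa using h2.symm

end Linearity

/-! ### The Cartan calculus on the negative cyclic complex -/

noncomputable section CyclicComplex

variable {k : Type u} {A : Type v} [Field k] [Ring A] [Algebra k A] {p q : ℤ}

/-- Multiplication by `u` as a linear map. -/
def uL : (ℕ → Chain k A) →ₗ[k] (ℕ → Chain k A) where
  toFun := uMul
  map_add' c c' := by funext i; cases i <;> simp [uMul]
  map_smul' r c := by funext i; cases i <;> simp [uMul]

@[simp] theorem uL_zero (c : ℕ → Chain k A) : uL c 0 = 0 := rfl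

@[simp] theorem uL_succ (c : ℕ → Chain k A) (i : ℕ) : uL c (i + 1) = c i := rfl

theorem uL_injective : Function.Injective (uL (k := k) (A := A)) := fun _ _ h =>
  funext fun i => congrFun h (i + 1)

/-- The differential `b + u B` on all power series. -/
def ccL : (ℕ → Chain k A) →ₗ[k] (ℕ → Chain k A) :=
  b.compLeft ℕ + uL ∘ₗ connes.compLeft ℕ

@[simp] theorem ccL_zero (c : ℕ → Chain k A) : ccL c 0 = b (c 0) := add_zero _

@[simp] theorem ccL_succ (c : ℕ → Chain k A) (i : ℕ) :
    ccL c (i + 1) = b (c (i + 1)) + connes (c i) := rfl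

/-- The operator `i_x + u S_x` on all power series. -/
def capU (x : Cochain k A p) : (ℕ → Chain k A) →ₗ[k] (ℕ → Chain k A) :=
  (contr x).compLeft ℕ + uL ∘ₗ (sOp x).compLeft ℕ

@[simp] theorem capU_zero (x : Cochain k A p) (c : ℕ → Chain k A) :
    capU x c 0 = contr x (c 0) := add_zero _

@[simp] theorem capU_succ (x : Cochain k A p) (c : ℕ → Chain k A) (i : ℕ) :
    capU x c (i + 1) = contr x (c (i + 1)) + sOp x (c i) := rfl

/-- The operator `L_x` on all power series. -/
def lieL (x : Cochain k A p) : (ℕ → Chain k A) →ₗ[k] (ℕ → Chain k A) :=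
  (lieDer x).compLeft ℕ

@[simp] theorem lieL_apply (x : Cochain k A p) (c : ℕ → Chain k A) (i : ℕ) :
    lieL x c i = lieDer x (c i) := rfl

/-- Division by `u`, forgetting the constant coefficient. -/
def shiftU : (ℕ → Chain k A) →ₗ[k] (ℕ → Chain k A) := LinearMap.funLeft k _ Nat.succ

@[simp] theorem shiftU_apply (c : ℕ → Chain k A) (i : ℕ) : shiftU c i = c (i + 1) := rfl

theorem uL_shiftU {c : ℕ → Chain k A} (h : c 0 = 0) : uL (shiftU c) = c := by
  funext i
  cases i
  · exact h.symm
  · rfl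

/-- A chain as a constant power series. -/
def constU : Chain k A →ₗ[k] (ℕ → Chain k A) := LinearMap.single k (fun _ => Chain k A) 0

@[simp] theorem constU_zero (c : Chain k A) : constU c 0 = c :=
  Pi.single_eq_same (M := fun _ : ℕ => Chain k A) 0 c

@[simp] theorem constU_succ (c : Chain k A) (i : ℕ) : constU c (i + 1) = 0 :=
  Pi.single_eq_of_ne (Nat.succ_ne_zero i) c

theorem ccL_uL (c : ℕ → Chain k A) : ccL (uL c) = uL (ccL c) := by
  funext i
  rcases i with _ | _ | i <;> simp

theorem ccL_constU (c : Chain k A) :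
    ccL (constU c) = constU (b c) + uL (constU (connes c)) := by
  funext i
  rcases i with _ | _ | i <;> simp

theorem ccL_ccL [CharZero k] (c : ℕ → Chain k A) : ccL (ccL c) = 0 := by
  funext i
  rcases i with _ | _ | i <;> simp [b_b, b_connes, connes_connes]

theorem capU_lin (r : k) (x y : Cochain k A p) (c : ℕ → Chain k A) :
    capU (r • x + y) c = r • capU x c + capU y c := by
  funext i
  cases i
  · simp [contr_lin]
  · simp [contr_lin, sOp_lin]
    module

theorem lieL_lin (r : k) (x y : Cochain k A p) (c : ℕ → Chain k A) :
    lieL (r • x + y) c = r • lieL x c + lieL y c := by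
  funext i
  simp [lieDer_lin]

theorem capU_smul (r : k) (x : Cochain k A p) (c : ℕ → Chain k A) :
    capU (r • x) c = r • capU x c := by
  have h0 := capU_lin (-1 : k) (0 : Cochain k A p) 0 c
  have h := capU_lin r x 0 c
  simp only [smul_zero, add_zero, neg_smul, one_smul, neg_add_cancel] at h0
  rwa [h0, add_zero, add_zero] at h

theorem capU_coe_zero (c : ℕ → Chain k A) : capU (0 : Cochain k A p) c = 0 := by
  simpa using capU_smul (0 : k) (0 : Cochain k A p) c

theorem lieL_smul (r : k) (x : Cochain k A p) (c : ℕ → Chain k A) :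
    lieL (r • x) c = r • lieL x c := by
  have h0 := lieL_lin (-1 : k) (0 : Cochain k A p) 0 c
  have h := lieL_lin r x 0 c
  simp only [smul_zero, add_zero, neg_smul, one_smul, neg_add_cancel] at h0
  rwa [h0, add_zero, add_zero] at h

/-- The Cartan homotopy formula on the negative cyclic complex. -/
theorem ccL_capU [CharZero k] {r : ℤ} (h : r = p + 1) (x : Cochain k A p) (c : ℕ → Chain k A) :
    ccL (capU x c) + sg k p • capU x (ccL c) = uL (lieL x c) - capU (cochainD h x) c := by
  funext i
  -- The constant coefficient is the rule for `b` and `i_x`. From `u` on the Cartan formula enters,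
  -- and from `u²` on also `B S_x` and `S_x B`, both zero.
  rcases i with _ | _ | i
  · have := b_contr h x (c 0)
    simpa using this
  · have h1 := b_contr h x (c 1)
    have h2 := cartan h x (c 0)
    rw [← eq_sub_iff_add_eq] at h1
    rw [add_assoc, add_assoc, ← eq_sub_iff_add_eq] at h2
    simp [h1, h2]
    module
  · have h1 := b_contr h x (c (i + 2))
    have h2 := cartan h x (c (i + 1))
    rw [← eq_sub_iff_add_eq] at h1
    rw [add_assoc, add_assoc, ← eq_sub_iff_add_eq] at h2
    simp [h1, h2, connes_sOp, sOp_connes]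
    module

theorem lieL_ccL {r : ℤ} {h : r = p + 1} {x : Cochain k A p} (hx : cochainD h x = 0)
    (c : ℕ → Chain k A) : lieL x (ccL c) = sg k p • ccL (lieL x c) := by
  funext i
  cases i <;> simp [lieDer_b hx, lieDer_connes]

theorem lieL_lieL {r : ℤ} (h : p + q = r) (x : Cochain k A p) (y : Cochain k A q)
    (c : ℕ → Chain k A) :
    lieL x (lieL y c) = sg k (p * q) • lieL y (lieL x c) + lieL (gerst h x y) c := by
  funext i
  simp [lieDer_lieDer h]

/-- The homotopies for `i_y` and for `S_y` are the same `T`: its commutator with `b` corrects `i_y`,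
its composite with `B` corrects `S_y`, and `T B = 0`. -/
theorem lieL_capU {r p' q' : ℤ} (h : p + q = r) {hp : p' = p + 1} {hq : q' = q + 1}
    {x : Cochain k A p} {y : Cochain k A q} (hx : cochainD hp x = 0) (hy : cochainD hq y = 0)
    (c : ℕ → Chain k A) :
    lieL x (capU y c) = sg k (p * q + p) • capU y (lieL x c) + sg k p • capU (gerst h x y) c
      + sg k q • ccL ((tOp x y).compLeft ℕ c) - sg k p • (tOp x y).compLeft ℕ (ccL c) := by
  funext i
  rcases i with _ | i
  · simp [lieDer_contr h hx hy]
  · simp [lieDer_contr h hx hy, lieDer_sOp h, tOp_connes]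
    module

/-- An equality `u z = (b + u B) W` determines `z` up to a boundary. -/
theorem eq_of_uL_eq_ccL {z W : ℕ → Chain k A} (h : uL z = ccL W) :
    z = constU (connes (W 0)) + ccL (shiftU W) := by
  have h0 : b (W 0) = 0 := by
    have := congrFun h 0
    simpa using this.symm
  apply uL_injective
  -- Write `W = W₀ + u W'`. As `b W₀ = 0`, its differential is `u B W₀ + u (b + uB) W'`, and `u` can
  -- be cancelled.
  have hW : W = constU (W 0) + uL (shiftU W) := by
    funext i
    cases i <;> simp
  rw [h, map_add, ← ccL_uL]
  conv_lhs => rw [hW]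
  rw [map_add, ccL_constU, h0, map_zero, zero_add]

theorem shiftU_mem {n m : ℤ} (h : m = n + 2) {c : ℕ → Chain k A} (hc : c ∈ CC k A n) :
    shiftU c ∈ CC k A m := fun i => by
  have h1 := hc (i + 1)
  have e : n + 2 * ((i + 1 : ℕ) : ℤ) = m + 2 * (i : ℤ) := by push_cast; omega
  rwa [e] at h1

theorem constU_mem {n : ℤ} {c : Chain k A} (hc : c ∈ chainDeg k A n) :
    constU c ∈ CC k A n
  | 0 => by simpa using hc
  | i + 1 => by simp

theorem zero_mem_of_CC {n : ℤ} {c : ℕ → Chain k A} (hc : c ∈ CC k A n) : c 0 ∈ chainDeg k A n := by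
  simpa using hc 0

theorem coe_ccD {n m : ℤ} (h : n = m + 1) (c : CC k A n) : (ccD h c).1 = ccL c.1 := rfl

theorem ccL_mem {n m : ℤ} (h : n = m + 1) {c : ℕ → Chain k A} (hc : c ∈ CC k A n) :
    ccL c ∈ CC k A m := (ccD h ⟨c, hc⟩).2

theorem capU_mem {n m : ℤ} (h : m = n - (p + 1)) (x : Cochain k A p) {c : ℕ → Chain k A}
    (hc : c ∈ CC k A n) : capU x c ∈ CC k A m := (cyclicCap h x ⟨c, hc⟩).2

end CyclicComplex

/-! ### Induced maps on homology -/

noncomputable section HomologyMaps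

variable {k : Type u} [Field k] {X Y Z X' Y' Z' X'' Y'' Z'' : Type*}
  [AddCommGroup X] [Module k X] [AddCommGroup Y] [Module k Y] [AddCommGroup Z] [Module k Z]
  [AddCommGroup X'] [Module k X'] [AddCommGroup Y'] [Module k Y'] [AddCommGroup Z'] [Module k Z']
  [AddCommGroup X''] [Module k X''] [AddCommGroup Y''] [Module k Y'']
  [AddCommGroup Z''] [Module k Z'']
variable {f : X →ₗ[k] Y} {g : Y →ₗ[k] Z} {f' : X' →ₗ[k] Y'} {g' : Y' →ₗ[k] Z'}
  {f'' : X'' →ₗ[k] Y''} {g'' : Y'' →ₗ[k] Z''}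

theorem exists_cls (a : Homology f g) : ∃ z hz, cls f g z hz = a := by
  obtain ⟨⟨z, hz⟩, rfl⟩ := Submodule.mkQ_surjective _ a
  exact ⟨z, hz, rfl⟩

theorem cls_eq_iff {z z' : Y} {hz : g z = 0} {hz' : g z' = 0} :
    cls f g z hz = cls f g z' hz' ↔ ∃ x, f x = z - z' :=
  Submodule.Quotient.eq _

theorem cls_eq_zero_iff {z : Y} {hz : g z = 0} : cls f g z hz = 0 ↔ ∃ x, f x = z :=
  Submodule.Quotient.mk_eq_zero _

theorem cls_smul (r : k) {z : Y} (hz : g z = 0) :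
    cls f g (r • z) (by rw [map_smul, hz, smul_zero]) = r • cls f g z hz := rfl

theorem cls_congr {z z' : Y} (hz : g z = 0) (h : z = z') :
    cls f g z hz = cls f g z' (h ▸ hz) := by subst h; rfl

/-- The map on homology induced by a linear map that respects cycles and boundaries. -/
def homMap (φ : Y → Y') (hφ : IsLinearMap k φ) (hz : ∀ z, g z = 0 → g' (φ z) = 0)
    (hb : ∀ x, ∃ x', f' x' = φ (f x)) : Homology f g →ₗ[k] Homology f' g' :=
  Submodule.mapQ _ _ ((IsLinearMap.mk' φ hφ).restrict hz) (by
    rintro ⟨z, h⟩ ⟨x, hx⟩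
    obtain ⟨x', hx'⟩ := hb x
    exact ⟨x', hx'.trans (congrArg φ hx)⟩)

theorem induces_homMap (φ : Y → Y') (hφ : IsLinearMap k φ) (hz : ∀ z, g z = 0 → g' (φ z) = 0)
    (hb : ∀ x, ∃ x', f' x' = φ (f x)) : Induces φ (homMap (f := f) (f' := f') φ hφ hz hb) :=
  fun z h => ⟨hz z h, rfl⟩

/-- The operation on homology induced by a bilinear map that respects cycles and boundaries. -/
def homMap₂ (φ : Y →ₗ[k] Y' →ₗ[k] Y'') (hz : ∀ z z', g z = 0 → g' z' = 0 → g'' (φ z z') = 0)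
    (hl : ∀ x z', g' z' = 0 → ∃ x'', f'' x'' = φ (f x) z')
    (hr : ∀ z x', g z = 0 → ∃ x'', f'' x'' = φ z (f' x')) :
    Homology f g →ₗ[k] Homology f' g' →ₗ[k] Homology f'' g'' :=
  Submodule.liftQ _
    { toFun := fun z => homMap (φ z.1) (φ z.1).isLinear (fun z' h => hz z.1 z' z.2 h)
        (fun x' => hr z.1 x' z.2)
      map_add' := fun z₁ z₂ => by
        ext a
        obtain ⟨z', hz', rfl⟩ := exists_cls a
        exact congrArg (Submodule.Quotient.mk) (Subtype.ext (LinearMap.map_add₂ φ z₁.1 z₂.1 z'))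
      map_smul' := fun r z => by
        ext a
        obtain ⟨z', hz', rfl⟩ := exists_cls a
        exact congrArg (Submodule.Quotient.mk) (Subtype.ext (LinearMap.map_smul₂ φ r z.1 z')) }
    (by
      rintro ⟨z, h⟩ ⟨x, hx⟩
      ext a
      obtain ⟨z', hz', rfl⟩ := exists_cls a
      obtain ⟨x'', hx''⟩ := hl x z' hz'
      exact cls_eq_zero_iff.2 ⟨x'', hx''.trans (congrArg (fun y => φ y z') hx)⟩)

/-- The equivalence on homology induced by a quasi-isomorphism. -/
def homEquiv (φ : Y → Y') (hφ : IsLinearMap k φ) (hz : ∀ z, g z = 0 → g' (φ z) = 0)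
    (hb : ∀ x, ∃ x', f' x' = φ (f x))
    (hi : ∀ z, g z = 0 → (∃ x', f' x' = φ z) → ∃ x, f x = z)
    (hs : ∀ z', g' z' = 0 → ∃ z, g z = 0 ∧ ∃ x', f' x' = φ z - z') :
    Homology f g ≃ₗ[k] Homology f' g' :=
  LinearEquiv.ofBijective (homMap φ hφ hz hb) (by
    constructor
    · rw [injective_iff_map_eq_zero]
      intro a ha
      obtain ⟨z, h, rfl⟩ := exists_cls a
      exact cls_eq_zero_iff.2 (hi z h (cls_eq_zero_iff.1 ha))
    · intro a
      obtain ⟨z', h, rfl⟩ := exists_cls a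
      obtain ⟨z, hz', hx⟩ := hs z' h
      exact ⟨cls f g z hz', cls_eq_iff.2 hx⟩)

theorem induces_homEquiv (φ : Y → Y') (hφ : IsLinearMap k φ) (hz : ∀ z, g z = 0 → g' (φ z) = 0)
    (hb : ∀ x, ∃ x', f' x' = φ (f x))
    (hi : ∀ z, g z = 0 → (∃ x', f' x' = φ z) → ∃ x, f x = z)
    (hs : ∀ z', g' z' = 0 → ∃ z, g z = 0 ∧ ∃ x', f' x' = φ z - z') :
    Induces φ (homEquiv φ hφ hz hb hi hs).toLinearMap :=
  fun z h => ⟨hz z h, rfl⟩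

end HomologyMaps

/-! ### The cup product through contractions -/

noncomputable section CupProduct

variable {k : Type u} {A : Type v} [Field k] [Ring A] [Algebra k A] {p q r : ℤ}

/-- A chain of the form `a` determines `a`. -/
theorem chain_singleton_injective : Function.Injective fun a : A => chain k [a] := fun a a' h => by
  have hw := congrArg (TensorProduct.rid k A ∘ TensorProduct.map LinearMap.id (wordZero k A)
    ∘ toWord 0) h
  simpa [toWord_cons, wordZero_word] using hw

/-- Cochains act faithfully by contraction. -/
theorem cochain_ext {x y : Cochain k A p} (h : ∀ c, contr x c = contr y c) : x = y := by
  ext l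
  by_cases hl : (l.length : ℤ) = p + 1
  · have h1 := h (chain k (1 :: l))
    have h2 : (p + 1).toNat = l.length := by omega
    rw [contr_cons, contr_cons, h2, List.take_length, List.drop_length, one_mul, one_mul] at h1
    exact chain_singleton_injective h1
  · rw [x.2.2.2 l hl, y.2.2.2 l hl]

/-- As cochains act faithfully by contraction (`cochain_ext`), this reduces bilinearity of the cup
product and the Leibniz rule to statements about composites of contractions. -/
theorem contr_cup (h : p + q + 1 = r) (x : Cochain k A p) (y : Cochain k A q) (c : Chain k A) :
    contr (cup h x y) c = sg k ((p + 1) * (q + 1)) • contr y (contr x c) := by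
  rw [contr_contr h, smul_smul, sg_mul_self, one_smul]

theorem contr_add (x y : Cochain k A p) (c : Chain k A) :
    contr (x + y) c = contr x c + contr y c := by
  simpa using contr_lin (1 : k) x y c

theorem contr_smul (s : k) (x : Cochain k A p) (c : Chain k A) :
    contr (s • x) c = s • contr x c := by
  simpa [contr_zero] using contr_lin s x 0 c

/-- The cup product as a bilinear map. -/
def cupL (h : p + q + 1 = r) : Cochain k A p →ₗ[k] Cochain k A q →ₗ[k] Cochain k A r :=
  LinearMap.mk₂ k (cup h)
    (fun x x' y => cochain_ext fun c => by
      simp only [contr_cup, contr_add, map_add, smul_add])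
    (fun s x y => cochain_ext fun c => by
      simp only [contr_cup, contr_smul, map_smul, smul_comm s])
    (fun x y y' => cochain_ext fun c => by simp only [contr_cup, contr_add, smul_add])
    (fun s x y => cochain_ext fun c => by simp only [contr_cup, contr_smul, smul_comm s])

theorem cupL_apply (h : p + q + 1 = r) (x : Cochain k A p) (y : Cochain k A q) :
    cupL h x y = cup h x y := rfl

theorem sg_eq_of_eq {a b : ℤ} (c : ℤ) (h : a = b + 2 * c) : sg k a = sg k b := by
  rw [h, sg_add, sg_even (a := 2 * c) (even_two_mul c), mul_one]

/-- The differential is a derivation of the cup product. -/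
theorem cochainD_cup [CharZero k] {p' q' r' : ℤ} (h : p + q + 1 = r) (hp : p' = p + 1)
    (hq : q' = q + 1) (hr : r' = r + 1) (x : Cochain k A p) (y : Cochain k A q) :
    cochainD hr (cup h x y)
      = cup (by omega) (cochainD hp x) y + sg k (p + 1) • cup (by omega) x (cochainD hq y) := by
  refine cochain_ext fun c => ?_
  -- Two ways to move `b` past `i_y i_x`: at once, through `x ∪ y`, or past one factor after the
  -- other.
  have h1 := b_contr hr (cup h x y) c
  have h2 := b_contr hq y (contr x c)
  have h3 := congrArg (contr y) (b_contr hp x c)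
  rw [contr_cup, contr_cup, map_smul] at h1
  rw [map_add, map_smul, map_neg, ← eq_sub_iff_add_eq] at h3
  rw [h3, ← eq_sub_iff_add_eq] at h2
  rw [h2, ← neg_eq_iff_eq_neg] at h1
  rw [← h1, contr_add, contr_smul, contr_cup, contr_cup]
  subst h hp hq
  have e1 : sg k (p + q + 1) = -(sg k p * sg k q) := by rw [sg_add, sg_add, sg_one]; ring
  have e2 : sg k ((p + 1 + 1) * (q + 1)) = sg k ((p + 1) * (q + 1)) * -sg k q := by
    rw [← mul_neg_one, ← sg_one (k := k), ← sg_add, ← sg_add]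
    exact sg_eq_of_eq 0 (by ring)
  have e3 : sg k ((p + 1) * (q + 1 + 1)) = sg k ((p + 1) * (q + 1)) * -sg k p := by
    rw [← mul_neg_one, ← sg_one (k := k), ← sg_add, ← sg_add]
    exact sg_eq_of_eq 0 (by ring)
  have e4 : sg k (p + 1) = - sg k p := by rw [sg_add, sg_one, mul_neg_one]
  rw [e1, e2, e3, e4]
  rcases sg_eq_or (k := k) p with hp | hp <;> rw [hp] <;> module

end CupProduct

/-! ### The operations on Hochschild and negative cyclic homology -/

noncomputable section InducedMaps

variable {k : Type u} {A : Type v} [Field k] [CharZero k] [Ring A] [Algebra k A]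

theorem coe_bDeg {n m : ℤ} (h : n = m + 1) (c : chainDeg k A n) : (bDeg k A h c).1 = b c.1 := rfl

theorem coe_piMap (n : ℤ) (c : CC k A n) : (piMap n c).1 = c.1 0 := rfl

theorem coe_connesCC {n m : ℤ} (h : m = n + 1) (c : chainDeg k A n) :
    (connesCC h c).1 = constU (connes c.1) := rfl

theorem b_zero_of_ccD {n m : ℤ} {h : n = m + 1} {c : CC k A n} (hc : ccD h c = 0) :
    b (c.1 0) = 0 := by
  have := congrFun (congrArg Subtype.val hc) 0
  rwa [coe_ccD, ccL_zero] at this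

variable (k A) in
/-- The map `π` on homology. -/
def piH (n : ℤ) : HC k A n →ₗ[k] HH k A n :=
  homMap (piMap n) ⟨fun _ _ => rfl, fun _ _ => rfl⟩
    (fun _ hz => Subtype.ext (b_zero_of_ccD hz))
    (fun x => ⟨piMap (n + 1) x, Subtype.ext (ccL_zero x.1).symm⟩)

theorem ccL_constU_connes (c : Chain k A) : ccL (constU (connes c)) = -constU (connes (b c)) := by
  rw [ccL_constU, connes_connes, map_zero, map_zero, add_zero, b_connes, map_neg]

variable (k A) in
/-- The map `B` from Hochschild to negative cyclic homology. -/
def connesH {n m : ℤ} (h : m = n + 1) : HH k A n →ₗ[k] HC k A m :=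
  homMap (connesCC h)
    ⟨fun c c' => Subtype.ext (by
        rw [Submodule.coe_add, coe_connesCC, coe_connesCC, coe_connesCC, Submodule.coe_add,
          map_add, map_add]),
      fun r c => Subtype.ext (by
        rw [Submodule.coe_smul, coe_connesCC, coe_connesCC, Submodule.coe_smul, map_smul,
          map_smul])⟩
    (fun c hc => Subtype.ext (by
      have hb : b c.1 = 0 := congrArg Subtype.val hc
      rw [coe_ccD, coe_connesCC, ccL_constU_connes, hb, map_zero, map_zero, neg_zero]
      rfl))
    (fun c => ⟨-connesCC (by omega) c, Subtype.ext (by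
      rw [map_neg, Submodule.coe_neg, coe_ccD, coe_connesCC, coe_connesCC, ccL_constU_connes,
        neg_neg, coe_bDeg])⟩)

theorem cochainD_cup_eq_zero {p q r p' q' r' : ℤ} (h : p + q + 1 = r) {hp : p' = p + 1}
    {hq : q' = q + 1} (hr : r' = r + 1) {x : Cochain k A p} {y : Cochain k A q}
    (hx : cochainD hp x = 0) (hy : cochainD hq y = 0) : cochainD hr (cup h x y) = 0 := by
  rw [cochainD_cup h hp hq hr, hx, hy, ← cupL_apply, ← cupL_apply, map_zero, map_zero, smul_zero,
    LinearMap.zero_apply, add_zero]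

/-- Classes in `HHCoh i` are represented by cochains of shifted degree `i - 1`. -/
theorem sub_one_add_sub_one {i j l : ℤ} (h : i + j = l) : i - 1 + (j - 1) + 1 = l - 1 := by
  rw [← h]; ring

variable (k A) in
/-- The cup product on cohomology. -/
def cupH {i j l : ℤ} (h : i + j = l) : HHCoh k A i →ₗ[k] HHCoh k A j →ₗ[k] HHCoh k A l :=
  homMap₂ (cupL (sub_one_add_sub_one h))
    (fun _ _ hx hy => cochainD_cup_eq_zero (sub_one_add_sub_one h) _ hx hy)
    (fun x y hy => ⟨cup (by omega) x y, by
      rw [cochainD_cup (p' := i - 1) (q' := j) _ (by ring) (by ring), hy, ← cupL_apply,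
        ← cupL_apply, map_zero, smul_zero, add_zero]⟩)
    (fun x y hx => ⟨sg k (i - 1 + 1) • cup (by omega) x y, by
      rw [map_smul, cochainD_cup (p' := i) (q' := j - 1) _ (by ring) (by ring), hx, ← cupL_apply,
        ← cupL_apply, map_zero, LinearMap.zero_apply, zero_add, smul_smul,
        sg_mul_self, one_smul]⟩)

theorem isLinearMap_cap {d : ℤ} (c : chainDeg k A d) {p n : ℤ} (h : n = d - (p + 1)) :
    IsLinearMap k (cap c h) where
  map_add x y := Subtype.ext (contr_add x y c.1)
  map_smul r x := Subtype.ext (contr_smul r x c.1)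

/-- The cap product with a nondegenerate cycle, on cohomology. -/
def capH {d : ℤ} {c : chainDeg k A d} (hc : b c.1 = 0) (hcap : CapIso k A d c.1) {i n : ℤ}
    (h : i + n = d) : HHCoh k A i ≃ₗ[k] HH k A n :=
  homEquiv (cap c (by omega)) (isLinearMap_cap c _)
    (fun x hx => Subtype.ext (by
      have := b_contr (show i = i - 1 + 1 by ring) x c.1
      rw [hc, map_zero, smul_zero, add_zero, hx, contr_zero, neg_zero] at this
      exact this))
    (fun x => ⟨-cap c (by omega) x, Subtype.ext (by
      have := b_contr (show i - 1 = i - 2 + 1 by ring) x c.1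
      rw [hc, map_zero, smul_zero, add_zero, ← neg_eq_iff_eq_neg] at this
      exact (map_neg b _).trans this)⟩)
    (fun x hx ⟨w, hw⟩ => hcap.inj _ _ x hx w.1 (congrArg Subtype.val hw).symm)
    (fun y hy => by
      obtain ⟨x, hx, w, hw, e⟩ := hcap.surj (p := i - 1) (show i = i - 1 + 1 by ring)
        (n := n) (by omega) rfl y.1 y.2 (congrArg Subtype.val hy)
      exact ⟨x, hx, ⟨w, hw⟩, Subtype.ext (eq_sub_of_add_eq' e.symm)⟩)

end InducedMaps

/-! ### The map `Ψ` is a quasi-isomorphism -/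

noncomputable section TwistedComplex

variable {k : Type u} {A : Type v} [Field k] [CharZero k] [Ring A] [Algebra k A] {d : ℕ}
  {η₀ : CC k A d}

variable (k) in
/-- The sign `(-1)^{d + 1 + p + (d + 1) p}`. -/
def psiSign (d : ℕ) (p : ℤ) : k := sg k ((d : ℤ) + 1 + p + (d + 1) * p)

theorem psiSign_mul_self (d : ℕ) (p : ℤ) : psiSign k d p * psiSign k d p = 1 := sg_mul_self _

/-- The signs in the definition of `Ψ` multiply to `-psiSign`. The same `psiSign` stands in front of
`L_x η₀` in the differential (`coe_ddDiff`), and this coincidence makes `Ψ` compatible with the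
differentials. -/
theorem coe_psi {p n : ℤ} (h : p + n = d - 1) (X : DD k A d p) :
    (psi η₀ h X).1 = uL X.2.1 - psiSign k d p • capU X.1 η₀.1 := by
  have e : (-1 : k) ^ (p - 1) * (-1 : k) ^ (((d : ℤ) - 1) * (p + 1)) = -psiSign k d p := by
    change sg k (p - 1) * sg k (((d : ℤ) - 1) * (p + 1)) = -sg k _
    rw [← sg_add, ← mul_neg_one, ← sg_one (k := k), ← sg_add]
    exact sg_eq_of_eq (-2 - p) (by ring)
  change (-1 : k) ^ (p - 1) • (-1 : k) ^ (((d : ℤ) - 1) * (p + 1)) • capU X.1 η₀.1 + uL X.2.1 = _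
  rw [smul_smul, e]
  module

theorem coe_ddDiff {p q : ℤ} (h : q = p + 1) (X : DD k A d p) :
    (ddDiff η₀ h X).2.1
      = sg k ((d : ℤ) + 1) • (ccL X.2.1 - psiSign k d p • lieL X.1 η₀.1) := by
  have e : (-1 : k) ^ (d + 1) = sg k ((d : ℤ) + 1) := by
    rw [sg, ← zpow_natCast]; push_cast; rfl
  change (-1 : k) ^ (d + 1) • ccL X.2.1
    - (-1 : k) ^ p • (-1 : k) ^ (((d : ℤ) + 1) * p) • lieL X.1 η₀.1 = _
  rw [e, smul_sub, smul_smul, smul_smul, psiSign]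
  change _ - (sg k p * sg k _) • _ = _
  rw [← sg_add, ← sg_add]
  congr 2
  exact sg_eq_of_eq (-(d + 1)) (by ring)

theorem fst_ddDiff {p q : ℤ} (h : q = p + 1) (X : DD k A d p) :
    (ddDiff η₀ h X).1 = cochainD h X.1 := rfl

theorem ddDiff_eq_zero_iff {p q : ℤ} (h : q = p + 1) (X : DD k A d p) :
    ddDiff η₀ h X = 0 ↔ cochainD h X.1 = 0 ∧ ccL X.2.1 = psiSign k d p • lieL X.1 η₀.1 := by
  rw [Prod.ext_iff, Subtype.ext_iff (a1 := (ddDiff η₀ h X).2), coe_ddDiff, fst_ddDiff]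
  refine and_congr Iff.rfl ?_
  change _ • _ = (0 : ℕ → Chain k A) ↔ _
  rw [smul_eq_zero_iff_right (sg_ne_zero _), sub_eq_zero]

theorem psiSign_succ (d : ℕ) (p : ℤ) :
    psiSign k d (p + 1) = -sg k ((d : ℤ) + 1) * psiSign k d p := by
  rw [psiSign, psiSign, neg_mul, ← mul_neg_one, ← sg_one (k := k), ← sg_add, ← sg_add]
  exact sg_eq_of_eq 0 (by ring)

/-- The Cartan formula applied to the cycle `η₀` matches `u L_x η₀` with the twist of the
differential. The factor `(-1)^{d+1}` is the sign of the differential on the shifted complex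
`Σ^{-d+1} CC⁻`. -/
theorem ccL_psi (hη : ccL η₀.1 = 0) {p q n m : ℤ} (h : p + n = d - 1) (hq : q = p + 1)
    (hm : q + m = d - 1) (X : DD k A d p) :
    (psi η₀ hm (ddDiff η₀ hq X)).1 = sg k ((d : ℤ) + 1) • ccL (psi η₀ h X).1 := by
  have h1 := ccL_capU hq X.1 η₀.1
  rw [hη, map_zero, smul_zero, add_zero] at h1
  rw [coe_psi, coe_psi, coe_ddDiff, fst_ddDiff]
  simp only [map_sub, map_smul, ccL_uL, h1]
  subst hq
  rw [psiSign_succ]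
  module

theorem isLinearMap_psi {p n : ℤ} (h : p + n = d - 1) : IsLinearMap k (psi η₀ h) where
  map_add X Y := Subtype.ext (by
    have h1 := capU_lin 1 X.1 Y.1 η₀.1
    rw [one_smul, one_smul] at h1
    rw [Submodule.coe_add, coe_psi, coe_psi, coe_psi, Prod.snd_add, Prod.fst_add, h1,
      Submodule.coe_add, map_add]
    module)
  map_smul r X := Subtype.ext (by
    rw [Submodule.coe_smul, coe_psi, coe_psi, Prod.smul_snd, Prod.smul_fst, capU_smul,
      Submodule.coe_smul, map_smul]
    module)

/-- A cocycle `x` has `L_x η₀` homologous to `B (i_x π η₀)`. -/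
theorem lieL_eq (hη : ccL η₀.1 = 0) {p q : ℤ} {hq : q = p + 1} {x : Cochain k A p}
    (hx : cochainD hq x = 0) :
    lieL x η₀.1 = constU (connes (contr x (η₀.1 0))) + ccL (shiftU (capU x η₀.1)) := by
  have h1 := ccL_capU hq x η₀.1
  rw [hη, map_zero, smul_zero, add_zero, hx, capU_coe_zero, sub_zero] at h1
  have := eq_of_uL_eq_ccL h1.symm
  rwa [capU_zero] at this

theorem ccL_psi_eq_zero (hη : ccL η₀.1 = 0) {p q n : ℤ} (h : p + n = d - 1) (hq : q = p + 1)
    {X : DD k A d p} (hX : ddDiff η₀ hq X = 0) : ccL (psi η₀ h X).1 = 0 := by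
  have h1 := ccL_psi hη h hq (m := d - 1 - q) (by ring) X
  rw [hX, (isLinearMap_psi _).map_zero] at h1
  exact (smul_eq_zero_iff_right (sg_ne_zero _)).1 h1.symm

/-- `Ψ` is injective on cohomology. -/
theorem exists_ddDiff_eq (hη : ccL η₀.1 = 0) (hcap : CapIso k A d (η₀.1 0)) {o p q n m : ℤ}
    (h : p + n = d - 1) (hq : q = p + 1) (hp : p = o + 1) (hm : m = n + 1) {X : DD k A d p}
    (hX : ddDiff η₀ hq X = 0) {V : CC k A m} (hV : ccL V.1 = (psi η₀ h X).1) :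
    ∃ Y, ddDiff η₀ hp Y = X := by
  have hX' := hX
  rw [ddDiff_eq_zero_iff] at hX'
  obtain ⟨hx, hXm⟩ := hX'
  -- The constant coefficient of `Ψ X` is `i_x π(η₀)` up to sign. It bounds, so `x` is a coboundary.
  obtain ⟨x', hx'⟩ : ∃ x', cochainD hp x' = X.1 := by
    have h0 := congrFun hV 0
    rw [coe_psi, ccL_zero] at h0
    refine hcap.inj hq hp X.1 hx (-psiSign k d p • V.1 0) ?_
    rw [map_smul, h0, Pi.sub_apply, uL_zero, Pi.smul_apply, capU_zero, zero_sub, smul_neg,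
      neg_smul, neg_neg, smul_smul, psiSign_mul_self, one_smul]
  have hm' : d + 1 - o = m + 2 := by omega
  -- Subtracting the differential of `(x', 0)` removes the cochain component of `X`; what remains is
  -- a chain whose product with `u` is a boundary, of `W`.
  set Y₁ : DD k A d o := (x', 0)
  obtain ⟨W, hW, hWm⟩ : ∃ W ∈ CC k A m, uL (X.2.1 - (ddDiff η₀ hp Y₁).2.1) = ccL W := by
    refine ⟨V.1 - sg k ((d : ℤ) + 1) • (psi η₀ (show o + m = d - 1 by omega) Y₁).1,
      Submodule.sub_mem _ V.2 (Submodule.smul_mem _ _ (Subtype.prop _)), ?_⟩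
    have h1 := ccL_psi hη (show o + m = d - 1 by omega) hp h Y₁
    rw [map_sub, map_sub, map_smul, hV, ← h1, coe_psi, coe_psi, fst_ddDiff]
    have h2 : cochainD hp Y₁.1 = X.1 := hx'
    rw [h2]
    abel
  have hz := eq_of_uL_eq_ccL hWm
  have hbW : b (W 0) = 0 := by
    have := congrFun hWm 0
    simpa using this.symm
  -- The remaining chain is homologous to `B W₀`. Writing `W₀` as `i_{x₂} π(η₀)` up to a boundary
  -- makes it homologous to `L_{x₂} η₀`, which is the twist in the differential of a pair with first
  -- component `± x₂`.
  obtain ⟨x₂, hx₂, w, hw, hxw⟩ := hcap.surj (p := o) hp (n := m) (m := m + 1) (by omega) rfl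
    (W 0) (zero_mem_of_CC hW) hbW
  have hL := lieL_eq hη hx₂
  rw [hxw, map_add, map_add, ← neg_neg (constU (connes (b w))), ← ccL_constU_connes] at hL
  set R : ℕ → Chain k A := shiftU W + constU (connes w) - shiftU (capU x₂ η₀.1) with hR
  have hRm : R ∈ CC k A (d + 1 - o) :=
    Submodule.sub_mem _ (Submodule.add_mem _ (shiftU_mem hm' hW)
      (constU_mem (connes_mem (n := m + 1) (by omega) w hw)))
      (shiftU_mem (n := m) hm' (capU_mem (by omega) x₂ η₀.2))
  have key : X.2.1 - (ddDiff η₀ hp Y₁).2.1 = lieL x₂ η₀.1 + ccL R := by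
    rw [hz, hL, hR, map_sub, map_add]
    abel
  refine ⟨Y₁ + sg k ((d : ℤ) + 1) • (-psiSign k d o • x₂, ⟨R, hRm⟩), ?_⟩
  rw [map_add, map_smul]
  refine Prod.ext ?_ (Subtype.ext ?_)
  · change cochainD hp x' + sg k _ • cochainD hp (-psiSign k d o • x₂) = X.1
    rw [map_smul, hx₂, smul_zero, smul_zero, add_zero, hx']
  · rw [Prod.snd_add, Prod.smul_snd, Submodule.coe_add, Submodule.coe_smul,
      coe_ddDiff hp (-psiSign k d o • x₂, ⟨R, hRm⟩), smul_smul, sg_mul_self, one_smul]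
    change (ddDiff η₀ hp Y₁).2.1 + (ccL R - psiSign k d o • lieL (-psiSign k d o • x₂) η₀.1) = _
    rw [lieL_smul, smul_smul, mul_neg, psiSign_mul_self, neg_one_smul, sub_neg_eq_add,
      add_comm (ccL R), ← key, add_sub_cancel]

/-- `Ψ` is surjective on cohomology. -/
theorem exists_psi_eq (hη : ccL η₀.1 = 0) (hcap : CapIso k A d (η₀.1 0)) {p q n m : ℤ}
    (h : p + n = d - 1) (hq : q = p + 1) (hm : m = n + 1) {ζ : CC k A n} (hζ : ccL ζ.1 = 0) :
    ∃ X, ddDiff η₀ hq X = 0 ∧ ∃ V : CC k A m, ccL V.1 = (psi η₀ h X).1 - ζ.1 := by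
  have hbζ : b (ζ.1 0) = 0 := by
    have := congrFun hζ 0
    rwa [ccL_zero] at this
  obtain ⟨x, hx, w, hw, hxw⟩ := hcap.surj (p := p) hq (n := n) (by omega) hm
    (ζ.1 0) (zero_mem_of_CC ζ.2) hbζ
  -- This has no constant coefficient, so it is divisible by `u`, and the quotient is the chain
  -- component of the preimage.
  set R : ℕ → Chain k A := ζ.1 - capU x η₀.1 + ccL (constU w) with hR
  have hR0 : R 0 = 0 := by
    rw [hR, Pi.add_apply, Pi.sub_apply, capU_zero, ccL_zero, constU_zero, hxw]
    abel
  have hRm : R ∈ CC k A n :=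
    Submodule.add_mem _ (Submodule.sub_mem _ ζ.2 (capU_mem (by omega) x η₀.2))
      (ccL_mem hm (constU_mem hw))
  have h1 := ccL_capU hq x η₀.1
  rw [hη, map_zero, smul_zero, add_zero, hx, capU_coe_zero, sub_zero] at h1
  refine ⟨(-psiSign k d p • x, ⟨shiftU R, shiftU_mem (by omega) hRm⟩), ?_, ⟨constU w, constU_mem hw⟩,
    ?_⟩
  · rw [ddDiff_eq_zero_iff]
    refine ⟨?_, ?_⟩
    · change cochainD hq (-psiSign k d p • x) = 0
      rw [map_smul, hx, smul_zero]
    · change ccL (shiftU R) = psiSign k d p • lieL (-psiSign k d p • x) η₀.1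
      rw [lieL_smul, smul_smul, mul_neg, psiSign_mul_self, neg_one_smul]
      apply uL_injective
      rw [← ccL_uL, uL_shiftU hR0, hR, map_add, map_sub, hζ, h1, ccL_ccL, map_neg]
      abel
  · rw [coe_psi]
    change ccL (constU w) = uL (shiftU R) - psiSign k d p • capU (-psiSign k d p • x) η₀.1 - ζ.1
    rw [capU_smul, smul_smul, mul_neg, psiSign_mul_self, neg_one_smul, uL_shiftU hR0, hR]
    abel

/-- The equivalence on cohomology induced by `Ψ`. -/
def psiH (hη : ccL η₀.1 = 0) (hcap : CapIso k A d (η₀.1 0)) {p n : ℤ} (h : p + n = d - 1) :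
    HD η₀ p ≃ₗ[k] HC k A n :=
  homEquiv (psi η₀ h) (isLinearMap_psi h)
    (fun X hX => Subtype.ext (ccL_psi_eq_zero hη h _ hX))
    (fun Y => ⟨sg k ((d : ℤ) + 1) • psi η₀ (by omega) Y, Subtype.ext (by
      rw [map_smul, Submodule.coe_smul, coe_ccD, ccL_psi hη (n := n + 1) (by omega)])⟩)
    (fun X hX ⟨V, hV⟩ => exists_ddDiff_eq hη hcap h _ _ rfl hX (V := V)
      (congrArg Subtype.val hV))
    (fun ζ hζ => by
      obtain ⟨X, hX, V, hV⟩ := exists_psi_eq hη hcap h rfl rfl (congrArg Subtype.val hζ)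
      exact ⟨X, hX, V, Subtype.ext hV⟩)

end TwistedComplex

/-! ### The image of the bracket under `Ψ` -/

noncomputable section BracketFormula

variable {k : Type u} {A : Type v} [Field k] [CharZero k] [Ring A] [Algebra k A] {d : ℕ}
  {η₀ : CC k A d} {p q r : ℤ}

theorem coe_ddBracket (h : p + q = r) (X : DD k A d p) (Y : DD k A d q) :
    (ddBracket h X Y).2.1 = sg k (((d : ℤ) + 1) * p) • lieL X.1 Y.2.1
      - sg k (p * q) • sg k (((d : ℤ) + 1) * q) • lieL Y.1 X.2.1 := by
  rw [mul_comm p q]; rfl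

theorem fst_ddBracket (h : p + q = r) (X : DD k A d p) (Y : DD k A d q) :
    (ddBracket h X Y).1 = gerst h X.1 Y.1 := rfl

theorem psiSign_add (d : ℕ) (p q : ℤ) :
    sg k (((d : ℤ) + 1) * p) * (sg k p * psiSign k d q) = psiSign k d (p + q) := by
  rw [psiSign, psiSign, ← sg_add, ← sg_add]
  exact sg_eq_of_eq 0 (by ring)

/-- The bracket of two cycles is a cycle. -/
theorem ddDiff_ddBracket (h : p + q = r) {p' q' r' : ℤ} {hp : p' = p + 1} {hq : q' = q + 1}
    (hr : r' = r + 1) {X : DD k A d p} {Y : DD k A d q} (hX : ddDiff η₀ hp X = 0)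
    (hY : ddDiff η₀ hq Y = 0) : ddDiff η₀ hr (ddBracket h X Y) = 0 := by
  rw [ddDiff_eq_zero_iff] at hX hY ⊢
  refine ⟨cochainD_gerst h hr hX.1 hY.1, ?_⟩
  have h1 : ccL (lieL X.1 Y.2.1) = (sg k p * psiSign k d q) • lieL X.1 (lieL Y.1 η₀.1) := by
    rw [mul_smul, ← map_smul, ← hY.2, lieL_ccL hX.1, smul_smul, sg_mul_self, one_smul]
  have h2 : ccL (lieL Y.1 X.2.1) = (sg k q * psiSign k d p) • lieL Y.1 (lieL X.1 η₀.1) := by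
    rw [mul_smul, ← map_smul, ← hX.2, lieL_ccL hY.1, smul_smul, sg_mul_self, one_smul]
  rw [coe_ddBracket, map_sub, map_smul, map_smul, map_smul, h1, h2, smul_smul,
    smul_smul (sg k (((d : ℤ) + 1) * q)) (sg k q * psiSign k d p), psiSign_add, psiSign_add, add_comm q p, fst_ddBracket, lieL_lieL h]
  subst h
  module

theorem capU_uL (x : Cochain k A p) (c : ℕ → Chain k A) : capU x (uL c) = uL (capU x c) := by
  funext i
  rcases i with _ | _ | i <;> simp

/-- The image of the bracket of two cycles under `Ψ` is homologous to `± B (i_{x ∪ y} π η₀)`. -/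
theorem exists_psi_ddBracket (hη : ccL η₀.1 = 0) (h : p + q = r) {p' q' l s t : ℤ}
    {hp : p' = p + 1} {hq : q' = q + 1} (hl : p + q + 1 = l) (hs : r + s = d - 1) (ht : t = s + 1)
    {X : DD k A d p} {Y : DD k A d q} (hX : ddDiff η₀ hp X = 0) (hY : ddDiff η₀ hq Y = 0) :
    ∃ V ∈ CC k A t, ccL V = (psi η₀ hs (ddBracket h X Y)).1
      + (psiSign k d r * sg k p) • constU (connes (contr (cup hl X.1 Y.1) (η₀.1 0))) := by
  rw [ddDiff_eq_zero_iff] at hX hY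
  obtain ⟨x, m⟩ := X
  obtain ⟨y, m'⟩ := Y
  dsimp only at hX hY
  -- Because `(b + uB) m' = ± L_y η₀`, this replaces `u L_x m'` by `± I_x L_y η₀` up to a boundary;
  -- `E2` is the same with the roles exchanged.
  have E1 := ccL_capU hp x m'.1
  rw [hY.2, hX.1, capU_coe_zero, sub_zero, map_smul, smul_smul] at E1
  have E2 := ccL_capU hq y m.1
  rw [hX.2, hY.1, capU_coe_zero, sub_zero, map_smul, smul_smul] at E2
  have E3 := lieL_capU (show q + p = r by omega) hY.1 hX.1 η₀.1
  rw [hη, map_zero, smul_zero, sub_zero] at E3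
  -- The Cartan formula for `y` on `I_x η₀`, whose own differential is `u L_x η₀` by `E6`. Both
  -- terms beside the differential of `I_y I_x η₀` are divisible by `u`.
  have E5 := ccL_capU hq y (capU x η₀.1)
  have E6 := ccL_capU hp x η₀.1
  rw [hη, map_zero, smul_zero, add_zero, hX.1, capU_coe_zero, sub_zero] at E6
  rw [E6, hY.1, capU_coe_zero, sub_zero, capU_uL, ← map_smul, ← eq_sub_iff_add_eq,
    ← map_sub] at E5
  -- Cancelling `u` leaves the term `B (i_y i_x π(η₀))`: the source of `B` in the final formula.
  have E7 := eq_of_uL_eq_ccL E5.symm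
  rw [capU_zero, capU_zero, contr_contr hl] at E7
  have e1 := psiSign_add (k := k) d p q
  have e2 := psiSign_add (k := k) d q p
  have e3 : sg k ((p + 1) * (q + 1)) = -(sg k (p * q) * sg k p * sg k q) := by
    rw [← mul_neg_one, ← sg_one (k := k), ← sg_add, ← sg_add, ← sg_add]
    exact sg_eq_of_eq 0 (by ring)
  have e4 : sg k (q * p + q) = sg k (p * q) * sg k q := by rw [sg_add, mul_comm q p]
  rw [add_comm q p, h] at e2
  rw [h] at e1
  -- The primitive collects those of the two Cartan formulas, of `E7`, and the homotopy `T` of `E3`.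
  refine ⟨sg k (((d : ℤ) + 1) * p) • capU x m'.1
      - sg k (p * q) • sg k (((d : ℤ) + 1) * q) • capU y m.1
      + (psiSign k d r * sg k (p * q) * sg k q) • (shiftU (capU y (capU x η₀.1))
        - sg k p • (tOp y x).compLeft ℕ η₀.1), ?_, ?_⟩
  · refine Submodule.add_mem _ (Submodule.sub_mem _ ?_ ?_) (Submodule.smul_mem _ _
      (Submodule.sub_mem _ ?_ (Submodule.smul_mem _ _ ?_)))
    · exact Submodule.smul_mem _ _ (capU_mem (by omega) x m'.2)
    · exact Submodule.smul_mem _ _ (Submodule.smul_mem _ _ (capU_mem (by omega) y m.2))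
    · exact shiftU_mem (n := t - 2) (by omega)
        (capU_mem (n := d - (p + 1)) (by omega) y (capU_mem rfl x η₀.2))
    · exact mapCC_mem (n := d) (-q - p) (by omega) (fun n c hc => tOp_mem (by ring) y x hc) η₀.2
  · rw [coe_psi, coe_ddBracket, fst_ddBracket, gerst_comm h (by omega), capU_smul]
    dsimp only
    simp only [map_add, map_sub, map_smul, ← E1, ← E2, smul_add, smul_smul, e1]
    rw [mul_assoc (sg k (p * q)), e2]
    rw [e3, map_smul, map_smul, ← sub_eq_iff_eq_add'] at E7
    rw [← E7, E3, e4]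
    rcases sg_eq_or (k := k) q with hQ | hQ <;> rcases sg_eq_or (k := k) (p * q) with hN | hN <;>
      rcases sg_eq_or (k := k) p with hP | hP <;> rw [hQ, hN, hP] <;> module

end BracketFormula

/-! ### The transported bracket -/

noncomputable section TransportedBracket

variable {k : Type u} {A : Type v} [Field k] [CharZero k] [Ring A] [Algebra k A] {d : ℕ}
  {η₀ : CC k A d}

theorem b_piMap (hη : ccL η₀.1 = 0) : b (piMap d η₀).1 = 0 := by
  have := congrFun hη 0
  rwa [ccL_zero] at this

theorem cochainD_fst {p q r : ℤ} {hq : q = p + 1} {X : DD k A d p} (hX : ddDiff η₀ hq X = 0)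
    (hr : r = p + 1) : cochainD hr X.1 = 0 := by
  obtain rfl : r = q := by omega
  exact ((ddDiff_eq_zero_iff hq X).1 hX).1

theorem induces_piH (n : ℤ) : Induces (piMap n) (piH k A n) := induces_homMap _ _ _ _

theorem induces_connesH {n m : ℤ} (h : m = n + 1) : Induces (connesCC h) (connesH k A h) :=
  induces_homMap _ _ _ _

theorem induces_cupH {i j l : ℤ} (h : i + j = l) :
    Induces₂ (cup (sub_one_add_sub_one h)) (cupH k A h) :=
  fun _ hx _ hy => ⟨cochainD_cup_eq_zero (sub_one_add_sub_one h) _ hx hy, rfl⟩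

theorem induces_capH {d : ℤ} {c : chainDeg k A d} (hc : b c.1 = 0) (hcap : CapIso k A d c.1)
    {i n : ℤ} (h : i + n = d) :
    Induces (cap c (show n = d - (i - 1 + 1) by omega)) (capH hc hcap h).toLinearMap :=
  induces_homEquiv _ _ _ _ _ _

theorem induces_psiH (hη : ccL η₀.1 = 0) (hcap : CapIso k A d (η₀.1 0)) {p n : ℤ}
    (h : p + n = d - 1) : Induces (psi η₀ h) (psiH hη hcap h).toLinearMap :=
  induces_homEquiv _ _ _ _ _ _

/-- The cocycle component of a cycle of the twisted complex, read off from its image in the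
negative cyclic homology. -/
theorem capH_symm_piH_psiH (hη : ccL η₀.1 = 0) (hcap : CapIso k A d (η₀.1 0)) {i n : ℤ}
    (h : i - 1 + n = d - 1) (h' : i + n = d) {X : DD k A d (i - 1)}
    (hX : ddDiff η₀ rfl X = 0) (hx : cochainD (show i = i - 1 + 1 by ring) X.1 = 0) :
    (capH (b_piMap hη) hcap h').symm (piH k A n (psiH hη hcap h (cls _ _ X hX)))
      = -psiSign k d (i - 1) • cls _ _ X.1 hx := by
  rw [LinearEquiv.symm_apply_eq, map_smul]
  obtain ⟨h1, e1⟩ := induces_psiH hη hcap h X hX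
  obtain ⟨h2, e2⟩ := induces_piH n _ h1
  obtain ⟨h3, e3⟩ := induces_capH (b_piMap hη) hcap h' X.1 hx
  rw [LinearEquiv.coe_coe] at e1 e3
  rw [e1, e2, e3, ← cls_smul]
  apply cls_congr
  refine Subtype.ext ?_
  rw [coe_piMap, coe_psi, Pi.sub_apply, uL_zero, Pi.smul_apply, capU_zero, zero_sub]
  exact (neg_smul _ _).symm

/-- The bracket of two cycles of the twisted complex in terms of the cup product. -/
theorem psiH_ddBracket (hη : ccL η₀.1 = 0) (hcap : CapIso k A d (η₀.1 0))
    {p q r n m s i j l t : ℤ} (hpn : p + n = d - 1) (hqm : q + m = d - 1) (hr : p + q = r)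
    (hrs : r + s = d - 1) (hin : i + n = d) (hjm : j + m = d) (hl : i + j = l) (hlt : l + t = d)
    (hs : s = t + 1) {X : DD k A d p} {Y : DD k A d q} (hX : ddDiff η₀ rfl X = 0)
    (hY : ddDiff η₀ rfl Y = 0) :
    psiH hη hcap hrs (cls _ _ (ddBracket hr X Y) (ddDiff_ddBracket hr rfl hX hY))
      = sg k (p + d) • connesH k A hs (capH (b_piMap hη) hcap hlt (cupH k A hl
          ((capH (b_piMap hη) hcap hin).symm (piH k A n (psiH hη hcap hpn (cls _ _ X hX))))
          ((capH (b_piMap hη) hcap hjm).symm (piH k A m (psiH hη hcap hqm (cls _ _ Y hY)))))) := by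
  obtain rfl : p = i - 1 := by omega
  obtain rfl : q = j - 1 := by omega
  have hx : cochainD (show i = i - 1 + 1 by ring) X.1 = 0 := cochainD_fst hX _
  have hy : cochainD (show j = j - 1 + 1 by ring) Y.1 = 0 := cochainD_fst hY _
  rw [capH_symm_piH_psiH hη hcap hpn hin hX hx, capH_symm_piH_psiH hη hcap hqm hjm hY hy]
  obtain ⟨h1, e1⟩ := induces_cupH hl X.1 hx Y.1 hy
  obtain ⟨h2, e2⟩ := induces_capH (b_piMap hη) hcap hlt _ h1
  obtain ⟨h3, e3⟩ := induces_connesH hs _ h2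
  obtain ⟨h4, e4⟩ := induces_psiH hη hcap hrs _ (ddDiff_ddBracket hr rfl hX hY)
  rw [LinearEquiv.coe_coe] at e2 e4
  simp only [map_smul, LinearMap.smul_apply, e1, e2, e3, e4]
  rw [smul_smul, smul_smul, ← cls_smul, cls_eq_iff]
  obtain ⟨V, hV, hVe⟩ := exists_psi_ddBracket hη hr (sub_one_add_sub_one hl) hrs rfl hX hY
  refine ⟨⟨V, hV⟩, Subtype.ext ?_⟩
  -- Recovering `x` and `y` from their images costs the two factors `-psiSign`; together with the
  -- sign of `exists_psi_ddBracket` they leave `(-1)^{|X| + d}`.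
  have e : psiSign k d r * sg k (i - 1)
      = -(sg k (i - 1 + d) * -psiSign k d (j - 1) * -psiSign k d (i - 1)) := by
    rw [← hr, mul_neg, mul_neg, neg_mul, neg_neg, ← mul_neg_one, ← sg_one (k := k), psiSign,
      psiSign, psiSign, ← sg_add, ← sg_add, ← sg_add, ← sg_add]
    exact sg_eq_of_eq (-(d + 1)) (by ring)
  rw [coe_ccD, hVe, e, neg_smul, ← sub_eq_add_neg]
  rfl

/-- The bracket on the cohomology of the twisted complex. -/
def lieH (hη : ccL η₀.1 = 0) (hcap : CapIso k A d (η₀.1 0)) {p q r : ℤ} (h : p + q = r) :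
    HD η₀ p →ₗ[k] HD η₀ q →ₗ[k] HD η₀ r :=
  ((cupH k A (show p + 1 + (q + 1) = r + 2 by omega)).compl₁₂
    ((capH (b_piMap hη) hcap (show p + 1 + (d - 1 - p) = d by ring)).symm.toLinearMap ∘ₗ
      piH k A _ ∘ₗ (psiH hη hcap (add_sub_cancel p _)).toLinearMap)
    ((capH (b_piMap hη) hcap (show q + 1 + (d - 1 - q) = d by ring)).symm.toLinearMap ∘ₗ
      piH k A _ ∘ₗ (psiH hη hcap (add_sub_cancel q _)).toLinearMap)).compr₂
  (sg k (p + d) • (psiH hη hcap (add_sub_cancel r _)).symm.toLinearMap ∘ₗ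
    connesH k A (show d - 1 - r = (d - 2 - r) + 1 by ring) ∘ₗ
    (capH (b_piMap hη) hcap (by ring)).toLinearMap)

/-- `lieH` is defined as the right-hand side of the bracket formula, carried back along `Ψ`;
bilinearity and independence of representatives are thus automatic. Since `Ψ` is injective on
cohomology, `psiH_ddBracket` shows that it is the operation induced by the bracket. -/
theorem induces_lieH (hη : ccL η₀.1 = 0) (hcap : CapIso k A d (η₀.1 0)) {p q r : ℤ}
    (h : p + q = r) : Induces₂ (ddBracket h) (lieH hη hcap h) := by
  intro X hX Y hY
  refine ⟨ddDiff_ddBracket h rfl hX hY, (psiH hη hcap (add_sub_cancel r _)).injective ?_⟩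
  rw [psiH_ddBracket hη hcap (add_sub_cancel p _) (add_sub_cancel q _) h (add_sub_cancel r _)
    (show p + 1 + (d - 1 - p) = d by ring) (show q + 1 + (d - 1 - q) = d by ring)
    (show p + 1 + (q + 1) = r + 2 by omega) (show r + 2 + (d - 2 - r) = d by ring)
    (show d - 1 - r = (d - 2 - r) + 1 by ring) hX hY]
  rw [lieH, LinearMap.compr₂_apply, LinearMap.compl₁₂_apply]
  simp only [LinearMap.smul_apply, LinearMap.comp_apply, LinearEquiv.coe_coe, map_smul,
    LinearEquiv.apply_symm_apply]

end TransportedBracket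

end NCCalculus

/-! ### The theorem -/

theorem theorem10p2 {k : Type*} [Field k] [CharZero k] {A : Type*} [Ring A] [Algebra k A]
    (hA : HomologicallySmooth k A) (d : ℕ) (η₀ : CC k A d)
    (hη₀ : ccD (show (d : ℤ) = (d - 1) + 1 by ring) η₀ = 0)
    (hnd : Nondegenerate d (piMap d η₀)) :
    -- the operations on (co)homology; each is determined by the `Induces` clause below
    ∃ (capH : ∀ i n : ℤ, i + n = d → (HHCoh k A i ≃ₗ[k] HH k A n))
      (cupH : ∀ i j l : ℤ, i + j = l → HHCoh k A i →ₗ[k] HHCoh k A j →ₗ[k] HHCoh k A l)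
      (piH : ∀ n : ℤ, HC k A n →ₗ[k] HH k A n)
      (connesH : ∀ n m : ℤ, m = n + 1 → HH k A n →ₗ[k] HC k A m)
      (lieH : ∀ p q r : ℤ, p + q = r → HD η₀ p →ₗ[k] HD η₀ q →ₗ[k] HD η₀ r)
      (psiH : ∀ p n : ℤ, p + n = d - 1 → (HD η₀ p ≃ₗ[k] HC k A n)),
      (∀ (i n : ℤ) (h : i + n = d),
        Induces (cap (piMap d η₀) (by omega)) (capH i n h).toLinearMap) ∧
      (∀ (i j l : ℤ) (h : i + j = l), Induces₂ (cup (by omega)) (cupH i j l h)) ∧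
      (∀ n : ℤ, Induces (piMap n) (piH n)) ∧
      (∀ (n m : ℤ) (h : m = n + 1), Induces (connesCC h) (connesH n m h)) ∧
      (∀ (p q r : ℤ) (h : p + q = r), Induces₂ (ddBracket h) (lieH p q r h)) ∧
      (∀ (p n : ℤ) (h : p + n = d - 1), Induces (psi η₀ h) (psiH p n h).toLinearMap) ∧
      -- the bracket transported along `psiH`
      ∀ (n m : ℤ) (a : HC k A n) (c : HC k A m),
        psiH ((d - 1 - n) + (d - 1 - m)) (n + m - d + 1) (by ring)
            (lieH (d - 1 - n) (d - 1 - m) ((d - 1 - n) + (d - 1 - m)) rfl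
              ((psiH (d - 1 - n) n (by ring)).symm a) ((psiH (d - 1 - m) m (by ring)).symm c))
          = (-1 : k) ^ ((d - 1 - n) + d) •
            connesH (n + m - d) (n + m - d + 1) rfl
              (capH ((d - n) + (d - m)) (n + m - d) (by ring)
                (cupH (d - n) (d - m) ((d - n) + (d - m)) rfl
                  ((capH (d - n) n (by ring)).symm (piH n a))
                  ((capH (d - m) m (by ring)).symm (piH m c)))) := by
  have hη : ccL η₀.1 = 0 := congrArg Subtype.val hη₀
  have hcap : CapIso k A d (η₀.1 0) := capIso_of_nondegenerate hA (b_piMap hη) hnd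
  refine ⟨fun i n h => capH (b_piMap hη) hcap h, fun i j l h => cupH k A h, piH k A,
    fun n m h => connesH k A h, fun p q r h => lieH hη hcap h, fun p n h => psiH hη hcap h,
    fun i n h => induces_capH (b_piMap hη) hcap h, fun i j l h => induces_cupH h, induces_piH,
    fun n m h => induces_connesH h, fun p q r h => induces_lieH hη hcap h,
    fun p n h => induces_psiH hη hcap h, fun n m a c => ?_⟩
  -- Both classes are images under `Ψ` of classes of cycles, to which `psiH_ddBracket` applies.
  obtain ⟨X, hX, hXa⟩ :=
    exists_cls ((psiH hη hcap (show (d : ℤ) - 1 - n + n = d - 1 by ring)).symm a)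
  obtain ⟨Y, hY, hYc⟩ :=
    exists_cls ((psiH hη hcap (show (d : ℤ) - 1 - m + m = d - 1 by ring)).symm c)
  obtain ⟨hXY, e⟩ := induces_lieH hη hcap (p := (d : ℤ) - 1 - n) rfl X hX Y hY
  rw [← hXa, ← hYc, e]
  have ha := (LinearEquiv.symm_apply_eq _).1 hXa.symm
  have hc := (LinearEquiv.symm_apply_eq _).1 hYc.symm
  rw [ha, hc]
  exact psiH_ddBracket hη hcap _ _ _ _ _ _ _ _ _ hX hY
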